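/- Setting. The input is the adjacency matrix of a simple graph $G$ on $[n]$; a query asks whether a pair is an edge. An algorithm is a randomised classical query algorithm that may call quantum query subroutines (sequences of input-independent unitaries and queries $|x,a,z\rangle\mapsto|x,a\oplus G(x),z\rangle$, followed by a measurement); its query complexity is the worst-case total number of classical and quantum queries. For a graph $H$ write $\nu_H(v)$ for the neighbourhood of $v$, $t(H,a,b)$ for the number of common neighbours of $a$ and $b$, $\nu^2$ for the complete graph on $\nu$, and $H(A,B)$ for the edges of $H$ between $A$ and $B$. $\tilde O(g)$ means $O(g\,(\log n)^{k})$ for some constant $k$. Algorithm. For real $\epsilon,\delta,\epsilon'$ and a constant $c>0$, the Combinatorial Algorithm$(\epsilon,\delta,\epsilon')$ is the following. Each search in it is a Safe Grover Search: Grover's algorithm (amplitude amplification, with a random number of iterations since the number of solutions is unknown) is repeated $\lceil c\log n\rceil$ times and every measured outcome is checked. 1. Choose $\lceil 4n^{\epsilon}\log n\rceil$ random distinct nodes $v_i$ (all nodes, if there are fewer) and query all $\nu_G(v_i)$. For every $i$ search for an edge of $G$ in $\nu_G(v_i)^2$; if one is found, output the triangle it forms with $v_i$. 2. Let $G'=[n]^2\setminus\bigcup_i\nu_G(v_i)^2$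 and $T=E=\emptyset$. While $G'\ne\emptyset$: (a) while $G'$ has an edge $(v,w)$ with $t(G',v,w)<n^{1-\epsilon'}$, move it from $G'$ to $T$; (b) if $G'\neq\emptyset$, pick a node $v$ of non-zero degree in $G'$, and $\lceil c\log n\rceil$ times query $\lceil n^{\delta}\rceil$ random pairs from $\{v\}\times[n]$ (all of them, if there are fewer), calling a round successful if one of these pairs is an edge of $G\cap G'$; (c) if fewer than half of the rounds succeed, move all edges of $G'$ at $v$ to $E$; (d) otherwise query $\nu_G(v)$, search for an edge of $G$ in $\nu_G(v)^2$, output the triangle it forms with $v$ if one is found, and else move $G'(\nu_{G\cap G'}(v),\nu_{G'}(v))$ from $G'$ to $E$. 3. Search for a triangle of $G$ among all triangles of $T$; then search for a triangle of $G$ with an edge in $E$, by amplitude amplification of a Grover search for an edge of $G\cap E$ followed by a Grover search for the third node, with the guesses $1,2,4,\dots,\le |E|$ for $|G\cap E|$ in turn. Output a triangle if one is found, otherwise reject. A counter makes the algorithm reject and stop before the number of queries exceeds a threshold $B(n)$. Theorem. For every sufficiently large constant $c$ and all $0<\epsilon<1$, $\delta\ge 0$, $\epsilon'\ge 0$ there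 is a threshold $B(n)$, depending only on $n,\epsilon,\delta,\epsilon',c$, such that the Combinatorial Algorithm$(\epsilon,\delta,\epsilon')$ rejects with probability one if $G$ has no triangle, otherwise returns a triangle of $G$ with probability $1-O(1/n)$, and has query complexity $$\tilde O\Bigl(n^{1+\epsilon}+n^{1+\delta+\epsilon'}+\sqrt{n^{3-\epsilon'}}+\sqrt{n^{3-\min(\delta,\,\epsilon-\delta-\epsilon')}}\Bigr).$$ All its quantum subroutines are Grover searches. In particular, with $\epsilon=3/7$ and $\delta=\epsilon'=1/7$ the query complexity is $\tilde O(n^{10/7})$. -/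

import Mathlib

noncomputable section

/-! ### The quantum query model -/

namespace QQuery

/-- Basis states `|x, a, z⟩`: query register, answer bit, work register. -/
abbrev Basis (X W : Type) : Type := X × Bool × W

/-- The state space spanned by the basis states, with the `ℓ²` norm. -/
abbrev State (X W : Type) [Fintype X] [Fintype W] : Type := EuclideanSpace ℂ (Basis X W)

/-- Unitary operators on a finite-dimensional space with a fixed orthonormal basis `β`. -/
abbrev UnitaryOp (β : Type) [Fintype β] : Type := EuclideanSpace ℂ β ≃ₗᵢ[ℂ] EuclideanSpace ℂ β

/-- The basis permutation `(x, a, z) ↦ (x, a ⊕ f x, z)`. -/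
def oraclePerm {X W : Type} (f : X → Bool) : Equiv.Perm (Basis X W) where
  toFun b := (b.1, xor b.2.1 (f b.1), b.2.2)
  invFun b := (b.1, xor b.2.1 (f b.1), b.2.2)
  left_inv b := by simp
  right_inv b := by simp

/-- The unitary that maps the basis state `|b⟩` to `|σ b⟩`. -/
def permOp {β : Type} [Fintype β] (σ : Equiv.Perm β) : UnitaryOp β :=
  LinearIsometryEquiv.piLpCongrLeft 2 ℂ ℂ σ

/-- One operation of a query algorithm: a unitary that does not depend on the input, or the query
operation `O_f`. -/
inductive Gate (X W : Type) [Fintype X] [Fintype W] : Type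
  | unitary (U : UnitaryOp (Basis X W)) : Gate X W
  | query : Gate X W

/-- A quantum query algorithm: a sequence of operations, the head of the list being applied first.
Merging consecutive unitaries gives the form `U₀, O_f, U₁, O_f, …, O_f, U_k`. -/
abbrev Circuit (X W : Type) [Fintype X] [Fintype W] : Type := List (Gate X W)

section Circuits

variable {X W : Type} [Fintype X] [Fintype W]

/-- The operator of a gate on the oracle input `f`. -/
def Gate.op (f : X → Bool) : Gate X W → UnitaryOp (Basis X W)
  | .unitary U => U
  | .query => permOp (oraclePerm f)

/-- The inverse gate (`O_f` is its own inverse). -/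
def Gate.inv : Gate X W → Gate X W
  | .unitary U => .unitary U.symm
  | .query => .query

/-- The number of queries of a gate. -/
def Gate.cost : Gate X W → ℕ
  | .unitary _ => 0
  | .query => 1

/-- The number of queries of a circuit. -/
def Circuit.cost (C : Circuit X W) : ℕ := (C.map Gate.cost).sum

/-- The inverse circuit. -/
def Circuit.inv (C : Circuit X W) : Circuit X W := (C.map Gate.inv).reverse

/-- The state reached from `ψ` by running the circuit on the oracle input `f`. -/
def Circuit.apply (f : X → Bool) (C : Circuit X W) (ψ : State X W) : State X W :=
  C.foldl (fun φ g => g.op f φ) ψ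

/-- The basis state `|b⟩`. -/
def ket {β : Type} [Fintype β] (b : β) : EuclideanSpace ℂ β := EuclideanSpace.basisFun β ℂ b

theorem norm_ket {β : Type} [Fintype β] (b : β) : ‖ket b‖ = 1 :=
  (EuclideanSpace.basisFun β ℂ).orthonormal.1 b

theorem Circuit.norm_apply (f : X → Bool) (C : Circuit X W) (ψ : State X W) :
    ‖C.apply f ψ‖ = ‖ψ‖ := by
  induction C generalizing ψ with
  | nil => rfl
  | cons g C ih =>
    have h := ih (g.op f ψ)
    rw [LinearIsometryEquiv.norm_map] at h
    exact h

theorem born_sum {β : Type} [Fintype β] (ψ : EuclideanSpace ℂ β) (h : ‖ψ‖ = 1) :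
    ∑ b, ENNReal.ofReal (‖ψ b‖ ^ 2) = 1 := by
  rw [← ENNReal.ofReal_sum_of_nonneg (fun b _ => sq_nonneg _), ← EuclideanSpace.norm_sq_eq, h]
  simp

/-- The outcome of running the circuit from the basis state `|b₀⟩` and measuring all registers in
the computational basis. -/
def Circuit.measure (f : X → Bool) (C : Circuit X W) (b₀ : Basis X W) : PMF (Basis X W) :=
  PMF.ofFintype (fun b => ENNReal.ofReal (‖C.apply f (ket b₀) b‖ ^ 2))
    (born_sum _ ((C.norm_apply f _).trans (norm_ket b₀)))

end Circuits

/-! ### Grover search -/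

/-- The operator `U ⊗ 1` when the register of `U` is split off by `e`. -/
def onRegister {β α κ : Type} [Fintype β] [Fintype α] [Fintype κ] (e : β ≃ α × κ)
    (U : UnitaryOp α) : UnitaryOp β :=
  let r := (LinearIsometryEquiv.piLpCongrLeft 2 ℂ ℂ
    (e.trans ((Equiv.prodComm α κ).trans (Equiv.sigmaEquivProd κ α).symm))).trans
      (LinearIsometryEquiv.piLpCurry ℂ 2 (fun (_ : κ) (_ : α) => ℂ))
  r.trans ((LinearIsometryEquiv.piLpCongrRight 2 (fun _ : κ => U)).trans r.symm)

/-- The uniform superposition over a finite set of items (`none` is the blank register). -/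
def uniformKet {ι : Type} [Fintype ι] (S : Finset ι) : EuclideanSpace ℂ (Option ι) :=
  ((1 / Real.sqrt S.card : ℝ) : ℂ) • ∑ i ∈ S, ket (some i)

/-- A unitary that exchanges the blank register with the uniform superposition over `S`
(for nonempty `S`): the reflection that fixes the orthogonal complement of their difference. -/
def uniformOp {ι : Type} [Fintype ι] (S : Finset ι) : UnitaryOp (Option ι) :=
  (ℂ ∙ (ket none - uniformKet S))ᗮ.reflection

open Classical in
/-- The phase operator `|b⟩ ↦ -|b⟩` for `b ∈ P` and `|b⟩ ↦ |b⟩` otherwise. -/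
def phaseOp {β : Type} [Fintype β] (P : Set β) : UnitaryOp β :=
  LinearIsometryEquiv.piLpCongrRight 2
    (fun b => if b ∈ P then LinearIsometryEquiv.neg ℂ else LinearIsometryEquiv.refl ℂ ℂ)

section Grover

variable {X W : Type} [Fintype X] [Fintype W]

/-- A reversible classical computation step. -/
def permGate (σ : Equiv.Perm (Basis X W)) : Gate X W := .unitary (permOp σ)

/-- Prepare the uniform superposition over `S` in the item register split off by `e`. -/
def prepare {ι κ : Type} [Fintype ι] [Fintype κ] (e : W ≃ Option ι × κ) (S : Finset ι) :
    Gate X W :=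
  .unitary (onRegister
    (⟨fun b => ((e b.2.2).1, b.1, b.2.1, (e b.2.2).2),
      fun c => (c.2.1, c.2.2.1, e.symm (c.1, c.2.2.2)),
      fun b => by simp, fun c => by simp⟩ : Basis X W ≃ Option ι × (X × Bool × κ))
    (uniformOp S))

/-- Grover's algorithm started from the circuit `A`: run `A`, then `s` Grover iterations, each of
which flips the phase of the good basis states, undoes `A`, flips the phase of the start states
and redoes `A`. -/
def amplify (A : Circuit X W) (start good : Set (Basis X W)) (s : ℕ) : Circuit X W :=
  A ++ (List.replicate s
    ([Gate.unitary (phaseOp good)] ++ A.inv ++ [Gate.unitary (phaseOp start)] ++ A)).flatten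

/-- The circuits of Grover search: they consist of reversible classical steps, queries, preparations
of uniform superpositions, and Grover iterations. -/
inductive IsGrover : Circuit X W → Prop
  | nil : IsGrover []
  | perm (σ : Equiv.Perm (Basis X W)) : IsGrover [permGate σ]
  | query : IsGrover [Gate.query]
  | prepare {ι κ : Type} [Fintype ι] [Fintype κ] (e : W ≃ Option ι × κ) (S : Finset ι)
      (hS : S.Nonempty) : IsGrover [prepare e S]
  | append {C D : Circuit X W} (hC : IsGrover C) (hD : IsGrover D) : IsGrover (C ++ D)
  | amplify {A : Circuit X W} (hA : IsGrover A) (start good : Set (Basis X W)) (s : ℕ) :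
      IsGrover (amplify A start good s)

end Grover

section Lookup

variable {X D : Type} {r : ℕ}

/-- Copy the position `p d` into a query register that holds `x₀`, or erase it again. -/
def loadPerm [DecidableEq X] (x₀ : X) (p : D → X) : Equiv.Perm (Basis X (D × (Fin r → Bool))) where
  toFun b := (Equiv.swap x₀ (p b.2.2.1) b.1, b.2)
  invFun b := (Equiv.swap x₀ (p b.2.2.1) b.1, b.2)
  left_inv b := by simp
  right_inv b := by simp

/-- Exchange the answer bit with the `i`-th bit of the work register. -/
def storePerm (i : Fin r) : Equiv.Perm (Basis X (D × (Fin r → Bool))) where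
  toFun b := (b.1, b.2.2.2 i, b.2.2.1, Function.update b.2.2.2 i b.2.1)
  invFun b := (b.1, b.2.2.2 i, b.2.2.1, Function.update b.2.2.2 i b.2.1)
  left_inv b := by simp
  right_inv b := by simp

/-- Query the position `p d` and keep the answer in the `i`-th bit of the work register. -/
def lookup [Fintype X] [DecidableEq X] [Fintype D] (x₀ : X) (p : D → X) (i : Fin r) :
    Circuit X (D × (Fin r → Bool)) :=
  [permGate (loadPerm x₀ p), Gate.query, permGate (storePerm i), permGate (loadPerm x₀ p)]

/-- The initial basis state: all registers blank. -/
def blank {ι : Type} (x₀ : X) (d₀ : ι) : Basis X (ι × (Fin r → Bool)) :=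
  (x₀, false, d₀, fun _ => false)

/-- Grover search with `j` iterations on the database `S`, in which the item `i` is marked when the
oracle bits at all the positions `p 0 i, …, p (r - 1) i` are `1`. -/
def searchCircuit [Fintype X] [DecidableEq X] {ι : Type} [Fintype ι] (x₀ : X) (S : Finset ι)
    (p : Fin r → ι → X) (j : ℕ) : Circuit X (Option ι × (Fin r → Bool)) :=
  amplify
    (prepare (Equiv.refl _) S ::
      (List.finRange r).flatMap fun i => lookup x₀ (fun o => o.elim x₀ (p i)) i)
    {blank x₀ none} {b | ∀ i, b.2.2.2 i = true} j

end Lookup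

/-! ### Randomised algorithms with quantum subroutines -/

/-- Classical randomised query algorithms with quantum subroutines, as decision trees: stop with a
result; make one classical query; draw a uniformly random element of a finite nonempty set; run a
quantum query algorithm from a basis state and measure it. -/
inductive Prog (X : Type) [Fintype X] (α : Type) : Type 1
  | ret (a : α) : Prog X α
  | query (x : X) (k : Bool → Prog X α) : Prog X α
  | choose {β : Type} (S : Finset β) (hS : S.Nonempty) (k : β → Prog X α) : Prog X α
  | quantum {W : Type} [Fintype W] (C : Circuit X W) (b₀ : Basis X W)
      (k : Basis X W → Prog X α) : Prog X α

namespace Prog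

variable {X : Type} [Fintype X] {α β : Type}

/-- Sequential composition. -/
def bind (p : Prog X α) (g : α → Prog X β) : Prog X β :=
  match p with
  | ret a => g a
  | query x k => query x fun b => (k b).bind g
  | choose S hS k => choose S hS fun b => (k b).bind g
  | quantum C b₀ k => quantum C b₀ fun b => (k b).bind g

instance : Monad (Prog X) where
  pure := ret
  bind := bind

/-- The distribution of the result on the oracle input `f`. -/
def run (f : X → Bool) : Prog X α → PMF α
  | ret a => PMF.pure a
  | query x k => (k (f x)).run f
  | choose S hS k => (PMF.uniformOfFinset S hS).bind fun b => (k b).run f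
  | quantum C b₀ k => (C.measure f b₀).bind fun b => (k b).run f

/-- The worst-case number of queries, classical and quantum, over all branches. -/
def queries : Prog X α → ℕ
  | ret _ => 0
  | query _ k => 1 + Finset.univ.sup fun b => (k b).queries
  | choose S _ k => S.sup fun b => (k b).queries
  | quantum C _ k => C.cost + Finset.univ.sup fun b => (k b).queries

/-- All quantum subroutines are Grover searches. -/
def OnlyGrover : Prog X α → Prop
  | ret _ => True
  | query _ k => ∀ b, (k b).OnlyGrover
  | choose S _ k => ∀ b ∈ S, (k b).OnlyGrover
  | quantum C _ k => IsGrover C ∧ ∀ b, (k b).OnlyGrover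

/-- Run with a counter for the queries: reject and stop as soon as the next operation would make the
number of queries exceed `B`. -/
def withThreshold : Prog X (Option α) → ℕ → Prog X (Option α)
  | ret a, _ => ret a
  | query x k, B => if 1 ≤ B then query x fun b => (k b).withThreshold (B - 1) else ret none
  | choose S hS k, B => choose S hS fun b => (k b).withThreshold B
  | quantum C b₀ k, B =>
      if C.cost ≤ B then quantum C b₀ fun b => (k b).withThreshold (B - C.cost) else ret none

/-- One classical query. -/
def ask (x : X) : Prog X Bool := query x ret

/-- A uniformly random element. -/
def random {β : Type} (S : Finset β) (hS : S.Nonempty) : Prog X β := choose S hS ret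

/-- A uniformly random element of `{0, …, m}`. -/
def randomUpTo (m : ℕ) : Prog X ℕ := random (Finset.range (m + 1)) Finset.nonempty_range_add_one

/-- Query all the listed positions. -/
def askAll : List X → Prog X (List Bool)
  | [] => ret []
  | x :: l => do
      let b ← ask x
      let bs ← askAll l
      return b :: bs

/-- Try `t` up to `R` times, until it returns something. -/
def attempts (t : Prog X (Option α)) : ℕ → Prog X (Option α)
  | 0 => ret none
  | R + 1 => do
      match ← t with
      | some a => return some a
      | none => attempts t R

/-- Go through a list until the search `t` returns something. -/
def firstSome (t : β → Prog X (Option α)) : List β → Prog X (Option α)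
  | [] => ret none
  | b :: l => do
      match ← t b with
      | some a => return some a
      | none => firstSome t l

/-- Check the measured candidate `o`: return it if all its positions hold `1`. -/
def verify {ι : Type} (positions : ι → List X) : Option ι → Prog X (Option ι)
  | none => ret none
  | some i => do
      let bs ← askAll (positions i)
      return if bs.all id then some i else none

/-- Safe Grover Search on the database `S`, where `i` is marked if the oracle bits at `p 0 i, …` are
all `1`: `R` times, run Grover's algorithm with a random number of at most about `√|S|` iterations
(the number of marked items being unknown), measure, and check the outcome.  An empty database is
rejected at once. -/
def safeGrover [DecidableEq X] {ι : Type} [Fintype ι] {r : ℕ} (x₀ : X) (R : ℕ) (S : Finset ι)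
    (p : Fin r → ι → X) : Prog X (Option ι) :=
  if S.Nonempty then
    attempts (do
      let j ← randomUpTo ⌈Real.sqrt S.card⌉₊
      let b ← quantum (searchCircuit x₀ S p j) (blank x₀ none) ret
      verify (fun i => List.ofFn fun k => p k i) b.2.2.1) R
  else ret none

end Prog

end QQuery

/-! ### The Combinatorial Algorithm for finding triangles -/

namespace Triangle

open QQuery Prog

/-- The oracle input: the adjacency matrix of `G`. -/
def adjMatrix {n : ℕ} (G : SimpleGraph (Fin n)) : Fin n × Fin n → Bool :=
  open Classical in fun p => decide (G.Adj p.1 p.2)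

/-- The triple is a triangle of `G`. -/
def IsTriangle {n : ℕ} (G : SimpleGraph (Fin n)) (t : Fin n × Fin n × Fin n) : Prop :=
  G.Adj t.1 t.2.1 ∧ G.Adj t.1 t.2.2 ∧ G.Adj t.2.1 t.2.2

/-- Query algorithms on (the adjacency matrix of) a graph on `n` nodes. -/
abbrev GProg (n : ℕ) (α : Type) : Type 1 := Prog (Fin n × Fin n) α

section Nodes

variable {n : ℕ}

/-- `m` random distinct nodes (all the nodes if `m > n`). -/
def randomNodes (n m : ℕ) : GProg n (List (Fin n)) := do
  let v ← random (Finset.univ : Finset (Fin (min m n) ↪ Fin n))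
    ⟨Fin.castLEEmb (min_le_right m n), Finset.mem_univ _⟩
  return List.ofFn v

/-- Query all pairs `(v, w)` with `w ≠ v` and return the neighbourhood of `v`. -/
def neighbourhood (v : Fin n) : GProg n (Finset (Fin n)) := do
  let l := (List.finRange n).filter (· ≠ v)
  let bs ← askAll (l.map fun w => (v, w))
  return ((l.zip bs).filterMap fun q => if q.2 then some q.1 else none).toFinset

/-- Compute the neighbourhoods of all the listed nodes. -/
def neighbourhoods : List (Fin n) → GProg n (List (Fin n × Finset (Fin n)))
  | [] => ret []
  | v :: l => do
      let A ← neighbourhood v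
      let L ← neighbourhoods l
      return (v, A) :: L

/-- `t(H, a, b)`: the number of paths of length two from `a` to `b` in `H`. -/
def numPaths (H : SimpleGraph (Fin n)) (a b : Fin n) : ℕ := {x | H.Adj a x ∧ H.Adj b x}.ncard

/-- The complete graph minus the complete graphs on the sets in the list. -/
def remaining (L : List (Fin n × Finset (Fin n))) : SimpleGraph (Fin n) where
  Adj a b := a ≠ b ∧ ∀ q ∈ L, ¬(a ∈ q.2 ∧ b ∈ q.2)
  symm := ⟨fun _ _ h => ⟨h.1.symm, fun q hq h' => h.2 q hq h'.symm⟩⟩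
  loopless := ⟨fun _ h => h.1 rfl⟩

/-- The state of the classification: the known graphs `T`, `E` and the not yet classified `G'`. -/
structure ClassState (n : ℕ) where
  T : SimpleGraph (Fin n)
  E : SimpleGraph (Fin n)
  G' : SimpleGraph (Fin n)

open Classical in
/-- If `G'` has an edge `(v, w)` with `t(G', v, w) < τ`, move such an edge to `T`. -/
def moveToT (τ : ℝ) (s : ClassState n) : ClassState n :=
  if h : ∃ e : Fin n × Fin n, s.G'.Adj e.1 e.2 ∧ (numPaths s.G' e.1 e.2 : ℝ) < τ then
    let e := h.choose
    { s with T := s.T ⊔ SimpleGraph.edge e.1 e.2, G' := s.G' \ SimpleGraph.edge e.1 e.2 }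
  else s

/-- While there is an edge `(v, w)` of `G'` with `t(G', v, w) < τ`, move it to `T`.  As `G'` has fewer
than `n ^ 2` edges, `n ^ 2` rounds suffice. -/
def moveAllToT (τ : ℝ) (s : ClassState n) : ClassState n := (moveToT τ)^[n ^ 2] s

/-- Move the edges of `G'` between `A` and `A'` to `E`. -/
def moveToE (A A' : Set (Fin n)) (s : ClassState n) : ClassState n :=
  { s with E := s.E ⊔ s.G'.between A A', G' := s.G' \ s.G'.between A A' }

/-- One round of sampling: query `⌈n ^ δ⌉` random edge candidates in `v × [n]` and tell whether
there is an edge of `G ∩ G'` among them. -/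
def sampleRound (δ : ℝ) (G' : SimpleGraph (Fin n)) (v : Fin n) : GProg n Bool := do
  let l ← randomNodes n ⌈(n : ℝ) ^ δ⌉₊
  let bs ← askAll (l.map fun w => (v, w))
  return open Classical in (l.zip bs).any fun q => q.2 && decide (G'.Adj v q.1)

/-- The number of successful sampling rounds out of `K`. -/
def sampleCount (δ : ℝ) (G' : SimpleGraph (Fin n)) (v : Fin n) : ℕ → GProg n ℕ
  | 0 => ret 0
  | K + 1 => do
      let b ← sampleRound δ G' v
      let C ← sampleCount δ G' v K
      return if b then C + 1 else C

/-- Decide whether to accept the high degree hypothesis (`true`) or the low degree hypothesis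
(`false`, if fewer than half of the `K = ⌈c log n⌉` rounds are successful). -/
def acceptHigh (c δ : ℝ) (G' : SimpleGraph (Fin n)) (v : Fin n) : GProg n Bool := do
  let C ← sampleCount δ G' v ⌈c * Real.log n⌉₊
  return decide (⌈c * Real.log n⌉₊ ≤ 2 * C)

end Nodes

section Algorithm

variable {n : ℕ} [NeZero n]

/-- The number of repetitions in each search. -/
def reps (c : ℝ) (n : ℕ) : ℕ := ⌈c * Real.log n⌉₊

/-- If `G` has an edge inside the neighbourhood `A` of `v`, find the triangle it forms with `v`. -/
def searchNeighbourhood (c : ℝ) (v : Fin n) (A : Finset (Fin n)) :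
    GProg n (Option (Fin n × Fin n × Fin n)) := do
  let o ← safeGrover 0 (reps c n) ((A ×ˢ A).filter fun e => e.1 < e.2)
    (fun (_ : Fin 1) (e : Fin n × Fin n) => e)
  return o.map fun e => (v, e.1, e.2)

open Classical in
/-- The outer loop of the classification, for at most `fuel` rounds, followed by `k`.  It either
outputs a triangle and stops or hands over to `k`. -/
def classify (c δ ε' : ℝ) (k : SimpleGraph (Fin n) → SimpleGraph (Fin n) →
      GProg n (Option (Fin n × Fin n × Fin n))) :
    ℕ → ClassState n → GProg n (Option (Fin n × Fin n × Fin n))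
  | 0, _ => ret none
  | fuel + 1, s₀ =>
      let s := moveAllToT ((n : ℝ) ^ (1 - ε')) s₀
      if h : ∃ v, ∃ w, s.G'.Adj v w then
        let v := h.choose
        do
          if ← acceptHigh c δ s.G' v then
            let A ← neighbourhood v
            match ← searchNeighbourhood c v A with
            | some t => return some t
            | none =>
              classify c δ ε' k fuel
                (moveToE ({x | x ∈ A} ∩ s.G'.neighborSet v) (s.G'.neighborSet v) s)
          else
            classify c δ ε' k fuel (moveToE {v} Set.univ s)
      else k s.T s.E

open Classical in
/-- Search for a triangle of `G` among all the triangles of the known graph `T`. -/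
def searchTriangles (c : ℝ) (T : SimpleGraph (Fin n)) :
    GProg n (Option (Fin n × Fin n × Fin n)) :=
  safeGrover 0 (reps c n)
    (Finset.univ.filter fun t : Fin n × Fin n × Fin n => t.1 < t.2.1 ∧ t.2.1 < t.2.2 ∧ IsTriangle T t)
    (fun (i : Fin 3) t => ![(t.1, t.2.1), (t.1, t.2.2), (t.2.1, t.2.2)] i)

/-- Work register for the search of a triangle with an edge in a known graph: an edge register, a node
register and the three answers. -/
abbrev EdgeWork (n : ℕ) : Type := (Option (Fin n × Fin n) × Option (Fin n)) × (Fin 3 → Bool)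

/-- The three pairs of the triangle formed by the edge register and the node register. -/
def edgePos (i : Fin 3) (d : Option (Fin n × Fin n) × Option (Fin n)) : Fin n × Fin n :=
  match d with
  | (some e, some w) => ![e, (e.1, w), (e.2, w)] i
  | (some e, none) => if i = 0 then e else 0
  | (none, _) => 0

/-- Grover search for an edge of `G` in `S`, with `j` iterations. -/
def edgeStage (S : Finset (Fin n × Fin n)) (j : ℕ) : Circuit (Fin n × Fin n) (EdgeWork n) :=
  amplify (prepare (Equiv.prodAssoc _ _ _) S :: lookup 0 (edgePos 0) 0)
    {blank 0 (none, none)} {b | b.2.2.2 0 = true} j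

/-- Grover search, with `l` iterations and for the edge held in the edge register, for a node adjacent
to both of its ends. -/
def nodeStage (l : ℕ) : Circuit (Fin n × Fin n) (EdgeWork n) :=
  amplify
    (prepare (((Equiv.prodComm _ _).prodCongr (Equiv.refl _)).trans (Equiv.prodAssoc _ _ _))
        (Finset.univ : Finset (Fin n)) ::
      (lookup 0 (edgePos 1) 1 ++ lookup 0 (edgePos 2) 2))
    {b | b.1 = 0 ∧ b.2.1 = false ∧ b.2.2.1.2 = none ∧ b.2.2.2 1 = false ∧ b.2.2.2 2 = false}
    {b | b.2.2.2 1 = true ∧ b.2.2.2 2 = true} l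

/-- Amplitude amplification, with `s` iterations, of the edge search followed by the node search. -/
def edgeTriangleCircuit (S : Finset (Fin n × Fin n)) (j l s : ℕ) :
    Circuit (Fin n × Fin n) (EdgeWork n) :=
  amplify (edgeStage S j ++ nodeStage l) {blank 0 (none, none)} {b | ∀ i, b.2.2.2 i = true} s

open Classical in
/-- Search for a triangle of `G` with an edge in the known graph `E`.  The number of edges of `G ∩ E`
is unknown, so it is guessed as `1, 2, 4, …` in turn; each guess `2 ^ i` is tried `⌈c log n⌉` times,
with random numbers of iterations. -/
def searchEdgeTriangles (c : ℝ) (E : SimpleGraph (Fin n)) :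
    GProg n (Option (Fin n × Fin n × Fin n)) :=
  let S := Finset.univ.filter fun e : Fin n × Fin n => e.1 < e.2 ∧ E.Adj e.1 e.2
  if S.Nonempty then
    firstSome (fun i : ℕ => attempts (do
      let j ← randomUpTo ⌈Real.sqrt (S.card / 2 ^ i)⌉₊
      let l ← randomUpTo ⌈Real.sqrt n⌉₊
      let s ← randomUpTo ⌈c * Real.sqrt (2 ^ i)⌉₊
      let b ← quantum (edgeTriangleCircuit S j l s) (blank 0 (none, none)) ret
      verify (fun t => [(t.1, t.2.1), (t.1, t.2.2), (t.2.1, t.2.2)])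
        (b.2.2.1.1.bind fun e => b.2.2.1.2.map fun w => (e.1, e.2, w))) (reps c n))
      (List.range (Nat.log 2 S.card + 1))
  else ret none

/-- All the steps of the algorithm, without the counter. -/
def steps (ε δ ε' c : ℝ) (fuel : ℕ) : GProg n (Option (Fin n × Fin n × Fin n)) := do
  let vs ← randomNodes n ⌈4 * (n : ℝ) ^ ε * Real.log n⌉₊
  let L ← neighbourhoods vs
  match ← firstSome (fun q : Fin n × Finset (Fin n) => searchNeighbourhood c q.1 q.2) L with
  | some t => return some t
  | none =>
    classify c δ ε' (fun T E => do
      match ← searchTriangles c T with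
      | some t => return some t
      | none => searchEdgeTriangles c E) fuel ⟨⊥, ⊥, remaining L⟩

end Algorithm

/-- The Combinatorial Algorithm with parameters `ε, δ, ε'` on graphs with `n` nodes, with the constant
`c` in its sampling and search steps, and with the threshold `B` of its query counter.  `some t` means
that the triangle `t` is returned and `none` that the algorithm rejects.  (Every round of the
classification makes a query when `n ≥ 2` and `c > 0`, so that the bound `B + 1` on the number of
rounds does not take effect before the threshold does.) -/
def combinatorialAlgorithm (ε δ ε' c : ℝ) (n B : ℕ) : GProg n (Option (Fin n × Fin n × Fin n)) :=
  match n with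
  | 0 => ret none
  | n + 1 => (steps (n := n + 1) ε δ ε' c (B + 1)).withThreshold B

/-- `F = Õ(g)`: `F(n) = O(g(n) (log n) ^ k)` for some `k`. -/
def SoftO (F g : ℕ → ℝ) : Prop :=
  ∃ k : ℕ, F =O[Filter.atTop] fun n => g n * Real.log n ^ k

/-- The family of algorithms rejects with probability one if there is no triangle, and otherwise
returns a triangle with probability `1 - O(1 / n)`. -/
def FindsTriangles (A : ∀ n : ℕ, GProg n (Option (Fin n × Fin n × Fin n))) : Prop :=
  (∀ (n : ℕ) (G : SimpleGraph (Fin n)), (∀ t, ¬IsTriangle G t) →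
    (A n).run (adjMatrix G) = PMF.pure none) ∧
  ∃ C : ℝ, ∀ (n : ℕ) (G : SimpleGraph (Fin n)), (∃ t, IsTriangle G t) →
    1 - C / n ≤
      (((A n).run (adjMatrix G)).toOuterMeasure {o | ∃ t, o = some t ∧ IsTriangle G t}).toReal

/-- The family finds triangles, has query complexity `Õ(g)`, and its quantum subroutines are Grover
searches. -/
def FindsTrianglesWithin (A : ∀ n : ℕ, GProg n (Option (Fin n × Fin n × Fin n))) (g : ℕ → ℝ) :
    Prop :=
  FindsTriangles A ∧ SoftO (fun n => ((A n).queries : ℝ)) g ∧ ∀ n, (A n).OnlyGrover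

end Triangle

end

/-!
The algorithm never outputs a triple that it has not checked, so the only issues are the probability
of missing a triangle and the number of queries.  Both are handled by one quantity,
`Prog.failure f Q p B`: the probability that the program `p` makes more than `B` queries or ends
outside `Q`.  It satisfies a union bound along sequential composition (`failure_bind_le_add`), and
bounds the failure probability of the program with a query counter from above (`one_sub_failure_le`).
Thus the threshold can be the sum of the budgets of the individual steps, and the error the sum of
their errors, each of which is polynomially small once the constant `c` is large.

*Grover search.*  If a circuit reaches the good states with probability `sin² θ`, then `s` Grover
iterations reach them with probability `sin² ((2s + 1) θ)`, and for `s` drawn uniformly from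
`{0, …, m}` with `m` at least `1 / sin θ` the average of this is bounded below by a constant
(`average_sin_sq`); so a repetition of `⌈c log n⌉` such attempts fails with probability at most
`n ^ (-4)`.  For the triangles with an edge in `E` the same estimate is applied to the inner searches
for an edge and for a node, and then to the circuit composed of both (`failure_edgeAttempt_le`); with
the right guess for the number of edges of `G ∩ E`, one attempt makes
`O(n + √(n |G ∩ E|))` queries.

*Classification.*  The first step covers, with high probability, all pairs with more than `n ^ (1 - ε)`
common neighbours (`failure_randomNodes_cover`), so afterwards each edge of `G'` closes at most
`n ^ (1 - ε)` paths of length two in `G`.  By Chernoff's bound the sampling distinguishes nodes with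
more than about `n ^ (1 - δ)` neighbours in `G ∩ G'` from those with fewer
(`failure_acceptHigh_le`).  A round with the low degree hypothesis isolates a node in `G'`, hence
there are at most `n` of them, each of which puts `O(n ^ (1 - δ))` edges of `G` into `E`.  In a round
with the high degree hypothesis at least about `n ^ (1 - δ) n ^ (1 - ε')` edges leave `G'`, since
the ends of each edge of `G'` have at least `n ^ (1 - ε')` common neighbours in `G'`; hence there are
`O(n ^ (δ + ε'))` such rounds, each of which puts `O(n n ^ (1 - ε))` edges of `G` into `E`.  An edge
that moves to `T` has fewer than `n ^ (1 - ε')` common neighbours in `G'`, so `T` has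
`O(n ^ (3 - ε'))` triangles in the end (`Inv`).  `failure_classify_le` is the induction over the
rounds, and `cast_threshold_le` adds up the resulting budgets.
-/

/-! ### A program logic for randomised query algorithms -/

namespace QQuery.Prog

variable {X : Type} [Fintype X] {α β : Type}

/-- Every branch that is consistent with the oracle input `f` ends with a result in `Q`, whatever
the random choices and the measured outcomes (of non-zero amplitude) are. -/
def Always (f : X → Bool) (Q : α → Prop) : Prog X α → Prop
  | ret a => Q a
  | query x k => (k (f x)).Always f Q
  | choose S _ k => ∀ b ∈ S, (k b).Always f Q
  | quantum C b₀ k => ∀ b, C.apply f (ket b₀) b ≠ 0 → (k b).Always f Q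

open Classical in
/-- The probability, on the oracle input `f`, that the program makes more than `B` queries or ends
with a result outside `Q`. -/
noncomputable def failure (f : X → Bool) (Q : α → Prop) : Prog X α → ℕ → ℝ
  | ret a, _ => if Q a then 0 else 1
  | query x k, B => if 1 ≤ B then (k (f x)).failure f Q (B - 1) else 1
  | choose S _ k, B => (∑ b ∈ S, (k b).failure f Q B) / S.card
  | quantum C b₀ k, B =>
      if C.cost ≤ B then
        ∑ b, ‖C.apply f (ket b₀) b‖ ^ 2 * (k b).failure f Q (B - C.cost)
      else 1

variable {f : X → Bool}

open Classical in
theorem failure_ret (Q : α → Prop) (a : α) (B : ℕ) :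
    (ret a : Prog X α).failure f Q B = if Q a then 0 else 1 := rfl

theorem failure_query (Q : α → Prop) (x : X) (k : Bool → Prog X α) (B : ℕ) :
    (query x k).failure f Q B = if 1 ≤ B then (k (f x)).failure f Q (B - 1) else 1 := rfl

theorem failure_choose {γ : Type} (Q : α → Prop) (S : Finset γ) (hS : S.Nonempty)
    (k : γ → Prog X α) (B : ℕ) :
    (choose S hS k).failure f Q B = (∑ b ∈ S, (k b).failure f Q B) / S.card := rfl

theorem failure_quantum {W : Type} [Fintype W] (Q : α → Prop) (C : Circuit X W) (b₀ : Basis X W)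
    (k : Basis X W → Prog X α) (B : ℕ) :
    (quantum C b₀ k).failure f Q B = if C.cost ≤ B then
      ∑ b, ‖C.apply f (ket b₀) b‖ ^ 2 * (k b).failure f Q (B - C.cost) else 1 := rfl

theorem Always.mono {Q Q' : α → Prop} {p : Prog X α} (h : p.Always f Q) (hQ : ∀ a, Q a → Q' a) :
    p.Always f Q' := by
  induction p with
  | ret a => exact hQ a h
  | query x k ih => exact ih _ h
  | choose S hS k ih => exact fun b hb => ih b (h b hb)
  | quantum C b₀ k ih => exact fun b hb => ih b (h b hb)

theorem Always.bind {Q : α → Prop} {Q' : β → Prop} {p : Prog X α} {g : α → Prog X β}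
    (h : p.Always f Q) (hg : ∀ a, Q a → (g a).Always f Q') : (p.bind g).Always f Q' := by
  induction p with
  | ret a => exact hg a h
  | query x k ih => exact ih _ h
  | choose S hS k ih => exact fun b hb => ih b (h b hb)
  | quantum C b₀ k ih => exact fun b hb => ih b (h b hb)

theorem always_true (p : Prog X α) : p.Always f fun _ => True := by
  induction p with
  | ret a => trivial
  | query x k ih => exact ih _
  | choose S hS k ih => exact fun b hb => ih b
  | quantum C b₀ k ih => exact fun b _ => ih b

theorem OnlyGrover.bind {p : Prog X α} {g : α → Prog X β} (h : p.OnlyGrover)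
    (hg : ∀ a, (g a).OnlyGrover) : (p.bind g).OnlyGrover := by
  induction p with
  | ret a => exact hg a
  | query x k ih => exact fun b => ih b (h b)
  | choose S hS k ih => exact fun b hb => ih b (h b hb)
  | quantum C b₀ k ih => exact ⟨h.1, fun b => ih b (h.2 b)⟩

theorem OnlyGrover.withThreshold {p : Prog X (Option α)} (h : p.OnlyGrover) (B : ℕ) :
    (p.withThreshold B).OnlyGrover := by
  induction p generalizing B with
  | ret a => trivial
  | query x k ih =>
    unfold Prog.withThreshold
    split_ifs
    · exact fun b => ih b (h b) _
    · trivial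
  | choose S hS k ih => exact fun b hb => ih b (h b hb) _
  | quantum C b₀ k ih =>
    unfold Prog.withThreshold
    split_ifs
    · exact ⟨h.1, fun b => ih b (h.2 b) _⟩
    · trivial

theorem queries_bind_le {p : Prog X α} {g : α → Prog X β} {B₁ B₂ : ℕ} (h : p.queries ≤ B₁)
    (hg : ∀ a, (g a).queries ≤ B₂) : (p.bind g).queries ≤ B₁ + B₂ := by
  induction p generalizing B₁ with
  | ret a => exact (hg a).trans (Nat.le_add_left _ _)
  | query x k ih =>
    simp only [queries, Prog.bind] at h ⊢
    have : (Finset.univ.sup fun b => ((k b).bind g).queries) ≤ (B₁ - 1) + B₂ := by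
      refine Finset.sup_le fun b _ => ih b ?_
      have := Finset.le_sup (f := fun b => (k b).queries) (Finset.mem_univ b)
      omega
    omega
  | choose S hS k ih =>
    simp only [queries, Prog.bind] at h ⊢
    exact Finset.sup_le fun b hb => ih b ((Finset.le_sup (f := fun b => (k b).queries) hb).trans h)
  | quantum C b₀ k ih =>
    simp only [queries, Prog.bind] at h ⊢
    have : (Finset.univ.sup fun b => ((k b).bind g).queries) ≤ (B₁ - C.cost) + B₂ := by
      refine Finset.sup_le fun b _ => ih b ?_
      have := Finset.le_sup (f := fun b => (k b).queries) (Finset.mem_univ b)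
      omega
    omega

theorem queries_withThreshold_le (p : Prog X (Option α)) (B : ℕ) :
    (p.withThreshold B).queries ≤ B := by
  induction p generalizing B with
  | ret a => exact Nat.zero_le _
  | query x k ih =>
    unfold Prog.withThreshold
    split_ifs with h
    · have : (Finset.univ.sup fun b => ((k b).withThreshold (B - 1)).queries) ≤ B - 1 :=
        Finset.sup_le fun b _ => ih b _
      simp only [queries]
      omega
    · exact Nat.zero_le _
  | choose S hS k ih => exact Finset.sup_le fun b _ => ih b _
  | quantum C b₀ k ih =>
    unfold Prog.withThreshold
    split_ifs with h
    · have : (Finset.univ.sup fun b => ((k b).withThreshold (B - C.cost)).queries) ≤ B - C.cost :=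
        Finset.sup_le fun b _ => ih b _
      simp only [queries]
      omega
    · exact Nat.zero_le _

/-- The measured probabilities of a circuit add up to one. -/
theorem sum_sq_norm_apply {W : Type} [Fintype W] (C : Circuit X W) (b₀ : Basis X W) :
    ∑ b, ‖C.apply f (ket b₀) b‖ ^ 2 = 1 := by
  rw [← EuclideanSpace.norm_sq_eq, C.norm_apply, norm_ket, one_pow]

theorem failure_nonneg (Q : α → Prop) (p : Prog X α) (B : ℕ) : 0 ≤ p.failure f Q B := by
  induction p generalizing B with
  | ret a => unfold failure; split_ifs <;> norm_num
  | query x k ih => unfold failure; split_ifs <;> [exact ih _ _; norm_num]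
  | choose S hS k ih => exact div_nonneg (Finset.sum_nonneg fun b _ => ih b B) (Nat.cast_nonneg _)
  | quantum C b₀ k ih =>
    unfold failure
    split_ifs
    · exact Finset.sum_nonneg fun b _ => mul_nonneg (sq_nonneg _) (ih b _)
    · norm_num

theorem average_le {γ : Type} {S : Finset γ} (hS : S.Nonempty) {a : γ → ℝ} {t : ℝ}
    (h : ∀ b ∈ S, a b ≤ t) : (∑ b ∈ S, a b) / S.card ≤ t := by
  rw [div_le_iff₀ (by exact_mod_cast hS.card_pos), mul_comm, ← nsmul_eq_mul]
  exact Finset.sum_le_card_nsmul _ _ _ h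

theorem failure_le_one (Q : α → Prop) (p : Prog X α) (B : ℕ) : p.failure f Q B ≤ 1 := by
  induction p generalizing B with
  | ret a => unfold failure; split_ifs <;> norm_num
  | query x k ih => unfold failure; split_ifs <;> [exact ih _ _; norm_num]
  | choose S hS k ih => exact average_le hS fun b _ => ih b B
  | quantum C b₀ k ih =>
    unfold failure
    split_ifs
    · rw [← sum_sq_norm_apply (f := f) C b₀]
      exact Finset.sum_le_sum fun b _ => mul_le_of_le_one_right (sq_nonneg _) (ih b _)
    · norm_num

theorem failure_anti (Q : α → Prop) (p : Prog X α) {B B' : ℕ} (h : B ≤ B') :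
    p.failure f Q B' ≤ p.failure f Q B := by
  induction p generalizing B B' with
  | ret a => exact le_rfl
  | query x k ih =>
    unfold failure
    by_cases h1 : 1 ≤ B
    · rw [if_pos h1, if_pos (h1.trans h)]
      exact ih _ (by omega)
    · rw [if_neg h1]
      exact failure_le_one Q (query x k) B'
  | choose S hS k ih =>
    unfold failure
    gcongr
    exact ih _ h
  | quantum C b₀ k ih =>
    unfold failure
    by_cases h1 : C.cost ≤ B
    · rw [if_pos h1, if_pos (h1.trans h)]
      gcongr
      exact ih _ (by omega)
    · rw [if_neg h1]
      exact failure_le_one Q (quantum C b₀ k) B'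

/-- Results outside `Q₂` never occur, so they do not contribute to the failure probability. -/
theorem failure_le_of_always {Q₁ Q₂ Q : α → Prop} {p : Prog X α} (h : p.Always f Q₂)
    (hQ : ∀ a, Q₁ a → Q₂ a → Q a) (B : ℕ) : p.failure f Q B ≤ p.failure f Q₁ B := by
  induction p generalizing B with
  | ret a =>
    have := hQ a
    have h : Q₂ a := h
    rw [failure_ret, failure_ret]
    by_cases h1 : Q₁ a
    · rw [if_pos (this h1 h), if_pos h1]
    · rw [if_neg h1]
      split_ifs <;> norm_num
  | query x k ih =>
    unfold failure
    split_ifs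
    · exact ih _ h _
    · exact le_rfl
  | choose S hS k ih =>
    unfold failure
    gcongr with b hb
    exact ih b (h b hb) B
  | quantum C b₀ k ih =>
    unfold failure
    split_ifs
    · refine Finset.sum_le_sum fun b _ => ?_
      by_cases hb : C.apply f (ket b₀) b = 0
      · simp [hb]
      · exact mul_le_mul_of_nonneg_left (ih b (h b hb) _) (sq_nonneg _)
    · exact le_rfl

theorem failure_mono {Q₁ Q : α → Prop} {p : Prog X α} (hQ : ∀ a, Q₁ a → Q a) (B : ℕ) :
    p.failure f Q B ≤ p.failure f Q₁ B :=
  failure_le_of_always (always_true p) (fun a h _ => hQ a h) B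

theorem failure_eq_zero {Q : α → Prop} {p : Prog X α} (h : p.Always f Q) {B : ℕ}
    (hB : p.queries ≤ B) : p.failure f Q B = 0 := by
  induction p generalizing B with
  | ret a => exact if_pos h
  | query x k ih =>
    simp only [queries] at hB
    have := Finset.le_sup (f := fun b => (k b).queries) (Finset.mem_univ (f x))
    unfold failure
    rw [if_pos (by omega), ih _ h (by omega)]
  | choose S hS k ih =>
    simp only [queries] at hB
    unfold failure
    rw [Finset.sum_eq_zero, zero_div]
    exact fun b hb => ih b (h b hb) ((Finset.le_sup (f := fun b => (k b).queries) hb).trans hB)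
  | quantum C b₀ k ih =>
    simp only [queries] at hB
    unfold failure
    rw [if_pos (by omega)]
    refine Finset.sum_eq_zero fun b _ => ?_
    by_cases hb : C.apply f (ket b₀) b = 0
    · simp [hb]
    have := Finset.le_sup (f := fun b => (k b).queries) (Finset.mem_univ b)
    rw [ih b (h b hb) (by omega), mul_zero]

/-- If the rest of the program fails with probability at most `η` after an intermediate result in
`Q₁`, and at most `η + ζ` after any other one, then the whole fails with probability at most
`η + (probability of a result outside Q₁) * ζ`.  Exceeding the budget `B₁` is a certain failure,
which accounts for `hover`. -/
theorem failure_bind_le {Q₁ : α → Prop} {Q : β → Prop} {p : Prog X α} {g : α → Prog X β}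
    {B₁ B₂ : ℕ} {η ζ : ℝ} (hover : p.queries ≤ B₁ ∨ 1 ≤ η + ζ)
    (hgood : ∀ a, Q₁ a → (g a).failure f Q B₂ ≤ η)
    (hbad : ∀ a, ¬Q₁ a → (g a).failure f Q B₂ ≤ η + ζ) :
    (p.bind g).failure f Q (B₁ + B₂) ≤ η + p.failure f Q₁ B₁ * ζ := by
  induction p generalizing B₁ with
  | ret a =>
    have h1 := failure_anti (f := f) Q (g a) (Nat.le_add_left B₂ B₁)
    rw [failure_ret]
    change (g a).failure f Q (B₁ + B₂) ≤ _
    split_ifs with h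
    · simpa using h1.trans (hgood a h)
    · simpa using h1.trans (hbad a h)
  | query x k ih =>
    by_cases h1 : 1 ≤ B₁
    · have e : B₁ + B₂ - 1 = (B₁ - 1) + B₂ := by omega
      rw [Prog.bind, failure_query, failure_query, if_pos h1, if_pos (by omega), e]
      refine ih _ (hover.imp_left fun h => ?_)
      simp only [queries] at h
      have := Finset.le_sup (f := fun b => (k b).queries) (Finset.mem_univ (f x))
      omega
    · have h2 : 1 ≤ η + ζ := hover.resolve_left fun h => by simp only [queries] at h; omega
      have h3 : (query x k).failure f Q₁ B₁ = 1 := if_neg h1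
      rw [h3, one_mul]
      exact (failure_le_one _ _ _).trans h2
  | choose S hS k ih =>
    have hS' : (0 : ℝ) < S.card := by exact_mod_cast hS.card_pos
    have : ∑ b ∈ S, ((k b).bind g).failure f Q (B₁ + B₂)
        ≤ ∑ b ∈ S, (η + (k b).failure f Q₁ B₁ * ζ) :=
      Finset.sum_le_sum fun b hb => ih b <| hover.imp_left fun h =>
        (Finset.le_sup (f := fun b => (k b).queries) hb).trans h
    rw [Prog.bind, failure_choose, failure_choose, div_mul_eq_mul_div, div_le_iff₀ hS',
      add_mul, div_mul_cancel₀ _ hS'.ne']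
    rwa [Finset.sum_add_distrib, ← Finset.sum_mul, Finset.sum_const, nsmul_eq_mul,
      mul_comm (S.card : ℝ)] at this
  | quantum C b₀ k ih =>
    by_cases h1 : C.cost ≤ B₁
    · have e : B₁ + B₂ - C.cost = (B₁ - C.cost) + B₂ := by omega
      rw [Prog.bind, failure_quantum, failure_quantum, if_pos h1, if_pos (by omega), e]
      have : ∑ b, ‖C.apply f (ket b₀) b‖ ^ 2 *
            ((k b).bind g).failure f Q (B₁ - C.cost + B₂)
          ≤ ∑ b, ‖C.apply f (ket b₀) b‖ ^ 2 *
            (η + (k b).failure f Q₁ (B₁ - C.cost) * ζ) := by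
        gcongr with b
        refine ih b (hover.imp_left fun h => ?_)
        simp only [queries] at h
        have := Finset.le_sup (f := fun b => (k b).queries) (Finset.mem_univ b)
        omega
      refine this.trans_eq ?_
      simp only [mul_add, Finset.sum_add_distrib, ← Finset.sum_mul, ← mul_assoc,
        sum_sq_norm_apply, one_mul]
    · have h2 : 1 ≤ η + ζ := hover.resolve_left fun h => by simp only [queries] at h; omega
      have h3 : (quantum C b₀ k).failure f Q₁ B₁ = 1 := if_neg h1
      rw [h3, one_mul]
      exact (failure_le_one _ _ _).trans h2

/-- The union bound for sequential composition. -/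
theorem failure_bind_le_add {Q₁ : α → Prop} {Q : β → Prop} {p : Prog X α} {g : α → Prog X β}
    {B₁ B₂ : ℕ} {η₁ η₂ : ℝ} (hη : 0 ≤ η₂) (hp : p.failure f Q₁ B₁ ≤ η₁)
    (hg : ∀ a, Q₁ a → (g a).failure f Q B₂ ≤ η₂) :
    (p.bind g).failure f Q (B₁ + B₂) ≤ η₁ + η₂ := by
  have := failure_bind_le (f := f) (p := p) (Q := Q) (B₁ := B₁) (ζ := 1) (Or.inr (by linarith)) hg
    fun a _ => (failure_le_one Q (g a) B₂).trans (by linarith)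
  linarith

theorem failure_bind_le_of_always {Q₁ : α → Prop} {Q : β → Prop} {p : Prog X α}
    {g : α → Prog X β} {B₁ B₂ : ℕ} {η : ℝ} (hη : 0 ≤ η) (hq : p.queries ≤ B₁)
    (hp : p.Always f Q₁) (hg : ∀ a, Q₁ a → (g a).failure f Q B₂ ≤ η) :
    (p.bind g).failure f Q (B₁ + B₂) ≤ η := by
  simpa using failure_bind_le_add hη (failure_eq_zero hp hq).le hg

theorem Always.run_withThreshold {p : Prog X (Option α)} (h : p.Always f (· = none)) (B : ℕ) :
    (p.withThreshold B).run f = PMF.pure none := by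
  induction p generalizing B with
  | ret a =>
    have h : a = none := h
    rw [h]; rfl
  | query x k ih =>
    unfold Prog.withThreshold
    split_ifs
    · exact ih _ h _
    · rfl
  | choose S hS k ih =>
    change (PMF.uniformOfFinset S hS).bind (fun b => ((k b).withThreshold B).run f) = _
    ext o
    rw [PMF.bind_apply]
    rw [show PMF.pure none o = ∑' b, PMF.uniformOfFinset S hS b * PMF.pure none o by
      rw [ENNReal.tsum_mul_right, PMF.tsum_coe, one_mul]]
    refine tsum_congr fun b => ?_
    by_cases hb : b ∈ S
    · rw [ih b (h b hb)]
    · rw [PMF.uniformOfFinset_apply_of_notMem _ hb, zero_mul, zero_mul]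
  | quantum C b₀ k ih =>
    unfold Prog.withThreshold
    split_ifs
    · change (C.measure f b₀).bind (fun b => ((k b).withThreshold _).run f) = _
      ext o
      rw [PMF.bind_apply, show PMF.pure none o = ∑' b, C.measure f b₀ b * PMF.pure none o by
        rw [ENNReal.tsum_mul_right, PMF.tsum_coe, one_mul]]
      refine tsum_congr fun b => ?_
      by_cases hb : C.apply f (ket b₀) b = 0
      · have : C.measure f b₀ b = 0 := by simp [Circuit.measure, hb]
        rw [this, zero_mul, zero_mul]
      · rw [ih b (h b hb)]
    · rfl

/-- The counter and the failure functional measure the same event. -/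
theorem toOuterMeasure_withThreshold_le (Q : Option α → Prop) (p : Prog X (Option α)) (B : ℕ) :
    ((p.withThreshold B).run f).toOuterMeasure {o | ¬Q o} ≤ ENNReal.ofReal (p.failure f Q B) := by
  have hle : ∀ (r : PMF (Option α)), r.toOuterMeasure {o | ¬Q o} ≤ 1 := fun r =>
    (r.toOuterMeasure.mono (Set.subset_univ _)).trans
      ((PMF.toOuterMeasure_apply_eq_one_iff r _).2 (Set.subset_univ _)).le
  induction p generalizing B with
  | ret a =>
    change (PMF.pure a).toOuterMeasure _ ≤ _
    rw [PMF.toOuterMeasure_pure_apply]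
    rw [failure_ret]
    by_cases h : Q a <;> simp [h]
  | query x k ih =>
    unfold Prog.withThreshold failure
    split_ifs
    · exact ih _ _
    · simpa using hle _
  | choose S hS k ih =>
    change ((PMF.uniformOfFinset S hS).bind
      (fun b => ((k b).withThreshold B).run f)).toOuterMeasure _ ≤ _
    rw [PMF.toOuterMeasure_bind_apply]
    unfold failure
    rw [tsum_eq_sum (s := S) (fun b hb => by
      rw [PMF.uniformOfFinset_apply_of_notMem _ hb, zero_mul]), Finset.sum_div,
      ENNReal.ofReal_sum_of_nonneg fun b _ =>
        div_nonneg (failure_nonneg _ _ _) (Nat.cast_nonneg _)]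
    refine Finset.sum_le_sum fun b hb => ?_
    rw [PMF.uniformOfFinset_apply_of_mem _ hb, div_eq_inv_mul,
      ENNReal.ofReal_mul (by positivity), ENNReal.ofReal_inv_of_pos
        (by exact_mod_cast hS.card_pos), ENNReal.ofReal_natCast]
    gcongr
    exact ih _ _
  | quantum C b₀ k ih =>
    unfold Prog.withThreshold failure
    split_ifs with h
    · change ((C.measure f b₀).bind
        (fun b => ((k b).withThreshold (B - C.cost)).run f)).toOuterMeasure _ ≤ _
      rw [PMF.toOuterMeasure_bind_apply, tsum_fintype,
        ENNReal.ofReal_sum_of_nonneg fun b _ =>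
          mul_nonneg (sq_nonneg _) (failure_nonneg _ _ _)]
      refine Finset.sum_le_sum fun b _ => ?_
      rw [ENNReal.ofReal_mul (sq_nonneg _)]
      exact mul_le_mul_right (ih _ _) _
    · simpa using hle _

theorem one_sub_failure_le (Q : Option α → Prop) (p : Prog X (Option α)) (B : ℕ) :
    1 - p.failure f Q B ≤ (((p.withThreshold B).run f).toOuterMeasure {o | Q o}).toReal := by
  set r := (p.withThreshold B).run f
  have h1 : (1 : ENNReal) ≤ r.toOuterMeasure {o | Q o} + r.toOuterMeasure {o | ¬Q o} := by
    rw [← (PMF.toOuterMeasure_apply_eq_one_iff r _).2 (Set.subset_univ _)]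
    refine (r.toOuterMeasure.mono fun o _ => ?_).trans (MeasureTheory.measure_union_le _ _)
    exact em (Q o)
  have hle : r.toOuterMeasure {o | Q o} ≤ 1 :=
    (r.toOuterMeasure.mono (Set.subset_univ _)).trans
      ((PMF.toOuterMeasure_apply_eq_one_iff r _).2 (Set.subset_univ _)).le
  have h2 := h1.trans (add_le_add_right (toOuterMeasure_withThreshold_le Q p B) _)
  rw [← ENNReal.ofReal_toReal (hle.trans_lt ENNReal.one_lt_top).ne,
    ← ENNReal.ofReal_add ENNReal.toReal_nonneg (failure_nonneg _ _ _), ENNReal.one_le_ofReal] at h2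
  linarith

theorem failure_choose_le {γ : Type} {Q : α → Prop} {S : Finset γ} (hS : S.Nonempty)
    {k : γ → Prog X α} {B : ℕ} {v : γ → ℝ} {κ : ℝ}
    (hk : ∀ b ∈ S, (k b).failure f Q B ≤ 1 - v b) (hv : κ * S.card ≤ ∑ b ∈ S, v b) :
    (choose S hS k).failure f Q B ≤ 1 - κ := by
  have hS' : (0 : ℝ) < S.card := by exact_mod_cast hS.card_pos
  rw [failure_choose, div_le_iff₀ hS']
  have := Finset.sum_le_sum hk
  rw [Finset.sum_sub_distrib, Finset.sum_const, nsmul_eq_mul, mul_one] at this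
  linarith

end QQuery.Prog

/-! ### Linear algebra of Grover circuits -/

namespace QQuery

open Complex

section Kets

/-- The component of a state in the span of the basis states in `P`. -/
noncomputable def restrict {β : Type} (P : Set β) (ψ : EuclideanSpace ℂ β) : EuclideanSpace ℂ β :=
  WithLp.toLp 2 (P.indicator ψ)

open Classical in
theorem restrict_apply {β : Type} (P : Set β) (ψ : EuclideanSpace ℂ β) (b : β) :
    restrict P ψ b = if b ∈ P then ψ b else 0 := by
  simp [restrict, Set.indicator_apply]

variable {β : Type}

theorem restrict_add (P : Set β) (ψ φ : EuclideanSpace ℂ β) :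
    restrict P (ψ + φ) = restrict P ψ + restrict P φ := by
  classical
  ext b; simp only [restrict_apply, PiLp.add_apply]; split_ifs <;> simp

theorem restrict_smul (P : Set β) (z : ℂ) (ψ : EuclideanSpace ℂ β) :
    restrict P (z • ψ) = z • restrict P ψ := by
  classical
  ext b; simp only [restrict_apply, PiLp.smul_apply]; split_ifs <;> simp

theorem restrict_sub (P : Set β) (ψ φ : EuclideanSpace ℂ β) :
    restrict P (ψ - φ) = restrict P ψ - restrict P φ := by
  classical
  ext b; simp only [restrict_apply, PiLp.sub_apply]; split_ifs <;> simp

theorem restrict_restrict (P : Set β) (ψ : EuclideanSpace ℂ β) :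
    restrict P (restrict P ψ) = restrict P ψ := by
  classical
  ext b; simp only [restrict_apply]; split_ifs <;> rfl

variable [Fintype β]

theorem ket_apply [DecidableEq β] (b c : β) : ket b c = if c = b then 1 else 0 := by
  classical
  rw [ket, EuclideanSpace.basisFun_apply]
  simp

theorem inner_ket_left (b : β) (ψ : EuclideanSpace ℂ β) : inner ℂ (ket b) ψ = ψ b := by
  classical
  rw [ket, EuclideanSpace.basisFun_apply, EuclideanSpace.inner_single_left]
  simp

theorem inner_ket_ket [DecidableEq β] (b c : β) :
    inner ℂ (ket b) (ket c) = if b = c then (1 : ℂ) else 0 := by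
  rw [inner_ket_left, ket_apply]

theorem permOp_ket (σ : Equiv.Perm β) (b : β) : permOp σ (ket b) = ket (σ b) := by
  classical
  ext c
  rw [ket_apply]
  simp only [permOp, LinearIsometryEquiv.piLpCongrLeft_apply, Equiv.piCongrLeft'_apply]
  rw [ket_apply]
  simp [Equiv.symm_apply_eq]

theorem inner_restrict (P : Set β) (ψ : EuclideanSpace ℂ β) :
    inner ℂ ψ (restrict P ψ) = ((‖restrict P ψ‖ ^ 2 : ℝ) : ℂ) := by
  classical
  rw [EuclideanSpace.norm_sq_eq, PiLp.inner_apply]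
  push_cast
  refine Finset.sum_congr rfl fun b _ => ?_
  rw [restrict_apply]
  split_ifs
  · exact inner_self_eq_norm_sq_to_K (𝕜 := ℂ) (ψ b)
  · simp

open Classical in
theorem norm_sq_restrict (P : Set β) (ψ : EuclideanSpace ℂ β) :
    ‖restrict P ψ‖ ^ 2 = ∑ b, if b ∈ P then ‖ψ b‖ ^ 2 else 0 := by
  rw [EuclideanSpace.norm_sq_eq]
  refine Finset.sum_congr rfl fun b _ => ?_
  rw [restrict_apply]
  split_ifs <;> simp

theorem norm_sq_restrict_le (P : Set β) (ψ : EuclideanSpace ℂ β) :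
    ‖restrict P ψ‖ ^ 2 ≤ ‖ψ‖ ^ 2 := by
  classical
  rw [norm_sq_restrict, EuclideanSpace.norm_sq_eq]
  refine Finset.sum_le_sum fun b _ => ?_
  split_ifs
  · exact le_rfl
  · positivity

theorem phaseOp_eq (P : Set β) (ψ : EuclideanSpace ℂ β) :
    phaseOp P ψ = ψ - (2 : ℂ) • restrict P ψ := by
  classical
  ext b
  simp only [phaseOp, LinearIsometryEquiv.piLpCongrRight_apply, PiLp.sub_apply, PiLp.smul_apply,
    restrict_apply]
  split_ifs
  · simp; ring
  · simp

end Kets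

section Circuits

variable {X W : Type} [Fintype X] [Fintype W] {f : X → Bool}

/-- The operator of a circuit. -/
noncomputable def Circuit.op (f : X → Bool) (C : Circuit X W) : UnitaryOp (Basis X W) :=
  C.foldl (fun U g => U.trans (g.op f)) (LinearIsometryEquiv.refl ℂ _)

theorem Circuit.apply_cons (g : Gate X W) (C : Circuit X W) (ψ : State X W) :
    Circuit.apply f (g :: C) ψ = C.apply f (g.op f ψ) := rfl

theorem Circuit.apply_nil (ψ : State X W) : Circuit.apply f ([] : Circuit X W) ψ = ψ := rfl

theorem Circuit.apply_append (C D : Circuit X W) (ψ : State X W) :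
    Circuit.apply f (C ++ D) ψ = D.apply f (C.apply f ψ) := List.foldl_append

theorem Circuit.op_apply (C : Circuit X W) (ψ : State X W) : C.op f ψ = C.apply f ψ := by
  have : ∀ U : UnitaryOp (Basis X W),
      C.foldl (fun U g => U.trans (g.op f)) U ψ = C.apply f (U ψ) := by
    induction C with
    | nil => exact fun U => rfl
    | cons g C ih => exact fun U => ih _
  exact this _

theorem Circuit.apply_sub (C : Circuit X W) (ψ φ : State X W) :
    C.apply f (ψ - φ) = C.apply f ψ - C.apply f φ := by
  simp only [← Circuit.op_apply, map_sub]

theorem Circuit.apply_smul (C : Circuit X W) (z : ℂ) (ψ : State X W) :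
    C.apply f (z • ψ) = z • C.apply f ψ := by
  simp only [← Circuit.op_apply, map_smul]

theorem Circuit.apply_sum {ι : Type*} (C : Circuit X W) (s : Finset ι) (ψ : ι → State X W) :
    C.apply f (∑ i ∈ s, ψ i) = ∑ i ∈ s, C.apply f (ψ i) := by
  simp only [← Circuit.op_apply, map_sum]

theorem Circuit.inner_apply (C : Circuit X W) (ψ φ : State X W) :
    inner ℂ (C.apply f ψ) (C.apply f φ) = inner ℂ ψ φ := by
  simp only [← Circuit.op_apply, LinearIsometryEquiv.inner_map_map]

theorem Gate.inv_op (g : Gate X W) (ψ : State X W) : g.op f (g.inv.op f ψ) = ψ := by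
  cases g with
  | unitary U => exact U.apply_symm_apply ψ
  | query =>
    change permOp (oraclePerm f) (permOp (oraclePerm f) ψ) = ψ
    have h : ∀ b : Basis X W, (oraclePerm f).symm ((oraclePerm f).symm b) = b :=
      fun b => (oraclePerm f).left_inv b
    ext b
    simp [permOp, LinearIsometryEquiv.piLpCongrLeft_apply, Equiv.piCongrLeft'_apply, h]

theorem Circuit.apply_apply_inv (C : Circuit X W) (ψ : State X W) :
    C.apply f (C.inv.apply f ψ) = ψ := by
  induction C generalizing ψ with
  | nil => rfl
  | cons g C ih =>
    have : Circuit.inv (g :: C) = Circuit.inv C ++ [g.inv] := by simp [Circuit.inv]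
    rw [this, Circuit.apply_append, Circuit.apply_cons, Circuit.apply_cons, Circuit.apply_nil,
      Gate.inv_op, ih]

theorem amplify_zero (A : Circuit X W) (start good : Set (Basis X W)) :
    amplify A start good 0 = A := by simp [amplify]

theorem amplify_succ (A : Circuit X W) (start good : Set (Basis X W)) (s : ℕ) :
    amplify A start good (s + 1) = amplify A start good s ++
      ([Gate.unitary (phaseOp good)] ++ A.inv ++ [Gate.unitary (phaseOp start)] ++ A) := by
  simp only [amplify, List.replicate_succ', List.flatten_append, List.flatten_singleton,
    List.append_assoc]

/-- The angle `θ` with `sin² θ = p`, by which a Grover iteration with initial success probability `p`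
turns the state twice. -/
noncomputable def groverAngle (p : ℝ) : ℝ := Real.arcsin (Real.sqrt p)

theorem sin_groverAngle {p : ℝ} (h1 : p ≤ 1) : Real.sin (groverAngle p) = Real.sqrt p :=
  Real.sin_arcsin ((by norm_num : (-1 : ℝ) ≤ 0).trans (Real.sqrt_nonneg p))
    (by rwa [Real.sqrt_le_one])

theorem cos_groverAngle {p : ℝ} (h0 : 0 ≤ p) : Real.cos (groverAngle p) = Real.sqrt (1 - p) := by
  rw [groverAngle, Real.cos_arcsin, Real.sq_sqrt h0]

/-- Amplitude amplification.  The start states other than `b₀` do not interfere if their images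
under `A` are orthogonal to the good part of the image of `b₀`; this holds for trivial reasons if
`b₀` is the only start state. -/
theorem amplify_apply (A : Circuit X W) (start good : Set (Basis X W)) {b₀ : Basis X W}
    (hb₀ : b₀ ∈ start)
    (horth : ∀ b ∈ start, b ≠ b₀ →
      inner ℂ (A.apply f (ket b)) (restrict good (A.apply f (ket b₀))) = 0) (s : ℕ) :
    ∃ a b : ℝ, (amplify A start good s).apply f (ket b₀) =
        (a : ℂ) • restrict good (A.apply f (ket b₀)) +
        (b : ℂ) • (A.apply f (ket b₀) - restrict good (A.apply f (ket b₀))) ∧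
      a ^ 2 * ‖restrict good (A.apply f (ket b₀))‖ ^ 2 =
        Real.sin ((2 * s + 1) * groverAngle (‖restrict good (A.apply f (ket b₀))‖ ^ 2)) ^ 2 := by
  classical
  set ψ := A.apply f (ket b₀) with hψ
  set u := restrict good ψ with hu
  set p := ‖u‖ ^ 2 with hp
  have hψ1 : ‖ψ‖ = 1 := (A.norm_apply f _).trans (norm_ket b₀)
  have hp0 : 0 ≤ p := by positivity
  have hp1 : p ≤ 1 := (norm_sq_restrict_le good ψ).trans (by rw [hψ1]; norm_num)
  have hψu : inner ℂ ψ u = (p : ℂ) := inner_restrict good ψ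
  have hψψ : inner ℂ ψ ψ = (1 : ℂ) := by rw [inner_self_eq_norm_sq_to_K, hψ1]; simp
  have hgu : restrict good u = u := restrict_restrict good ψ
  have hgw : restrict good (ψ - u) = 0 := by rw [restrict_sub, hgu, sub_self]
  set θ := groverAngle p with hθ
  have hsin : Real.sin θ = Real.sqrt p := sin_groverAngle hp1
  have hcos : Real.cos θ = Real.sqrt (1 - p) := cos_groverAngle hp0
  have hsq : Real.sqrt p ^ 2 = p := Real.sq_sqrt hp0
  have hcq : Real.sqrt (1 - p) ^ 2 = 1 - p := Real.sq_sqrt (by linarith)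
  suffices h : ∃ a b ς : ℝ, (amplify A start good s).apply f (ket b₀) =
      (a : ℂ) • u + (b : ℂ) • (ψ - u) ∧ ς ^ 2 = 1 ∧
      Real.sqrt p * a = ς * Real.sin ((2 * s + 1) * θ) ∧
      Real.sqrt (1 - p) * b = ς * Real.cos ((2 * s + 1) * θ) by
    obtain ⟨a, b, ς, h1, h2, h3, -⟩ := h
    refine ⟨a, b, h1, ?_⟩
    rw [← hsq, ← mul_pow, mul_comm a, h3, mul_pow, h2, one_mul]
  induction s with
  | zero =>
    refine ⟨1, 1, 1, ?_, by norm_num, ?_, ?_⟩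
    · rw [amplify_zero]; simp [hψ]
    · simp [hsin]
    · simp [hcos]
  | succ s ih =>
    obtain ⟨a, b, ς, h1, h2, h3, h4⟩ := ih
    set κ : ℝ := b * (1 - p) - a * p with hκ
    have step : (amplify A start good (s + 1)).apply f (ket b₀) =
        ((-a - 2 * κ : ℝ) : ℂ) • u + ((b - 2 * κ : ℝ) : ℂ) • (ψ - u) := by
      set φ : State X W := ((-a : ℝ) : ℂ) • u + (b : ℂ) • (ψ - u) with hφ
      have e1 : phaseOp good ((a : ℂ) • u + (b : ℂ) • (ψ - u)) = φ := by
        rw [phaseOp_eq, restrict_add, restrict_smul, restrict_smul, hgu, hgw, hφ]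
        push_cast
        module
      have e2 : ∀ c, (A.inv.apply f φ) c = inner ℂ (A.apply f (ket c)) φ := fun c => by
        rw [← inner_ket_left, ← A.inner_apply (f := f), A.apply_apply_inv]
      have e3 : phaseOp start (A.inv.apply f φ) =
          A.inv.apply f φ - ((2 * κ : ℝ) : ℂ) • ket b₀ := by
        rw [phaseOp_eq]
        congr 1
        ext c
        rw [PiLp.smul_apply, PiLp.smul_apply, restrict_apply, ket_apply, e2]
        by_cases hc : c = b₀
        · subst hc
          rw [if_pos hb₀, if_pos rfl, ← hψ, hφ, inner_add_right, inner_smul_right,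
            inner_smul_right, inner_sub_right, hψu, hψψ, hκ]
          simp only [smul_eq_mul]
          push_cast
          ring
        · rw [if_neg hc]
          split_ifs with hcs
          · have h5 : inner ℂ (A.apply f (ket c)) ψ = (0 : ℂ) := by
              rw [hψ, A.inner_apply, inner_ket_ket, if_neg hc]
            rw [hφ, inner_add_right, inner_smul_right, inner_smul_right, inner_sub_right, h5,
              horth c hcs hc]
            simp
          · simp
      rw [amplify_succ, Circuit.apply_append, h1]
      simp only [Circuit.apply_append, Circuit.apply_cons, Circuit.apply_nil, Gate.op]
      rw [e1, e3, Circuit.apply_sub, Circuit.apply_apply_inv, Circuit.apply_smul, ← hψ, hφ]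
      push_cast
      module
    have hang : ((2 * ((s + 1 : ℕ) : ℝ) + 1) * θ) = (2 * s + 1) * θ + 2 * θ := by push_cast; ring
    refine ⟨_, _, -ς, step, by rw [neg_sq, h2], ?_, ?_⟩
    · rw [hang, Real.sin_add, Real.cos_two_mul, Real.sin_two_mul, hsin, hcos, hcq, hκ]
      linear_combination (-1 + 2 * p) * h3 - 2 * Real.sqrt p * Real.sqrt (1 - p) * h4 +
        2 * b * Real.sqrt p * hcq
    · rw [hang, Real.cos_add, Real.cos_two_mul, Real.sin_two_mul, hsin, hcos, hcq, hκ]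
      linear_combination (-1 + 2 * p) * h4 + 2 * Real.sqrt p * Real.sqrt (1 - p) * h3 -
        2 * a * Real.sqrt (1 - p) * hsq

/-- The probability that amplitude amplification ends in a good state. -/
theorem norm_sq_restrict_amplify (A : Circuit X W) (start good : Set (Basis X W))
    {b₀ : Basis X W} (hb₀ : b₀ ∈ start)
    (horth : ∀ b ∈ start, b ≠ b₀ →
      inner ℂ (A.apply f (ket b)) (restrict good (A.apply f (ket b₀))) = 0) (s : ℕ) :
    ‖restrict good ((amplify A start good s).apply f (ket b₀))‖ ^ 2 =
      Real.sin ((2 * s + 1) * groverAngle (‖restrict good (A.apply f (ket b₀))‖ ^ 2)) ^ 2 := by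
  obtain ⟨a, b, h1, h2⟩ := amplify_apply A start good hb₀ horth s
  rw [h1, restrict_add, restrict_smul, restrict_smul, restrict_sub, restrict_restrict, sub_self,
    smul_zero, add_zero, norm_smul, mul_pow, ← h2]
  simp

end Circuits

section Average

theorem two_mul_sin_mul_sum_cos (θ : ℝ) (J : ℕ) :
    2 * Real.sin (2 * θ) * ∑ s ∈ Finset.range J, Real.cos (2 * ((2 * s + 1) * θ)) =
      Real.sin (4 * J * θ) := by
  induction J with
  | zero => simp
  | succ J ih =>
    have e1 : 4 * ((J + 1 : ℕ) : ℝ) * θ = 2 * ((2 * J + 1) * θ) + 2 * θ := by push_cast; ring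
    have e2 : 4 * (J : ℝ) * θ = 2 * ((2 * J + 1) * θ) - 2 * θ := by ring
    rw [Finset.sum_range_succ, mul_add, ih, e1, e2, Real.sin_add, Real.sin_sub]
    ring

/-- With a random number of iterations below `J`, where `J ≥ 1 / sin θ`, amplitude amplification
succeeds with probability at least `1 / 4` on average. -/
theorem average_sin_sq {p : ℝ} (hp1 : p ≤ 1) {J : ℕ} (hJ : 1 ≤ (J : ℝ) ^ 2 * p) :
    (J : ℝ) / 4 ≤ ∑ s ∈ Finset.range J, Real.sin ((2 * s + 1) * groverAngle p) ^ 2 := by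
  have hp0 : 0 < p := by
    by_contra h
    nlinarith [sq_nonneg (J : ℝ)]
  have hJ0 : (0 : ℝ) < J := by
    refine lt_of_le_of_ne (Nat.cast_nonneg J) fun h => ?_
    rw [← h] at hJ
    norm_num at hJ
  set θ := groverAngle p with hθ
  have hsin : Real.sin θ = Real.sqrt p := sin_groverAngle hp1
  have hcos : Real.cos θ = Real.sqrt (1 - p) := cos_groverAngle hp0.le
  have hs0 : 0 < Real.sin θ := by rw [hsin]; exact Real.sqrt_pos.2 hp0
  have hc0 : 0 ≤ Real.cos θ := by rw [hcos]; exact Real.sqrt_nonneg _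
  have hJs : 1 ≤ J * Real.sin θ := by
    have : 1 ≤ (J * Real.sin θ) ^ 2 := by rw [mul_pow, hsin, Real.sq_sqrt hp0.le]; exact hJ
    have h2 : 0 ≤ J * Real.sin θ := mul_nonneg hJ0.le hs0.le
    nlinarith
  set C := ∑ s ∈ Finset.range J, Real.cos (2 * ((2 * s + 1) * θ)) with hC
  have hid : 2 * Real.sin (2 * θ) * C = Real.sin (4 * J * θ) := two_mul_sin_mul_sum_cos θ J
  have hsum : ∑ s ∈ Finset.range J, Real.sin ((2 * s + 1) * θ) ^ 2 = J / 2 - C / 2 := by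
    simp only [Real.sin_sq_eq_half_sub, Finset.sum_sub_distrib, ← Finset.sum_div, hC]
    simp [div_eq_mul_inv]
  rw [hsum]
  suffices C ≤ J / 2 by linarith
  have hx : Real.sin (2 * θ) = 2 * Real.sin θ * Real.cos θ := Real.sin_two_mul θ
  have hx0 : 0 ≤ Real.sin (2 * θ) := by rw [hx]; exact mul_nonneg (mul_nonneg zero_le_two hs0.le) hc0
  rcases le_or_gt 1 (J * Real.sin (2 * θ)) with h | h
  · have h1 := Real.sin_le_one (4 * J * θ)
    rw [← hid] at h1
    by_contra hcon
    push Not at hcon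
    nlinarith
  · -- here `θ` is so close to `π / 2` that all the `J` rotations together stay below a half turn
    refine le_trans ?_ (by positivity : (0 : ℝ) ≤ J / 2)
    have hθ2 : θ ≤ Real.pi / 2 := Real.arcsin_le_pi_div_two _
    set φ := Real.pi / 2 - θ with hφ
    have hθφ : θ = Real.pi / 2 - φ := by rw [hφ]; ring
    have hφ0 : 0 ≤ φ := by rw [hφ]; linarith
    have hch : Real.cos θ < 1 / 2 := by
      rw [hx] at h
      by_contra hcon
      push Not at hcon
      have : (J * Real.sin θ) * (1 / 2) ≤ (J * Real.sin θ) * Real.cos θ := by gcongr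
      linarith
    have hφ4 : φ < Real.pi / 4 := by
      have h1 : Real.cos (Real.pi / 3) = 1 / 2 := Real.cos_pi_div_three
      rw [← h1] at hch
      have h2 : Real.pi / 3 < θ := by
        by_contra hcon
        push Not at hcon
        have := Real.cos_le_cos_of_nonneg_of_le_pi (Real.arcsin_nonneg.2 (Real.sqrt_nonneg p))
          (by linarith [Real.pi_pos]) hcon
        exact absurd this (not_le.2 hch)
      rw [hφ]; linarith [Real.pi_pos]
    have hsφ : Real.sin (2 * θ) = Real.sin (2 * φ) := by
      rw [hθφ, ← Real.sin_pi_sub]; congr 1; ring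
    have hjor : 2 / Real.pi * (2 * φ) ≤ Real.sin (2 * φ) :=
      Real.mul_le_sin (by linarith) (by linarith)
    have hpi : 4 * J * φ ≤ Real.pi := by
      have : J * (2 / Real.pi * (2 * φ)) ≤ 1 := (mul_le_mul_of_nonneg_left hjor hJ0.le).trans
        (by rw [← hsφ]; exact h.le)
      have h3 : J * (2 / Real.pi * (2 * φ)) = 4 * J * φ / Real.pi := by ring
      rwa [h3, div_le_one Real.pi_pos] at this
    have hs4 : Real.sin (4 * J * θ) = -Real.sin (4 * J * φ) := by
      have : 4 * (J : ℝ) * θ = (J : ℕ) * (2 * Real.pi) - 4 * J * φ := by rw [hθφ]; ring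
      rw [this, Real.sin_nat_mul_two_pi_sub]
    have hJ4 : (0 : ℝ) ≤ 4 * J := by linarith
    have hs4' : 0 ≤ Real.sin (4 * J * φ) := Real.sin_nonneg_of_nonneg_of_le_pi
      (mul_nonneg hJ4 hφ0) hpi
    rcases hx0.eq_or_lt with h0 | h0
    · have hφz : φ = 0 := by
        rw [← hsφ, ← h0] at hjor
        have : 0 ≤ 2 / Real.pi := by positivity
        by_contra hne
        have hpos : 0 < φ := lt_of_le_of_ne hφ0 (Ne.symm hne)
        have : 0 < 2 / Real.pi * (2 * φ) :=
          mul_pos (div_pos two_pos Real.pi_pos) (mul_pos two_pos hpos)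
        linarith
      refine Finset.sum_nonpos fun s _ => ?_
      have : 2 * ((2 * (s : ℝ) + 1) * θ) = Real.pi + s * (2 * Real.pi) := by
        rw [hθφ, hφz]; ring
      rw [this, Real.cos_add_nat_mul_two_pi, Real.cos_pi]
      norm_num
    · by_contra hcon
      push Not at hcon
      have : 0 < 2 * Real.sin (2 * θ) * C := mul_pos (mul_pos two_pos h0) hcon
      linarith

end Average

section Prepare

variable {α β κ : Type} [Fintype β] [Fintype α] [Fintype κ]

theorem onRegister_apply (e : β ≃ α × κ) (U : UnitaryOp α) (ψ : EuclideanSpace ℂ β) (b : β) :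
    onRegister e U ψ b = U (WithLp.toLp 2 fun a => ψ (e.symm (a, (e b).2))) (e b).1 := by
  simp only [onRegister, LinearIsometryEquiv.trans_apply, LinearIsometryEquiv.symm_trans,
    LinearIsometryEquiv.piLpCongrLeft_symm, LinearIsometryEquiv.piLpCongrLeft_apply,
    LinearIsometryEquiv.piLpCurry_symm_apply, LinearIsometryEquiv.piLpCongrRight_apply,
    LinearIsometryEquiv.piLpCurry_apply, Equiv.piCongrLeft'_apply]
  rfl

theorem onRegister_ket (e : β ≃ α × κ) (U : UnitaryOp α) (a : α) (k : κ) [DecidableEq κ] (b : β) :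
    onRegister e U (ket (e.symm (a, k))) b = if (e b).2 = k then U (ket a) (e b).1 else 0 := by
  classical
  rw [onRegister_apply]
  split_ifs with h
  · have : (WithLp.toLp 2 fun a' => ket (e.symm (a, k)) (e.symm (a', (e b).2))) = ket a := by
      ext a'
      simp [ket_apply, h]
    rw [this]
  · have : (WithLp.toLp 2 fun a' => ket (e.symm (a, k)) (e.symm (a', (e b).2))) =
        (0 : EuclideanSpace ℂ α) := by
      ext a'
      simp [ket_apply, h]
    rw [this]; simp

theorem uniformKet_apply {ι : Type} [Fintype ι] [DecidableEq ι] (S : Finset ι) (o : Option ι) :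
    uniformKet S o = ((1 / Real.sqrt S.card : ℝ) : ℂ) * ∑ i ∈ S, if o = some i then 1 else 0 := by
  rw [uniformKet, PiLp.smul_apply, WithLp.ofLp_sum, Finset.sum_apply, smul_eq_mul]
  simp only [ket_apply]

theorem norm_uniformKet {ι : Type} [Fintype ι] (S : Finset ι) (hS : S.Nonempty) :
    ‖uniformKet S‖ = 1 := by
  classical
  have hS' : (0 : ℝ) < S.card := by exact_mod_cast hS.card_pos
  have h : ‖uniformKet S‖ ^ 2 = 1 := by
    rw [EuclideanSpace.norm_sq_eq, Fintype.sum_option]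
    simp only [uniformKet_apply, Option.some_inj, reduceCtorEq, if_false, Finset.sum_const_zero,
      mul_zero, norm_zero, Finset.sum_ite_eq, norm_mul, mul_pow, Complex.norm_real,
      Real.norm_eq_abs, sq_abs, div_pow, Real.sq_sqrt hS'.le]
    simp [apply_ite, hS'.ne']
  exact (pow_eq_one_iff_of_nonneg (norm_nonneg _) two_ne_zero).1 h

theorem uniformOp_ket_none {ι : Type} [Fintype ι] (S : Finset ι) (hS : S.Nonempty) :
    uniformOp S (ket none) = uniformKet S := by
  classical
  set u := uniformKet S with hu
  set v : EuclideanSpace ℂ (Option ι) := ket none with hv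
  have h1 : inner ℂ v u = (0 : ℂ) := by
    rw [hv, inner_ket_left, hu, uniformKet_apply]
    simp
  have h2 : inner ℂ u v = (0 : ℂ) := inner_eq_zero_symm.1 h1
  have hv1 : inner ℂ v v = (1 : ℂ) := by rw [hv, inner_ket_ket, if_pos rfl]
  have hu1 : inner ℂ u u = (1 : ℂ) := by
    rw [inner_self_eq_norm_sq_to_K, norm_uniformKet S hS]; simp
  have h3 : ((‖v - u‖ : ℝ) : ℂ) ^ 2 = 2 := by
    refine (inner_self_eq_norm_sq_to_K (𝕜 := ℂ) (v - u)).symm.trans ?_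
    simp only [inner_sub_left, inner_sub_right, h1, h2, hv1, hu1]
    norm_num
  rw [uniformOp, Submodule.reflection_orthogonal_apply, Submodule.reflection_singleton_apply,
    inner_sub_left, h2, hv1]
  erw [h3]
  module

theorem prepare_op_ket {X W : Type} [Fintype X] [Fintype W] {ι κ : Type} [Fintype ι] [Fintype κ]
    {f : X → Bool} (e : W ≃ Option ι × κ) (S : Finset ι) (hS : S.Nonempty) (x : X) (a : Bool)
    (k : κ) :
    (prepare e S).op f (ket (x, a, e.symm (none, k))) =
      ((1 / Real.sqrt S.card : ℝ) : ℂ) • ∑ i ∈ S, ket (x, a, e.symm (some i, k)) := by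
  classical
  ext b
  obtain ⟨x', a', w⟩ := b
  obtain ⟨⟨o, k'⟩, rfl⟩ := e.symm.surjective w
  refine (onRegister_ket _ (uniformOp S) none (x, a, k) _).trans ?_
  rw [uniformOp_ket_none S hS, uniformKet_apply, PiLp.smul_apply, WithLp.ofLp_sum,
    Finset.sum_apply, smul_eq_mul]
  simp only [ket_apply, Prod.mk.injEq, Equiv.coe_fn_mk, Equiv.apply_symm_apply,
    EmbeddingLike.apply_eq_iff_eq]
  split_ifs with h
  · obtain ⟨rfl, rfl, rfl⟩ := h
    simp
  · rw [Finset.sum_eq_zero, mul_zero]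
    intro i _
    rw [if_neg]
    tauto

end Prepare

end QQuery

/-! ### Success probability of a single Grover search -/

namespace QQuery

section Kets

variable {β ι : Type} [Fintype β]

open Classical in
theorem restrict_ket (P : Set β) (b : β) : restrict P (ket b) = if b ∈ P then ket b else 0 := by
  ext c
  rw [restrict_apply, ket_apply]
  by_cases h : c = b
  · subst h
    by_cases hc : c ∈ P <;> simp [hc, ket_apply]
  · split_ifs <;> simp [ket_apply, h]

omit [Fintype β] in
theorem restrict_sum (P : Set β) (S : Finset ι) (ψ : ι → EuclideanSpace ℂ β) :
    restrict P (∑ i ∈ S, ψ i) = ∑ i ∈ S, restrict P (ψ i) := by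
  classical
  ext c
  simp only [restrict_apply, WithLp.ofLp_sum, Finset.sum_apply]
  split_ifs <;> simp

theorem norm_sq_sum_ket {b : ι → β} (hb : Function.Injective b) (S : Finset ι) (α : ι → ℂ) :
    ‖∑ i ∈ S, α i • ket (b i)‖ ^ 2 = ∑ i ∈ S, ‖α i‖ ^ 2 := by
  have ho : Orthonormal ℂ fun i => ket (b i) :=
    (EuclideanSpace.basisFun β ℂ).orthonormal.comp b hb
  have h := ho.inner_sum α α S
  have h2 : ((‖∑ i ∈ S, α i • ket (b i)‖ ^ 2 : ℝ) : ℂ) = ((∑ i ∈ S, ‖α i‖ ^ 2 : ℝ) : ℂ) := by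
    push_cast
    refine (inner_self_eq_norm_sq_to_K (𝕜 := ℂ) _).symm.trans (h.trans ?_)
    refine Finset.sum_congr rfl fun i _ => ?_
    exact Complex.conj_mul' (α i)
  exact_mod_cast h2

open Classical in
theorem norm_sq_restrict_sum_ket {b : ι → β} (hb : Function.Injective b) (S : Finset ι)
    (α : ι → ℂ) (P : Set β) :
    ‖restrict P (∑ i ∈ S, α i • ket (b i))‖ ^ 2 = ∑ i ∈ S with b i ∈ P, ‖α i‖ ^ 2 := by
  rw [restrict_sum, ← norm_sq_sum_ket hb, Finset.sum_filter]
  congr 2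
  refine Finset.sum_congr rfl fun i _ => ?_
  rw [restrict_smul, restrict_ket]
  split_ifs <;> simp

theorem exists_of_sum_ket_ne_zero {b : ι → β} {S : Finset ι} {α : ι → ℂ} {c : β}
    (h : (∑ i ∈ S, α i • ket (b i)) c ≠ 0) : ∃ i ∈ S, c = b i := by
  classical
  by_contra hcon
  push Not at hcon
  refine h ?_
  rw [WithLp.ofLp_sum, Finset.sum_apply]
  refine Finset.sum_eq_zero fun i hi => ?_
  simp [ket_apply, hcon i hi]

end Kets

section Circuits

variable {X W : Type} [Fintype X] [Fintype W] {f : X → Bool}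

theorem permGate_op_ket (σ : Equiv.Perm (Basis X W)) (b : Basis X W) :
    (permGate σ).op f (ket b) = ket (σ b) := permOp_ket σ b

theorem query_op_ket (b : Basis X W) :
    (Gate.query : Gate X W).op f (ket b) = ket (b.1, xor b.2.1 (f b.1), b.2.2) := permOp_ket _ b

theorem apply_amplify_eq_zero (A : Circuit X W) (good : Set (Basis X W)) {b₀ : Basis X W} (s : ℕ)
    {c : Basis X W} (hc : A.apply f (ket b₀) c = 0) :
    (amplify A {b₀} good s).apply f (ket b₀) c = 0 := by
  classical
  obtain ⟨a, b, h, -⟩ := amplify_apply (f := f) A {b₀} good (Set.mem_singleton b₀)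
    (fun b hb hne => absurd hb hne) s
  rw [h]
  simp [restrict_apply, hc]

theorem Circuit.cost_append (C D : Circuit X W) :
    Circuit.cost (C ++ D) = Circuit.cost C + Circuit.cost D := by simp [Circuit.cost]

theorem Circuit.cost_inv (C : Circuit X W) : C.inv.cost = C.cost := by
  have : ∀ g : Gate X W, g.inv.cost = g.cost := fun g => by cases g <;> rfl
  simp [Circuit.cost, Circuit.inv, List.sum_reverse, Function.comp_def, this]

theorem cost_amplify (A : Circuit X W) (start good : Set (Basis X W)) (s : ℕ) :
    (amplify A start good s).cost = (2 * s + 1) * A.cost := by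
  induction s with
  | zero => rw [amplify_zero]; ring
  | succ s ih =>
    have h : ∀ P : Set (Basis X W), Circuit.cost [Gate.unitary (phaseOp P)] = 0 := fun P => rfl
    rw [amplify_succ]
    simp only [Circuit.cost_append, Circuit.cost_inv, ih, h]
    ring

end Circuits

section Lookup

variable {X D : Type} [Fintype X] [DecidableEq X] [Fintype D] {r : ℕ} {f : X → Bool}

theorem lookup_apply_ket (x₀ : X) (p : D → X) (i : Fin r) (d : D) (w : Fin r → Bool)
    (hw : w i = false) :
    (lookup x₀ p i).apply f (ket (x₀, false, d, w)) =
      ket (x₀, false, d, Function.update w i (f (p d))) := by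
  simp only [lookup, Circuit.apply_cons, Circuit.apply_nil, permGate_op_ket, query_op_ket]
  simp [loadPerm, storePerm, hw]

theorem lookups_apply_ket (x₀ : X) (p : Fin r → D → X) (l : List (Fin r)) (hl : l.Nodup) (d : D)
    (w : Fin r → Bool) (hw : ∀ i ∈ l, w i = false) :
    Circuit.apply f (l.flatMap fun i => lookup x₀ (p i) i) (ket (x₀, false, d, w)) =
      ket (x₀, false, d, fun i => if i ∈ l then f (p i d) else w i) := by
  induction l generalizing w with
  | nil => simp [Circuit.apply_nil]
  | cons i l ih =>
    rw [List.nodup_cons] at hl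
    rw [List.flatMap_cons, Circuit.apply_append, lookup_apply_ket _ _ _ _ _ (hw i (by simp)),
      ih hl.2]
    · congr 4
      funext k
      by_cases hk : k = i
      · subst hk; simp [hl.1]
      · simp [hk]
    · intro k hk
      have : k ≠ i := fun h => hl.1 (h ▸ hk)
      rw [Function.update_of_ne this]
      exact hw k (by simp [hk])

theorem cost_lookup (x₀ : X) (p : D → X) (i : Fin r) : (lookup x₀ p i).cost = 1 := rfl

variable {ι : Type} [Fintype ι]

/-- The state before the first Grover iteration. -/
theorem searchStart_apply (x₀ : X) (S : Finset ι) (hS : S.Nonempty) (p : Fin r → ι → X) :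
    Circuit.apply f (prepare (Equiv.refl _) S ::
      (List.finRange r).flatMap fun i => lookup x₀ (fun o : Option ι => o.elim x₀ (p i)) i)
      (ket (blank x₀ none)) =
    ∑ i ∈ S, ((1 / Real.sqrt S.card : ℝ) : ℂ) •
      ket ((x₀, false, some i, fun k => f (p k i)) : Basis X (Option ι × (Fin r → Bool))) := by
  rw [Circuit.apply_cons]
  have h := prepare_op_ket (f := f) (Equiv.refl (Option ι × (Fin r → Bool))) S hS x₀ false
    (fun _ => false)
  rw [Equiv.refl_symm] at h
  simp only [Equiv.refl_apply] at h
  rw [blank, h, Circuit.apply_smul, Circuit.apply_sum, Finset.smul_sum]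
  refine Finset.sum_congr rfl fun i _ => ?_
  rw [lookups_apply_ket _ _ _ (List.nodup_finRange r) _ _ (fun _ _ => rfl)]
  simp

theorem searchCircuit_support {x₀ : X} {S : Finset ι} (hS : S.Nonempty) {p : Fin r → ι → X}
    {j : ℕ} {c : Basis X (Option ι × (Fin r → Bool))}
    (hc : (searchCircuit x₀ S p j).apply f (ket (blank x₀ none)) c ≠ 0) :
    ∃ i ∈ S, c = (x₀, false, some i, fun k => f (p k i)) := by
  have h := mt (apply_amplify_eq_zero (f := f) _ _ j) hc
  rw [searchStart_apply x₀ S hS p] at h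
  exact exists_of_sum_ket_ne_zero h

theorem norm_sq_restrict_searchCircuit (x₀ : X) (S : Finset ι) (hS : S.Nonempty)
    (p : Fin r → ι → X) (j : ℕ) :
    ‖restrict {b | ∀ i, b.2.2.2 i = true}
      ((searchCircuit x₀ S p j).apply f (ket (blank x₀ none)))‖ ^ 2 =
      Real.sin ((2 * j + 1) *
        groverAngle ((S.filter fun i => ∀ k, f (p k i) = true).card / S.card : ℝ)) ^ 2 := by
  classical
  rw [searchCircuit, norm_sq_restrict_amplify _ _ _ (Set.mem_singleton _)
    (fun b hb hne => absurd hb hne), searchStart_apply x₀ S hS p, norm_sq_restrict_sum_ket]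
  · congr 4
    simp only [Set.mem_ofPred_eq, Finset.sum_const, nsmul_eq_mul, Complex.norm_real,
      Real.norm_eq_abs, sq_abs, div_pow, Real.sq_sqrt (Nat.cast_nonneg _)]
    ring
  · intro i i' h
    simpa using (congrArg (fun b => b.2.2.1) h)

theorem cost_searchCircuit (x₀ : X) (S : Finset ι) (p : Fin r → ι → X) (j : ℕ) :
    (searchCircuit x₀ S p j).cost = (2 * j + 1) * r := by
  have h : ∀ l : List (Fin r), Circuit.cost (l.flatMap fun i =>
      lookup x₀ (fun o : Option ι => o.elim x₀ (p i)) i) = l.length := by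
    intro l
    induction l with
    | nil => rfl
    | cons i l ih => rw [List.flatMap_cons, Circuit.cost_append, ih, cost_lookup, List.length_cons,
        add_comm]
  rw [searchCircuit, cost_amplify, ← List.singleton_append, Circuit.cost_append, h,
    List.length_finRange]
  have : Circuit.cost [prepare (Equiv.refl (Option ι × (Fin r → Bool))) S (X := X)] = 0 := rfl
  rw [this, zero_add]

end Lookup

namespace Prog

variable {X : Type} [Fintype X] {f : X → Bool} {α : Type}

/-- A quantum subroutine from which the program continues without failure if the measured outcome is
in `P`. -/
theorem failure_quantum_le {W : Type} [Fintype W] {Q : α → Prop} {C : Circuit X W}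
    {b₀ : Basis X W} {k : Basis X W → Prog X α} {B B' : ℕ} (hB : C.cost + B' ≤ B)
    (P : Set (Basis X W))
    (hP : ∀ b ∈ P, C.apply f (ket b₀) b ≠ 0 → (k b).failure f Q B' = 0) :
    (quantum C b₀ k).failure f Q B ≤
      1 - ‖restrict P (C.apply f (ket b₀))‖ ^ 2 := by
  classical
  rw [norm_sq_restrict, failure_quantum, if_pos (by omega), ← sum_sq_norm_apply (f := f) C b₀,
    ← Finset.sum_sub_distrib]
  refine Finset.sum_le_sum fun b _ => ?_
  split_ifs with h
  · rw [sub_self]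
    by_cases hb : C.apply f (ket b₀) b = 0
    · simp [hb]
    · have h0 : (k b).failure f Q (B - C.cost) ≤ 0 :=
        (failure_anti Q (k b) (by omega)).trans (hP b h hb).le
      exact mul_nonpos_of_nonneg_of_nonpos (sq_nonneg _) h0
  · rw [sub_zero]
    exact mul_le_of_le_one_right (sq_nonneg _) (failure_le_one _ _ _)

theorem askAll_always (l : List X) : (askAll l).Always f (· = l.map f) := by
  induction l with
  | nil => rfl
  | cons x l ih =>
    change Always f _ ((askAll l).bind fun bs => ret (f x :: bs))
    refine ih.bind fun bs h => ?_
    change f x :: bs = _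
    rw [h]; rfl

theorem queries_askAll (l : List X) : (askAll l).queries ≤ l.length := by
  induction l with
  | nil => exact le_rfl
  | cons x l ih =>
    change queries (query x fun b => (askAll l).bind fun bs => ret (b :: bs)) ≤ _
    simp only [queries, List.length_cons]
    have : (Finset.univ.sup fun b => ((askAll l).bind fun bs => ret (b :: bs)).queries)
        ≤ l.length + 0 := Finset.sup_le fun b _ => queries_bind_le ih fun _ => le_rfl
    omega

theorem onlyGrover_askAll (l : List X) : (askAll l).OnlyGrover := by
  induction l with
  | nil => trivial
  | cons x l ih => exact fun b => OnlyGrover.bind (g := fun bs => ret (b :: bs)) ih fun _ => trivial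

theorem verify_always {ι : Type} (positions : ι → List X) (o : Option ι) :
    (verify positions o).Always f fun o' =>
      (∀ i, o' = some i → o = some i ∧ ∀ x ∈ positions i, f x = true) ∧
      ∀ i, o = some i → (∀ x ∈ positions i, f x = true) → o' = some i := by
  cases o with
  | none => exact ⟨fun i (h : none = some i) => (by cases h),
      fun i (h : none = some i) => (by cases h)⟩
  | some i =>
    refine (askAll_always (positions i)).bind fun bs h => ?_
    subst h
    change (∀ j, _ → _) ∧ (∀ j, _ → _ → _)
    by_cases h : ((positions i).map f).all id = true
    · rw [if_pos h]
      have h' : ∀ x ∈ positions i, f x = true := by simpa using h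
      refine ⟨fun j hj => ?_, fun j hj _ => hj⟩
      obtain rfl : i = j := by simpa using hj
      exact ⟨rfl, h'⟩
    · rw [if_neg h]
      refine ⟨fun j hj => (by cases hj), fun j hj h' => absurd ?_ h⟩
      obtain rfl : i = j := by simpa using hj
      simpa using h'

theorem queries_verify {ι : Type} {positions : ι → List X} {r : ℕ}
    (h : ∀ i, (positions i).length ≤ r) (o : Option ι) : (verify positions o).queries ≤ r := by
  cases o with
  | none => exact Nat.zero_le _
  | some i => exact queries_bind_le (B₂ := 0) ((queries_askAll _).trans (h i)) fun _ => le_rfl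

theorem onlyGrover_verify {ι : Type} (positions : ι → List X) (o : Option ι) :
    (verify positions o).OnlyGrover := by
  cases o with
  | none => trivial
  | some i => exact OnlyGrover.bind (onlyGrover_askAll _) fun _ => trivial

theorem attempts_succ (t : Prog X (Option α)) (R : ℕ) :
    attempts t (R + 1) = t.bind fun o => match o with
      | some a => ret (some a)
      | none => attempts t R := rfl

theorem Always.attempts {Q : Option α → Prop} {t : Prog X (Option α)} (h : t.Always f Q)
    (hn : Q none) (R : ℕ) : (t.attempts R).Always f Q := by
  induction R with
  | zero => exact hn
  | succ R ih =>
    rw [attempts_succ]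
    refine h.bind fun o ho => ?_
    cases o with
    | none => exact ih
    | some a => exact ho

theorem queries_attempts {t : Prog X (Option α)} {B : ℕ} (h : t.queries ≤ B) (R : ℕ) :
    (attempts t R).queries ≤ R * B := by
  induction R with
  | zero => exact Nat.zero_le _
  | succ R ih =>
    rw [attempts_succ, add_mul, one_mul, add_comm]
    refine queries_bind_le h fun o => ?_
    cases o with
    | none => exact ih
    | some a => exact Nat.zero_le _

theorem OnlyGrover.attempts {t : Prog X (Option α)} (h : t.OnlyGrover) (R : ℕ) :
    (t.attempts R).OnlyGrover := by
  induction R with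
  | zero => trivial
  | succ R ih =>
    rw [attempts_succ]
    refine h.bind fun o => ?_
    cases o with
    | none => exact ih
    | some a => trivial

/-- Independent attempts: the failure probabilities multiply. -/
theorem failure_attempts_le {t : Prog X (Option α)} {B : ℕ} {q : ℝ} (hq : 0 ≤ q)
    (ht : t.queries ≤ B) (h : t.failure f (fun o => o.isSome = true) B ≤ q) (R : ℕ) :
    (attempts t R).failure f (fun o => o.isSome = true) (R * B) ≤ q ^ R := by
  induction R with
  | zero => exact (failure_le_one _ _ _).trans (by simp)
  | succ R ih =>
    rw [attempts_succ, add_mul, one_mul, add_comm (R * B)]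
    have := failure_bind_le (f := f) (p := t) (Q := fun o : Option α => o.isSome = true)
      (Q₁ := fun o => o.isSome = true) (B₁ := B) (B₂ := R * B) (η := 0) (ζ := q ^ R)
      (g := fun o => match o with
        | some a => ret (some a)
        | none => attempts t R) (Or.inl ht) ?_ ?_
    · refine this.trans ?_
      rw [zero_add, pow_succ, mul_comm]
      gcongr
    · intro o ho
      cases o with
      | none => simp at ho
      | some a => rw [failure_ret]; simp
    · intro o ho
      cases o with
      | none => simpa using ih
      | some a => simp at ho

section SafeGrover

variable [DecidableEq X] {ι : Type} [Fintype ι] {r : ℕ}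

/-- One run of Grover's algorithm with a random number of iterations and a check of the outcome. -/
noncomputable def groverAttempt (x₀ : X) (S : Finset ι) (p : Fin r → ι → X) : Prog X (Option ι) := do
  let j ← randomUpTo ⌈Real.sqrt S.card⌉₊
  let b ← quantum (searchCircuit x₀ S p j) (blank x₀ none) ret
  verify (fun i => List.ofFn fun k => p k i) b.2.2.1

theorem groverAttempt_eq (x₀ : X) (S : Finset ι) (p : Fin r → ι → X) :
    groverAttempt x₀ S p = choose (Finset.range (⌈Real.sqrt S.card⌉₊ + 1))
      Finset.nonempty_range_add_one fun j =>
        quantum (searchCircuit x₀ S p j) (blank x₀ none) fun b =>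
          verify (fun i => List.ofFn fun k => p k i) b.2.2.1 := rfl

theorem groverAttempt_always (x₀ : X) {S : Finset ι} (hS : S.Nonempty) (p : Fin r → ι → X) :
    (groverAttempt x₀ S p).Always f
      fun o => ∀ i, o = some i → i ∈ S ∧ ∀ k, f (p k i) = true := by
  rw [groverAttempt_eq]
  intro j _ b hb
  obtain ⟨i, hi, rfl⟩ := searchCircuit_support hS hb
  refine (verify_always _ _).mono fun o ho i' h => ?_
  obtain ⟨h1, h2⟩ := ho.1 i' h
  obtain rfl : i = i' := by simpa using h1
  exact ⟨hi, fun k => h2 _ (List.mem_ofFn.2 ⟨k, rfl⟩)⟩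

theorem queries_groverAttempt (x₀ : X) (S : Finset ι) (p : Fin r → ι → X) :
    (groverAttempt x₀ S p).queries ≤ (2 * ⌈Real.sqrt S.card⌉₊ + 2) * r := by
  rw [groverAttempt_eq]
  refine Finset.sup_le fun j hj => ?_
  have hj' : j ≤ ⌈Real.sqrt S.card⌉₊ := by
    rw [Finset.mem_range] at hj; omega
  simp only [queries, cost_searchCircuit]
  have : (Finset.univ.sup fun b : Basis X (Option ι × (Fin r → Bool)) =>
      (verify (fun i => List.ofFn fun k => p k i) b.2.2.1).queries) ≤ r :=
    Finset.sup_le fun b _ => queries_verify (fun i => (List.length_ofFn).le) _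
  nlinarith

theorem failure_groverAttempt_le (x₀ : X) {S : Finset ι} (p : Fin r → ι → X)
    (hM : ∃ i ∈ S, ∀ k, f (p k i) = true) :
    (groverAttempt x₀ S p).failure f (fun o => o.isSome = true)
      ((2 * ⌈Real.sqrt S.card⌉₊ + 2) * r) ≤ 3 / 4 := by
  classical
  obtain ⟨i₁, hi₁, hm⟩ := hM
  have hS : S.Nonempty := ⟨i₁, hi₁⟩
  have hS' : (0 : ℝ) < S.card := by exact_mod_cast hS.card_pos
  obtain ⟨m, hmdef⟩ : ∃ m : ℝ,
      m = ((S.filter fun i => ∀ k, f (p k i) = true).card : ℕ) := ⟨_, rfl⟩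
  have hm1 : 1 ≤ m := by
    rw [hmdef]
    exact_mod_cast Finset.card_pos.2 ⟨i₁, Finset.mem_filter.2 ⟨hi₁, hm⟩⟩
  have hm2 : m / S.card ≤ 1 := by
    rw [div_le_one hS', hmdef]
    exact_mod_cast Finset.card_filter_le _ _
  rw [groverAttempt_eq]
  have key := failure_choose_le (f := f) (Q := fun o : Option ι => o.isSome = true)
    (S := Finset.range (⌈Real.sqrt S.card⌉₊ + 1)) Finset.nonempty_range_add_one
    (k := fun j => quantum (searchCircuit x₀ S p j) (blank x₀ none) fun b =>
          verify (fun i => List.ofFn fun k => p k i) b.2.2.1)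
    (B := (2 * ⌈Real.sqrt S.card⌉₊ + 2) * r)
    (v := fun j => Real.sin ((2 * j + 1) * groverAngle (m / S.card)) ^ 2) (κ := 1 / 4) ?_ ?_
  · exact key.trans (by norm_num)
  · intro j hj
    have hj' : j ≤ ⌈Real.sqrt S.card⌉₊ := by
      rw [Finset.mem_range] at hj; omega
    rw [hmdef, ← norm_sq_restrict_searchCircuit x₀ S hS p j]
    refine failure_quantum_le (B' := r) ?_
      {b : Basis X (Option ι × (Fin r → Bool)) | ∀ i, b.2.2.2 i = true} ?_
    · rw [cost_searchCircuit]
      nlinarith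
    · intro b hb hne
      obtain ⟨i, hi, rfl⟩ := searchCircuit_support hS hne
      refine failure_eq_zero ((verify_always _ _).mono fun o ho => ?_)
        (queries_verify (fun i => (List.length_ofFn).le) _)
      rw [ho.2 i rfl]
      · rfl
      · intro x hx
        obtain ⟨k, rfl⟩ := List.mem_ofFn.1 hx
        exact hb k
  · rw [Finset.card_range]
    refine le_trans (by linarith) (average_sin_sq hm2 ?_)
    have h1 : Real.sqrt S.card ≤ ((⌈Real.sqrt S.card⌉₊ + 1 : ℕ) : ℝ) :=
      (Nat.le_ceil _).trans (by push_cast; linarith)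
    have h2 : (S.card : ℝ) ≤ ((⌈Real.sqrt S.card⌉₊ + 1 : ℕ) : ℝ) ^ 2 :=
      (Real.sqrt_le_left (by positivity)).1 h1
    calc (1 : ℝ) ≤ m := hm1
      _ = S.card * (m / S.card) := by field_simp
      _ ≤ _ := by gcongr

theorem isGrover_lookup {D : Type} [Fintype D] (x₀ : X) (p : D → X) (i : Fin r) :
    IsGrover (lookup x₀ p i) :=
  .append (.perm _) (.append .query (.append (.perm _) (.perm _)))

theorem isGrover_searchCircuit (x₀ : X) {S : Finset ι} (hS : S.Nonempty) (p : Fin r → ι → X)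
    (j : ℕ) : IsGrover (searchCircuit x₀ S p j) := by
  have h : ∀ l : List (Fin r), IsGrover (l.flatMap fun i =>
      lookup x₀ (fun o : Option ι => o.elim x₀ (p i)) i) := by
    intro l
    induction l with
    | nil => exact .nil
    | cons i l ih => exact .append (isGrover_lookup _ _ _) ih
  exact .amplify (.append (.prepare _ S hS) (h _)) _ _ _

theorem onlyGrover_groverAttempt (x₀ : X) {S : Finset ι} (hS : S.Nonempty) (p : Fin r → ι → X) :
    (groverAttempt x₀ S p).OnlyGrover := by
  rw [groverAttempt_eq]
  exact fun j _ => ⟨isGrover_searchCircuit x₀ hS p j, fun b => onlyGrover_verify _ _⟩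

theorem safeGrover_eq (x₀ : X) (R : ℕ) (S : Finset ι) (p : Fin r → ι → X) :
    safeGrover x₀ R S p = if S.Nonempty then attempts (groverAttempt x₀ S p) R else ret none := rfl

/-- Safe Grover Search only ever returns marked items. -/
theorem safeGrover_always (x₀ : X) (R : ℕ) (S : Finset ι) (p : Fin r → ι → X) :
    (safeGrover x₀ R S p).Always f
      fun o => ∀ i, o = some i → i ∈ S ∧ ∀ k, f (p k i) = true := by
  rw [safeGrover_eq]
  split_ifs with hS
  · exact (groverAttempt_always x₀ hS p).attempts (fun i h => by cases h) R
  · exact fun i h => by cases h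

theorem queries_safeGrover (x₀ : X) (R : ℕ) (S : Finset ι) (p : Fin r → ι → X) :
    (safeGrover x₀ R S p).queries ≤ R * ((2 * ⌈Real.sqrt S.card⌉₊ + 2) * r) := by
  rw [safeGrover_eq]
  split_ifs with hS
  · exact queries_attempts (queries_groverAttempt x₀ S p) R
  · exact Nat.zero_le _

theorem onlyGrover_safeGrover (x₀ : X) (R : ℕ) (S : Finset ι) (p : Fin r → ι → X) :
    (safeGrover x₀ R S p).OnlyGrover := by
  rw [safeGrover_eq]
  split_ifs with hS
  · exact (onlyGrover_groverAttempt x₀ hS p).attempts R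
  · trivial

/-- Safe Grover Search finds a marked item, if there is one, except with probability
`(3 / 4) ^ R`. -/
theorem failure_safeGrover_le (x₀ : X) (R : ℕ) {S : Finset ι} (p : Fin r → ι → X)
    (hM : ∃ i ∈ S, ∀ k, f (p k i) = true) :
    (safeGrover x₀ R S p).failure f (fun o => o.isSome = true)
      (R * ((2 * ⌈Real.sqrt S.card⌉₊ + 2) * r)) ≤ (3 / 4) ^ R := by
  rw [safeGrover_eq, if_pos (show S.Nonempty from hM.imp fun i h => h.1)]
  exact failure_attempts_le (by norm_num) (queries_groverAttempt x₀ S p)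
    (failure_groverAttempt_le x₀ p hM) R

end SafeGrover

end Prog

end QQuery

/-! ### Success probability of the search for a triangle with an edge in a known graph -/

namespace QQuery

/-- Amplitude amplification of a circuit that prepares a uniform superposition: the amplitudes of the
good items stay equal. -/
theorem amplify_uniform {X W ι : Type} [Fintype X] [Fintype W] {f : X → Bool} (A : Circuit X W)
    (start good : Set (Basis X W)) {b₀ : Basis X W} (hb₀ : b₀ ∈ start) {b : ι → Basis X W}
    (hb : Function.Injective b) (S : Finset ι) (z : ℂ)
    (hA : A.apply f (ket b₀) = ∑ i ∈ S, z • ket (b i))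
    (horth : ∀ c ∈ start, c ≠ b₀ →
      inner ℂ (A.apply f (ket c)) (restrict good (A.apply f (ket b₀))) = 0)
    (g : ι → Prop) [DecidablePred g] (hg : ∀ i, b i ∈ good ↔ g i) (s : ℕ) :
    ∃ α : ι → ℂ, (amplify A start good s).apply f (ket b₀) = ∑ i ∈ S, α i • ket (b i) ∧
      ∀ i, g i → ‖α i‖ ^ 2 * (S.filter g).card =
        Real.sin ((2 * s + 1) * groverAngle ((S.filter g).card * ‖z‖ ^ 2)) ^ 2 := by
  classical
  obtain ⟨a, a', h1, h2⟩ := amplify_apply (f := f) A start good hb₀ horth s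
  have hp : ‖restrict good (A.apply f (ket b₀))‖ ^ 2 = (S.filter g).card * ‖z‖ ^ 2 := by
    rw [hA, norm_sq_restrict_sum_ket hb, Finset.sum_const, nsmul_eq_mul]
    simp only [hg]
  refine ⟨fun i => if g i then a * z else a' * z, ?_, fun i hi => ?_⟩
  · rw [h1, hA, restrict_sum, Finset.smul_sum, ← Finset.sum_sub_distrib, Finset.smul_sum,
      ← Finset.sum_add_distrib]
    refine Finset.sum_congr rfl fun i _ => ?_
    rw [restrict_smul, restrict_ket]
    dsimp only
    by_cases hi : g i
    · rw [if_pos ((hg i).2 hi), if_pos hi, sub_self, smul_zero, add_zero, smul_smul]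
    · rw [if_neg (fun h => hi ((hg i).1 h)), if_neg hi, smul_zero, smul_zero, zero_add, sub_zero,
        smul_smul]
  · rw [hp] at h2
    dsimp only
    rw [← h2, if_pos hi, norm_mul, mul_pow, Complex.norm_real, Real.norm_eq_abs, sq_abs]
    ring

end QQuery

namespace Triangle

open QQuery Prog

section EdgeCircuit

variable {n : ℕ} [NeZero n] {f : Fin n × Fin n → Bool}

/-- The basis state with the edge `e` in the edge register, after the query of `e`. -/
def edgeBasis (f : Fin n × Fin n → Bool) (e : Fin n × Fin n) : Basis (Fin n × Fin n) (EdgeWork n) :=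
  (0, false, ((some e, none), Function.update (fun _ => false) 0 (f e)))

/-- The basis state with the node `v` in the node register, after the two queries that compare `v`
with the ends of the edge in the edge register. -/
def nodeBasis (f : Fin n × Fin n → Bool) (o : Option (Fin n × Fin n)) (w : Fin 3 → Bool)
    (v : Fin n) : Basis (Fin n × Fin n) (EdgeWork n) :=
  (0, false, ((o, some v), Function.update
    (Function.update w 1 (f (edgePos 1 (o, some v)))) 2 (f (edgePos 2 (o, some v)))))

theorem nodeBasis_injective (o : Option (Fin n × Fin n)) (w : Fin 3 → Bool) :
    Function.Injective (nodeBasis f o w) := fun v v' h => by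
  simpa [nodeBasis] using congrArg (fun b => b.2.2.1.2) h

theorem edgeBasis_injective : Function.Injective (edgeBasis f) := fun e e' h => by
  simpa [edgeBasis] using congrArg (fun b => b.2.2.1.1) h

theorem edgeStart_apply {S : Finset (Fin n × Fin n)} (hS : S.Nonempty) :
    Circuit.apply f (prepare (Equiv.prodAssoc _ _ _) S :: lookup 0 (edgePos 0) 0 :
      Circuit (Fin n × Fin n) (EdgeWork n)) (ket (blank 0 (none, none))) =
    ∑ e ∈ S, ((1 / Real.sqrt S.card : ℝ) : ℂ) • ket (edgeBasis f e) := by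
  rw [Circuit.apply_cons]
  have h := prepare_op_ket (f := f) (Equiv.prodAssoc (Option (Fin n × Fin n)) (Option (Fin n))
    (Fin 3 → Bool)) S hS 0 false (none, fun _ => false)
  simp only [Equiv.prodAssoc_symm_apply] at h
  rw [blank, h, Circuit.apply_smul, Circuit.apply_sum, Finset.smul_sum]
  refine Finset.sum_congr rfl fun e _ => ?_
  rw [lookup_apply_ket _ _ _ _ _ rfl]
  rfl

theorem nodeStart_apply (o : Option (Fin n × Fin n)) (w : Fin 3 → Bool) (h1 : w 1 = false)
    (h2 : w 2 = false) :
    Circuit.apply f (prepare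
        (((Equiv.prodComm _ _).prodCongr (Equiv.refl _)).trans (Equiv.prodAssoc _ _ _))
        (Finset.univ : Finset (Fin n)) ::
      (lookup 0 (edgePos 1) 1 ++ lookup 0 (edgePos 2) 2) : Circuit (Fin n × Fin n) (EdgeWork n))
      (ket (0, false, ((o, none), w))) =
    ∑ v, ((1 / Real.sqrt n : ℝ) : ℂ) • ket (nodeBasis f o w v) := by
  rw [Circuit.apply_cons]
  have h := prepare_op_ket (f := f)
    (((Equiv.prodComm (Option (Fin n × Fin n)) (Option (Fin n))).prodCongr
      (Equiv.refl (Fin 3 → Bool))).trans (Equiv.prodAssoc _ _ _))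
    Finset.univ Finset.univ_nonempty 0 false (o, w)
  simp only [Equiv.symm_trans_apply, Equiv.prodAssoc_symm_apply, Equiv.prodCongr_symm,
    Equiv.prodCongr_apply, Equiv.prodComm_symm, Equiv.refl_symm, Prod.map_apply,
    Equiv.prodComm_apply, Prod.swap_prod_mk, Equiv.refl_apply, Finset.card_univ,
    Fintype.card_fin] at h
  rw [h, Circuit.apply_smul, Circuit.apply_sum, Finset.smul_sum]
  refine Finset.sum_congr rfl fun v _ => ?_
  rw [Circuit.apply_append, lookup_apply_ket _ _ _ _ _ h1, lookup_apply_ket]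
  · rfl
  · simp [h2]

theorem edgeStage_apply {S : Finset (Fin n × Fin n)} (hS : S.Nonempty) (j : ℕ) :
    ∃ α : Fin n × Fin n → ℂ, (edgeStage S j).apply f (ket (blank 0 (none, none))) =
        ∑ e ∈ S, α e • ket (edgeBasis f e) ∧
      ∀ e, f e = true → ‖α e‖ ^ 2 * (S.filter fun e => f e = true).card =
        Real.sin ((2 * j + 1) *
          groverAngle ((S.filter fun e => f e = true).card / S.card)) ^ 2 := by
  obtain ⟨α, h1, h2⟩ := amplify_uniform (f := f) _ {blank 0 (none, none)}
    {b : Basis (Fin n × Fin n) (EdgeWork n) | b.2.2.2 0 = true} (Set.mem_singleton _)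
    edgeBasis_injective S _ (edgeStart_apply hS) (fun c hc hne => absurd hc hne)
    (fun e => f e = true) (fun e => by simp [edgeBasis]) j
  refine ⟨α, h1, fun e he => ?_⟩
  rw [h2 e he, Complex.norm_real, Real.norm_eq_abs, sq_abs, div_pow,
    Real.sq_sqrt (Nat.cast_nonneg _), one_pow, mul_one_div]

theorem nodeStage_apply (o : Option (Fin n × Fin n)) (w : Fin 3 → Bool) (h1 : w 1 = false)
    (h2 : w 2 = false) (l : ℕ) :
    ∃ γ : Fin n → ℂ, (nodeStage l).apply f (ket (0, false, ((o, none), w))) =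
        ∑ v, γ v • ket (nodeBasis f o w v) ∧
      ∀ v, (f (edgePos 1 (o, some v)) = true ∧ f (edgePos 2 (o, some v)) = true) →
        ‖γ v‖ ^ 2 * (Finset.univ.filter fun v =>
            f (edgePos 1 (o, some v)) = true ∧ f (edgePos 2 (o, some v)) = true).card =
        Real.sin ((2 * l + 1) * groverAngle ((Finset.univ.filter fun v =>
            f (edgePos 1 (o, some v)) = true ∧ f (edgePos 2 (o, some v)) = true).card / n)) ^ 2 := by
  classical
  have horth : ∀ c ∈ {b : Basis (Fin n × Fin n) (EdgeWork n) |
      b.1 = 0 ∧ b.2.1 = false ∧ b.2.2.1.2 = none ∧ b.2.2.2 1 = false ∧ b.2.2.2 2 = false},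
      c ≠ (0, false, ((o, none), w)) →
      inner ℂ (Circuit.apply f (prepare
        (((Equiv.prodComm _ _).prodCongr (Equiv.refl _)).trans (Equiv.prodAssoc _ _ _))
        (Finset.univ : Finset (Fin n)) ::
        (lookup 0 (edgePos 1) 1 ++ lookup 0 (edgePos 2) 2) : Circuit (Fin n × Fin n) (EdgeWork n))
        (ket c))
      (restrict {b | b.2.2.2 1 = true ∧ b.2.2.2 2 = true} (Circuit.apply f (prepare
        (((Equiv.prodComm _ _).prodCongr (Equiv.refl _)).trans (Equiv.prodAssoc _ _ _))
        (Finset.univ : Finset (Fin n)) ::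
        (lookup 0 (edgePos 1) 1 ++ lookup 0 (edgePos 2) 2) : Circuit (Fin n × Fin n) (EdgeWork n))
        (ket (0, false, ((o, none), w))))) = 0 := by
    -- the other start states differ in the edge register or in the bit `0`, which are left alone
    rintro ⟨x, a, ⟨o', v'⟩, w'⟩ ⟨hx, ha, hv, hw1, hw2⟩ hne
    simp only at hx ha hv hw1 hw2
    subst hx ha hv
    rw [nodeStart_apply o' w' hw1 hw2, nodeStart_apply o w h1 h2, PiLp.inner_apply]
    refine Finset.sum_eq_zero fun c _ => ?_
    by_contra hcon
    rw [restrict_apply] at hcon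
    have hc1 : (∑ v, ((1 / Real.sqrt n : ℝ) : ℂ) • ket (nodeBasis f o' w' v)) c ≠ 0 :=
      fun h => hcon (by rw [h, inner_zero_left])
    have hc2 : (∑ v, ((1 / Real.sqrt n : ℝ) : ℂ) • ket (nodeBasis f o w v)) c ≠ 0 :=
      fun h => hcon (by rw [h, ite_self, inner_zero_right])
    obtain ⟨v₁, -, e1⟩ := exists_of_sum_ket_ne_zero hc1
    obtain ⟨v₂, -, e2⟩ := exists_of_sum_ket_ne_zero hc2
    rw [e1] at e2
    have ho : o' = o := congrArg (fun b => b.2.2.1.1) e2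
    have hw0 : w' 0 = w 0 := by
      simpa [nodeBasis] using congrArg (fun b => b.2.2.2 0) e2
    refine hne ?_
    rw [ho]
    congr 3
    funext i
    fin_cases i
    · exact hw0
    · exact hw1.trans h1.symm
    · exact hw2.trans h2.symm
  obtain ⟨γ, h3, h4⟩ := amplify_uniform (f := f) _
    {b : Basis (Fin n × Fin n) (EdgeWork n) |
      b.1 = 0 ∧ b.2.1 = false ∧ b.2.2.1.2 = none ∧ b.2.2.2 1 = false ∧ b.2.2.2 2 = false}
    {b | b.2.2.2 1 = true ∧ b.2.2.2 2 = true}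
    (b₀ := (0, false, ((o, none), w))) ⟨rfl, rfl, rfl, h1, h2⟩
    (nodeBasis_injective o w) Finset.univ _ (nodeStart_apply o w h1 h2) horth
    (fun v => f (edgePos 1 (o, some v)) = true ∧ f (edgePos 2 (o, some v)) = true)
    (fun v => by simp [nodeBasis]) l
  refine ⟨γ, h3, fun v hv => ?_⟩
  rw [h4 v hv, Complex.norm_real, Real.norm_eq_abs, sq_abs, div_pow,
    Real.sq_sqrt (Nat.cast_nonneg _), one_pow, mul_one_div]

/-- The basis state after the edge search and the node search. -/
def triBasis (f : Fin n × Fin n → Bool) (q : (Fin n × Fin n) × Fin n) :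
    Basis (Fin n × Fin n) (EdgeWork n) :=
  nodeBasis f (some q.1) (Function.update (fun _ => false) 0 (f q.1)) q.2

theorem triBasis_injective : Function.Injective (triBasis f) := fun q q' h => by
  have h1 : q.1 = q'.1 := by
    simpa [triBasis, nodeBasis] using congrArg (fun b => b.2.2.1.1) h
  have h2 : q.2 = q'.2 := by
    simpa [triBasis, nodeBasis] using congrArg (fun b => b.2.2.1.2) h
  exact Prod.ext h1 h2

theorem triBasis_bits (q : (Fin n × Fin n) × Fin n) :
    (∀ i, (triBasis f q).2.2.2 i = true) ↔
      f q.1 = true ∧ f (q.1.1, q.2) = true ∧ f (q.1.2, q.2) = true := by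
  rw [Fin.forall_fin_succ, Fin.forall_fin_two]
  simp [triBasis, nodeBasis, edgePos]

/-- The two searches lead to a triangle that contains a given edge `e` with at least the product of
the probabilities of finding `e` and of finding a third node for `e`. -/
theorem edgeNode_apply {S : Finset (Fin n × Fin n)} (hS : S.Nonempty) (j l : ℕ) :
    ∃ α : (Fin n × Fin n) × Fin n → ℂ,
      (edgeStage S j ++ nodeStage l).apply f (ket (blank 0 (none, none))) =
        ∑ q ∈ S ×ˢ Finset.univ, α q • ket (triBasis f q) ∧
      ∀ e ∈ S, f e = true →
        Real.sin ((2 * j + 1) *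
            groverAngle ((S.filter fun e => f e = true).card / S.card)) ^ 2 *
          Real.sin ((2 * l + 1) * groverAngle ((Finset.univ.filter fun v =>
            f (e.1, v) = true ∧ f (e.2, v) = true).card / n)) ^ 2 ≤
        (S.filter fun e => f e = true).card *
          ‖restrict {b | ∀ i, b.2.2.2 i = true} ((edgeStage S j ++ nodeStage l).apply f
            (ket (blank 0 (none, none))))‖ ^ 2 := by
  classical
  obtain ⟨α, hα, hα2⟩ := edgeStage_apply (f := f) hS j
  choose γ hγ hγ2 using fun e : Fin n × Fin n => nodeStage_apply (f := f) (some e)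
    (Function.update (fun _ => false) 0 (f e)) (by simp) (by simp) l
  have hsum : (edgeStage S j ++ nodeStage l).apply f (ket (blank 0 (none, none))) =
      ∑ q ∈ S ×ˢ Finset.univ, (α q.1 * γ q.1 q.2) • ket (triBasis f q) := by
    rw [Circuit.apply_append, hα, Circuit.apply_sum, Finset.sum_product]
    refine Finset.sum_congr rfl fun e _ => ?_
    rw [Circuit.apply_smul, edgeBasis, hγ, Finset.smul_sum]
    refine Finset.sum_congr rfl fun v _ => ?_
    rw [smul_smul]
    rfl
  refine ⟨_, hsum, fun e he hfe => ?_⟩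
  rw [hsum, norm_sq_restrict_sum_ket triBasis_injective]
  rcases (Finset.univ.filter fun v =>
      f (e.1, v) = true ∧ f (e.2, v) = true).eq_empty_or_nonempty with h0 | hne
  · rw [h0]
    simp [groverAngle]
    positivity
  set T := Finset.univ.filter fun v => f (e.1, v) = true ∧ f (e.2, v) = true with hT
  have hT0 : (T.card : ℝ) ≠ 0 := by exact_mod_cast hne.card_pos.ne'
  have hγe : ∀ v ∈ T, ‖γ e v‖ ^ 2 * T.card =
      Real.sin ((2 * l + 1) * groverAngle (T.card / n)) ^ 2 := fun v hv =>
    hγ2 e v (by rw [hT, Finset.mem_filter] at hv; exact hv.2)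
  have hsub : ∑ v ∈ T, ‖α e * γ e v‖ ^ 2 ≤
      ∑ q ∈ S ×ˢ Finset.univ with triBasis f q ∈ {b | ∀ i, b.2.2.2 i = true},
        ‖α q.1 * γ q.1 q.2‖ ^ 2 := by
    have himg : ∑ v ∈ T, ‖α e * γ e v‖ ^ 2 =
        ∑ q ∈ T.map ⟨fun v => (e, v), fun v v' h => (Prod.ext_iff.1 h).2⟩,
          ‖α q.1 * γ q.1 q.2‖ ^ 2 := by rw [Finset.sum_map]; rfl
    rw [himg]
    refine Finset.sum_le_sum_of_subset_of_nonneg ?_ fun _ _ _ => by positivity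
    intro q hq
    obtain ⟨v, hv, rfl⟩ := Finset.mem_map.1 hq
    rw [Finset.mem_filter]
    refine ⟨Finset.mem_product.2 ⟨he, Finset.mem_univ _⟩, ?_⟩
    refine (triBasis_bits (e, v)).2 ⟨hfe, ?_⟩
    simpa [hT] using hv
  have hTsum : ∑ v ∈ T, ‖α e * γ e v‖ ^ 2 =
      ‖α e‖ ^ 2 * Real.sin ((2 * l + 1) * groverAngle (T.card / n)) ^ 2 := by
    have : ∀ v ∈ T, ‖α e * γ e v‖ ^ 2 =
        ‖α e‖ ^ 2 * Real.sin ((2 * l + 1) * groverAngle (T.card / n)) ^ 2 / T.card := by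
      intro v hv
      rw [← hγe v hv, norm_mul, mul_pow]
      field_simp
    rw [Finset.sum_congr rfl this, Finset.sum_const, nsmul_eq_mul]
    field_simp
  rw [← hα2 e hfe, mul_right_comm, mul_comm]
  rw [hTsum] at hsub
  refine mul_le_mul_of_nonneg_left (hsub.trans_eq ?_) (Nat.cast_nonneg _)
  congr!

theorem edgeTriangleCircuit_support {S : Finset (Fin n × Fin n)} (hS : S.Nonempty) {j l s : ℕ}
    {c : Basis (Fin n × Fin n) (EdgeWork n)}
    (hc : (edgeTriangleCircuit S j l s).apply f (ket (blank 0 (none, none))) c ≠ 0) :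
    ∃ q, c = triBasis f q := by
  have h := mt (apply_amplify_eq_zero (f := f) _ _ s) hc
  obtain ⟨α, hα, -⟩ := edgeNode_apply (f := f) hS j l
  rw [hα] at h
  obtain ⟨q, -, hq⟩ := exists_of_sum_ket_ne_zero h
  exact ⟨q, hq⟩

theorem cost_edgeTriangleCircuit (S : Finset (Fin n × Fin n)) (j l s : ℕ) :
    (edgeTriangleCircuit S j l s).cost = (2 * s + 1) * ((2 * j + 1) + (2 * l + 1) * 2) := by
  rw [edgeTriangleCircuit, cost_amplify, Circuit.cost_append, edgeStage, nodeStage, cost_amplify,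
    cost_amplify]
  congr 2
  exact mul_one _

theorem isGrover_edgeTriangleCircuit {S : Finset (Fin n × Fin n)} (hS : S.Nonempty) (j l s : ℕ) :
    IsGrover (edgeTriangleCircuit S j l s) :=
  .amplify (.append (.amplify (.append (.prepare _ S hS) (isGrover_lookup _ _ _)) _ _ _)
    (.amplify (.append (.prepare _ _ Finset.univ_nonempty)
      (.append (isGrover_lookup _ _ _) (isGrover_lookup _ _ _))) _ _ _)) _ _ _

/-- The nodes in the edge register and in the node register. -/
def outcome (b : Basis (Fin n × Fin n) (EdgeWork n)) : Option (Fin n × Fin n × Fin n) :=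
  b.2.2.1.1.bind fun e => b.2.2.1.2.map fun w => (e.1, e.2, w)

/-- The three pairs of a triangle. -/
def triPairs (t : Fin n × Fin n × Fin n) : List (Fin n × Fin n) :=
  [(t.1, t.2.1), (t.1, t.2.2), (t.2.1, t.2.2)]

/-- One attempt to find a triangle with an edge in `S`, with the guess `2 ^ i` for the number of edges
of the input in `S`. -/
noncomputable def edgeAttempt (c : ℝ) (S : Finset (Fin n × Fin n)) (i : ℕ) :
    GProg n (Option (Fin n × Fin n × Fin n)) := do
  let j ← randomUpTo ⌈Real.sqrt (S.card / 2 ^ i)⌉₊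
  let l ← randomUpTo ⌈Real.sqrt n⌉₊
  let s ← randomUpTo ⌈c * Real.sqrt (2 ^ i)⌉₊
  let b ← quantum (edgeTriangleCircuit S j l s) (blank 0 (none, none)) ret
  verify triPairs (outcome b)

theorem edgeAttempt_eq (c : ℝ) (S : Finset (Fin n × Fin n)) (i : ℕ) :
    edgeAttempt c S i =
      choose (Finset.range (⌈Real.sqrt (S.card / 2 ^ i)⌉₊ + 1)) Finset.nonempty_range_add_one
        fun j => choose (Finset.range (⌈Real.sqrt n⌉₊ + 1)) Finset.nonempty_range_add_one
          fun l => choose (Finset.range (⌈c * Real.sqrt (2 ^ i)⌉₊ + 1))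
            Finset.nonempty_range_add_one fun s =>
              quantum (edgeTriangleCircuit S j l s) (blank 0 (none, none)) fun b =>
                verify triPairs (outcome b) := rfl

/-- A bound for the number of queries of one attempt. -/
noncomputable def edgeAttemptCost (c : ℝ) (n N i : ℕ) : ℕ :=
  (2 * ⌈c * Real.sqrt (2 ^ i)⌉₊ + 1) *
    ((2 * ⌈Real.sqrt (N / 2 ^ i)⌉₊ + 1) + (2 * ⌈Real.sqrt n⌉₊ + 1) * 2) + 3

omit [NeZero n] in
theorem queries_verify_triPairs (o : Option (Fin n × Fin n × Fin n)) :
    (verify triPairs o).queries ≤ 3 :=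
  queries_verify (positions := triPairs) (fun _ => le_rfl) o

theorem queries_edgeAttempt (c : ℝ) (S : Finset (Fin n × Fin n)) (i : ℕ) :
    (edgeAttempt c S i).queries ≤ edgeAttemptCost c n S.card i := by
  rw [edgeAttempt_eq]
  refine Finset.sup_le fun j hj => Finset.sup_le fun l hl => Finset.sup_le fun s hs => ?_
  simp only [Finset.mem_range, Nat.lt_succ_iff] at hj hl hs
  have : (Finset.univ.sup fun b : Basis (Fin n × Fin n) (EdgeWork n) =>
      (verify triPairs (outcome b)).queries) ≤ 3 :=
    Finset.sup_le fun b _ => queries_verify_triPairs _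
  simp only [queries, cost_edgeTriangleCircuit]
  unfold edgeAttemptCost
  gcongr

theorem onlyGrover_edgeAttempt (c : ℝ) {S : Finset (Fin n × Fin n)} (hS : S.Nonempty) (i : ℕ) :
    (edgeAttempt c S i).OnlyGrover := by
  rw [edgeAttempt_eq]
  exact fun j _ l _ s _ => ⟨isGrover_edgeTriangleCircuit hS j l s, fun b => onlyGrover_verify _ _⟩

theorem edgeAttempt_always (c : ℝ) (S : Finset (Fin n × Fin n)) (i : ℕ) :
    (edgeAttempt c S i).Always f fun o => ∀ t, o = some t → ∀ x ∈ triPairs t, f x = true := by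
  rw [edgeAttempt_eq]
  exact fun j _ l _ s _ b _ => (verify_always _ _).mono fun o ho t ht => (ho.1 t ht).2

/-- An attempt with the right guess succeeds with a constant probability.  For a constant fraction of
the pairs `j, l`, the combined search succeeds with probability `Ω(1 / 2 ^ i)`, so that about
`c * √(2 ^ i)` iterations amplify it to a constant. -/
theorem failure_edgeAttempt_le {c : ℝ} (hc : 8 ≤ c) {S : Finset (Fin n × Fin n)} {i : ℕ}
    (hi : 2 ^ i ≤ (S.filter fun e => f e = true).card)
    (hi' : (S.filter fun e => f e = true).card < 2 ^ (i + 1))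
    (hT : ∃ e ∈ S, f e = true ∧ ∃ v, f (e.1, v) = true ∧ f (e.2, v) = true) :
    (edgeAttempt c S i).failure f (fun o => o.isSome = true) (edgeAttemptCost c n S.card i) ≤
      127 / 128 := by
  classical
  obtain ⟨e, heS, hfe, v, hv⟩ := hT
  have hS : S.Nonempty := ⟨e, heS⟩
  have hS0 : (0 : ℝ) < S.card := by exact_mod_cast hS.card_pos
  have hn0 : (0 : ℝ) < n := by exact_mod_cast NeZero.pos n
  obtain ⟨M, hM⟩ : ∃ M : ℝ, M = ((S.filter fun e => f e = true).card : ℕ) := ⟨_, rfl⟩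
  obtain ⟨t, ht⟩ : ∃ t : ℝ, t = ((Finset.univ.filter fun v =>
    f (e.1, v) = true ∧ f (e.2, v) = true).card : ℕ) := ⟨_, rfl⟩
  have h2i : (0 : ℝ) < 2 ^ i := by positivity
  have hMi : (2 : ℝ) ^ i ≤ M := by rw [hM]; exact_mod_cast hi
  have hMi' : M ≤ 2 * 2 ^ i := by
    rw [hM, ← pow_succ']
    exact_mod_cast hi'.le
  have hM0 : 0 < M := h2i.trans_le hMi
  have hMS : M / S.card ≤ 1 := by
    rw [div_le_one hS0, hM]
    exact_mod_cast Finset.card_filter_le _ _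
  have ht1 : 1 ≤ t := by
    rw [ht]
    exact_mod_cast Finset.card_pos.2 ⟨v, by simpa using hv⟩
  have htn : t / n ≤ 1 := by
    rw [div_le_one hn0, ht]
    have := Finset.card_filter_le (Finset.univ : Finset (Fin n))
      (fun v => f (e.1, v) = true ∧ f (e.2, v) = true)
    rw [Finset.card_univ, Fintype.card_fin] at this
    exact_mod_cast this
  set J₁ := ⌈Real.sqrt (S.card / 2 ^ i)⌉₊ + 1 with hJ₁
  set J₂ := ⌈Real.sqrt n⌉₊ + 1 with hJ₂
  set J₃ := ⌈c * Real.sqrt (2 ^ i)⌉₊ + 1 with hJ₃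
  set u : ℕ → ℝ := fun j => Real.sin ((2 * j + 1) * groverAngle (M / S.card)) ^ 2 with hu
  set w : ℕ → ℝ := fun l => Real.sin ((2 * l + 1) * groverAngle (t / n)) ^ 2 with hw
  have hu0 : ∀ j, 0 ≤ u j := fun j => sq_nonneg _
  have hw0 : ∀ l, 0 ≤ w l := fun l => sq_nonneg _
  have hu1 : ∀ j, u j ≤ 1 := fun j => Real.sin_sq_le_one _
  have hw1 : ∀ l, w l ≤ 1 := fun l => Real.sin_sq_le_one _
  have hsq : ∀ {x : ℝ} {J : ℕ}, 0 ≤ x → J = ⌈Real.sqrt x⌉₊ + 1 → x ≤ (J : ℝ) ^ 2 := by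
    intro x J hx hJ
    refine (Real.sqrt_le_left (Nat.cast_nonneg J)).1 ((Nat.le_ceil _).trans ?_)
    rw [hJ]; push_cast; linarith
  have hsumu : (J₁ : ℝ) / 4 ≤ ∑ j ∈ Finset.range J₁, u j := by
    refine average_sin_sq hMS ?_
    calc (1 : ℝ) = (S.card / M) * (M / S.card) := by field_simp
      _ ≤ (S.card / 2 ^ i) * (M / S.card) := by gcongr
      _ ≤ _ := by
        gcongr
        exact hsq (by positivity) hJ₁
  have hsumw : (J₂ : ℝ) / 4 ≤ ∑ l ∈ Finset.range J₂, w l := by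
    refine average_sin_sq htn ?_
    calc (1 : ℝ) ≤ t := ht1
      _ = n * (t / n) := by field_simp
      _ ≤ _ := by
        gcongr
        exact hsq (by positivity) hJ₂
  set p : ℕ → ℕ → ℝ := fun j l => ‖restrict {b | ∀ i, b.2.2.2 i = true}
    ((edgeStage S j ++ nodeStage l).apply f (ket (blank 0 (none, none))))‖ ^ 2 with hp
  have hp1 : ∀ j l, p j l ≤ 1 := fun j l => by
    refine (norm_sq_restrict_le _ _).trans ?_
    rw [Circuit.norm_apply, norm_ket, one_pow]
  have hpM : ∀ j l, u j * w l ≤ M * p j l := fun j l => by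
    obtain ⟨α, -, h⟩ := edgeNode_apply (f := f) hS j l
    have := h e heS hfe
    rw [← hM, ← ht] at this
    exact this
  rw [edgeAttempt_eq]
  -- The success probability given `j` and `l` is at least `1 / 4` if `u j * w l ≥ 1 / 32`, hence at
  -- least `(u j * w l - 1 / 32) / 4` in any case, and this linear bound can be averaged over `l` and
  -- then over `j`, where the averages of `w` and of `u` are at least `1 / 4`.
  refine (failure_choose_le (κ := 1 / 128)
    (v := fun j => 1 / 4 * (u j * (1 / 4) - 1 / 32)) _ (fun j hj => ?_) ?_).trans (by norm_num)
  · refine failure_choose_le (v := fun l => 1 / 4 * (u j * w l - 1 / 32)) _ (fun l hl => ?_) ?_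
    · refine failure_choose_le (v := fun s : ℕ => Real.sin ((2 * s + 1) * groverAngle (p j l)) ^ 2) _
        (fun s hs => ?_) ?_
      · simp only [Finset.mem_range, Nat.lt_succ_iff] at hj hl hs
        rw [hp, ← norm_sq_restrict_amplify _ _ _ (Set.mem_singleton _)
          (fun b hb hne => absurd hb hne)]
        refine failure_quantum_le (B' := 3) ?_
          {b : Basis (Fin n × Fin n) (EdgeWork n) | ∀ i, b.2.2.2 i = true} ?_
        · rw [cost_edgeTriangleCircuit]
          unfold edgeAttemptCost
          gcongr
        · intro b hb hne
          obtain ⟨q, rfl⟩ := edgeTriangleCircuit_support hS hne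
          refine failure_eq_zero ((verify_always _ _).mono fun o ho => ?_)
            (queries_verify_triPairs _)
          have hb' := (triBasis_bits q).1 hb
          rw [ho.2 (q.1.1, q.1.2, q.2) rfl]
          · rfl
          · intro x hx
            simp only [triPairs, List.mem_cons, List.not_mem_nil, or_false] at hx
            rcases hx with rfl | rfl | rfl
            exacts [hb'.1, hb'.2.1, hb'.2.2]
      · rw [Finset.card_range]
        have hJ0 : (0 : ℝ) ≤ J₃ := Nat.cast_nonneg _
        by_cases huw : 1 / 32 ≤ u j * w l
        · have huw1 : u j * w l ≤ 1 := mul_le_one₀ (hu1 j) (hw0 l) (hw1 l)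
          refine le_trans ?_ (average_sin_sq (hp1 j l) ?_)
          · nlinarith
          · have h1 : c * Real.sqrt (2 ^ i) ≤ J₃ :=
              (Nat.le_ceil _).trans (by rw [hJ₃]; push_cast; linarith)
            have h2 : 8 * Real.sqrt (2 ^ i) ≤ J₃ :=
              (mul_le_mul_of_nonneg_right hc (Real.sqrt_nonneg _)).trans h1
            have h3 : 64 * 2 ^ i ≤ (J₃ : ℝ) ^ 2 := by
              calc (64 : ℝ) * 2 ^ i = (8 * Real.sqrt (2 ^ i)) ^ 2 := by
                    rw [mul_pow, Real.sq_sqrt h2i.le]; norm_num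
                _ ≤ _ := by gcongr
            have hp0 : 0 ≤ p j l := sq_nonneg _
            have h4 := hpM j l
            have h5 : M * p j l ≤ 2 * 2 ^ i * p j l := by gcongr
            have h6 : 64 * 2 ^ i * p j l ≤ (J₃ : ℝ) ^ 2 * p j l := by gcongr
            linarith
        · refine le_trans ?_ (Finset.sum_nonneg fun s _ => sq_nonneg _)
          push Not at huw
          nlinarith
    · rw [Finset.card_range, ← Finset.mul_sum, Finset.sum_sub_distrib, ← Finset.mul_sum,
        Finset.sum_const, Finset.card_range, nsmul_eq_mul]
      have := mul_le_mul_of_nonneg_left hsumw (hu0 j)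
      nlinarith
  · rw [Finset.card_range, ← Finset.mul_sum, Finset.sum_sub_distrib, ← Finset.sum_mul,
      Finset.sum_const, Finset.card_range, nsmul_eq_mul]
    linarith

end EdgeCircuit

end Triangle

/-! ### Random samples -/

namespace Triangle

open QQuery Prog

section Counting

/-- The number of injections from `Fin k` that avoid `S`. -/
theorem card_avoiding {n k : ℕ} (S : Finset (Fin n)) :
    (Finset.univ.filter fun v : Fin k ↪ Fin n => ∀ i, v i ∉ S).card =
      (n - S.card).descFactorial k := by
  classical
  have h1 : Fintype.card (Fin k ↪ {x // x ∉ S}) = (n - S.card).descFactorial k := by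
    rw [Fintype.card_embedding_eq, Fintype.card_fin, Fintype.card_subtype_compl,
      Fintype.card_fin, Fintype.card_coe]
  rw [← h1, ← Finset.card_univ]
  refine (Finset.card_bij (fun v _ => v.trans (Function.Embedding.subtype _)) ?_ ?_ ?_).symm
  · intro v _
    simpa using fun i => (v i).2
  · intro v _ v' _ h
    ext i
    exact congrArg Fin.val (DFunLike.congr_fun h i)
  · intro v hv
    refine ⟨v.codRestrict {x | x ∉ S} (by simpa using hv), Finset.mem_univ _, ?_⟩
    ext i
    rfl

theorem descFactorial_sub_le {n s k : ℕ} (hs : s ≤ n) (hk : k ≤ n) :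
    ((n - s).descFactorial k : ℝ) ≤ (1 - s / n) ^ k * n.descFactorial k := by
  rcases Nat.eq_zero_or_pos n with rfl | hn
  · obtain rfl : k = 0 := by omega
    simp
  have hn' : (0 : ℝ) < n := by exact_mod_cast hn
  have hs' : (s : ℝ) / n ≤ 1 := by rw [div_le_one hn']; exact_mod_cast hs
  induction k with
  | zero => simp
  | succ k ih =>
    have hkn : (k : ℝ) ≤ n := by exact_mod_cast (Nat.le_succ k).trans hk
    rw [Nat.descFactorial_succ, Nat.descFactorial_succ, pow_succ]
    push_cast
    have h1 : ((n - s - k : ℕ) : ℝ) ≤ (1 - s / n) * (n - k : ℕ) := by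
      rw [Nat.cast_sub (by omega : k ≤ n)]
      rcases le_or_gt k (n - s) with h | h
      · rw [Nat.cast_sub h, Nat.cast_sub hs]
        have : (1 - (s : ℝ) / n) * (n - k) = n - s - k + s * k / n := by field_simp; ring
        rw [this]
        have : (0 : ℝ) ≤ s * k / n := by positivity
        linarith
      · rw [Nat.sub_eq_zero_of_le h.le]
        push_cast
        exact mul_nonneg (by linarith) (by linarith)
    calc ((n - s - k : ℕ) : ℝ) * ((n - s).descFactorial k : ℝ)
        ≤ ((1 - s / n) * (n - k : ℕ)) * ((1 - s / n) ^ k * n.descFactorial k) :=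
          mul_le_mul h1 (ih (by omega)) (Nat.cast_nonneg _) (mul_nonneg (by linarith)
            (Nat.cast_nonneg _))
      _ = _ := by ring

theorem le_descFactorial_sub {n s k : ℕ} (hs : s ≤ n) (hk : k ≤ n) :
    (n.descFactorial k : ℝ) * (n - k * s) ≤ n * (n - s).descFactorial k := by
  rcases Nat.eq_zero_or_pos s with rfl | hs0
  · simp [mul_comm]
  induction k with
  | zero => simp
  | succ k ih =>
    have hkn : (k : ℝ) + 1 ≤ n := by exact_mod_cast hk
    have hs1 : (1 : ℝ) ≤ s := by exact_mod_cast hs0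
    have hk0 : (0 : ℝ) ≤ k := Nat.cast_nonneg k
    have hd : (0 : ℝ) ≤ n.descFactorial k := Nat.cast_nonneg _
    rw [Nat.descFactorial_succ, Nat.descFactorial_succ]
    push_cast
    rw [Nat.cast_sub (by omega : k ≤ n)]
    rcases le_or_gt k (n - s) with h | h
    · rw [Nat.cast_sub h, Nat.cast_sub hs]
      have hpos : (0 : ℝ) ≤ n - s - k := by
        rw [← Nat.cast_sub hs]; have : (k : ℝ) ≤ (n - s : ℕ) := by exact_mod_cast h
        linarith
      have h1 := mul_le_mul_of_nonneg_left (ih (by omega)) hpos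
      have h2 : (n - k : ℝ) * (n - (k + 1) * s) ≤ (n - s - k) * (n - k * s) := by
        nlinarith [mul_nonneg (mul_nonneg hk0 (sub_nonneg.2 hs1)) (by linarith : (0 : ℝ) ≤ s)]
      calc (n - k : ℝ) * n.descFactorial k * (n - (k + 1) * s)
          = n.descFactorial k * ((n - k) * (n - (k + 1) * s)) := by ring
        _ ≤ n.descFactorial k * ((n - s - k) * (n - k * s)) := by gcongr
        _ ≤ _ := by linarith
    · have h1 : (n : ℝ) - (k + 1) * s ≤ 0 := by
        have h2 : (n : ℝ) < s + k := by
          have : n < s + k := by omega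
          exact_mod_cast this
        have h3 : (n : ℝ) ≤ s + k - 1 := by
          have : n + 1 ≤ s + k := by omega
          have : ((n + 1 : ℕ) : ℝ) ≤ (s + k : ℕ) := by exact_mod_cast this
          push_cast at this
          linarith
        nlinarith
      have h2 : (0 : ℝ) ≤ (n - k) * n.descFactorial k := mul_nonneg (by linarith) hd
      have h3 := mul_nonpos_of_nonneg_of_nonpos h2 h1
      have h4 : (0 : ℝ) ≤ n * ((n - s - k : ℕ) * (n - s).descFactorial k) := by positivity
      linarith

end Counting

variable {n : ℕ} {f : Fin n × Fin n → Bool}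

theorem univ_embedding_nonempty (n m : ℕ) :
    (Finset.univ : Finset (Fin (min m n) ↪ Fin n)).Nonempty :=
  ⟨Fin.castLEEmb (min_le_right m n), Finset.mem_univ _⟩

theorem randomNodes_eq (n m : ℕ) : randomNodes n m =
    choose (Finset.univ : Finset (Fin (min m n) ↪ Fin n)) (univ_embedding_nonempty n m)
      fun v => ret (List.ofFn v) := rfl

theorem queries_randomNodes (n m : ℕ) : (randomNodes n m).queries = 0 := by
  rw [randomNodes_eq]
  exact Nat.le_zero.1 (Finset.sup_le fun _ _ => le_rfl)

theorem onlyGrover_randomNodes (n m : ℕ) : (randomNodes n m).OnlyGrover := fun _ _ => trivial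

theorem randomNodes_always (m : ℕ) :
    (randomNodes n m).Always f fun l => l.length = min m n := by
  rw [randomNodes_eq]
  exact fun v _ => List.length_ofFn

theorem failure_randomNodes (m : ℕ) (Q : List (Fin n) → Prop)
    (P : (Fin (min m n) ↪ Fin n) → Prop) [DecidablePred P]
    (hP : ∀ v : Fin (min m n) ↪ Fin n, ¬Q (List.ofFn v) ↔ P v) :
    (randomNodes n m).failure f Q 0 =
      (Finset.univ.filter P).card / n.descFactorial (min m n) := by
  rw [randomNodes_eq, failure_choose, Finset.card_univ, Fintype.card_embedding_eq,
    Fintype.card_fin, Fintype.card_fin]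
  congr 1
  simp only [failure_ret, Finset.card_filter]
  push_cast
  refine Finset.sum_congr rfl fun v _ => ?_
  by_cases h : P v
  · rw [if_pos h, if_neg ((hP v).2 h)]
  · rw [if_neg h, if_pos (not_not.1 (mt (hP v).1 h))]

/-- Random distinct nodes miss a set of `s` nodes with probability at most `exp (- s m / n)`. -/
theorem failure_randomNodes_hit (hn : 0 < n) (m : ℕ) (S : Finset (Fin n)) :
    (randomNodes n m).failure f (fun l => ∃ x ∈ l, x ∈ S) 0 ≤
      Real.exp (-(S.card * (min m n : ℕ) / n)) := by
  classical
  have hn' : (0 : ℝ) < n := by exact_mod_cast hn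
  have hs : S.card ≤ n := (Finset.card_le_univ S).trans (Fintype.card_fin n).le
  have hd : (0 : ℝ) < n.descFactorial (min m n) := by
    exact_mod_cast Nat.descFactorial_pos.2 (min_le_right m n)
  rw [failure_randomNodes m _ (fun v => ∀ i, v i ∉ S) (fun v => by simp [List.mem_ofFn]),
    div_le_iff₀ hd, card_avoiding]
  refine (descFactorial_sub_le hs (min_le_right m n)).trans ?_
  gcongr
  have h0 : (0 : ℝ) ≤ 1 - S.card / n := by
    rw [sub_nonneg, div_le_one hn']; exact_mod_cast hs
  calc (1 - (S.card : ℝ) / n) ^ (min m n) ≤ Real.exp (-(S.card / n)) ^ (min m n) := by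
        gcongr
        exact Real.one_sub_le_exp_neg _
    _ = _ := by
        rw [← Real.exp_nat_mul]
        congr 1
        ring

theorem failure_randomNodes_hit_of_le {m : ℕ} (hm : n ≤ m) {S : Finset (Fin n)}
    (hS : S.Nonempty) : (randomNodes n m).failure f (fun l => ∃ x ∈ l, x ∈ S) 0 ≤ 0 := by
  classical
  obtain ⟨x, hx⟩ := hS
  rw [failure_randomNodes m _ (fun v => ¬∃ x ∈ List.ofFn v, x ∈ S) (fun v => Iff.rfl),
    Finset.filter_false_of_mem, Finset.card_empty, Nat.cast_zero, zero_div]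
  intro v _
  have hv : Function.Surjective v := by
    have h := (Fintype.bijective_iff_injective_and_card v).2 ⟨v.injective, by
      simp [min_eq_right hm]⟩
    exact h.2
  obtain ⟨i, hi⟩ := hv x
  exact not_not.2 ⟨x, List.mem_ofFn.2 ⟨i, hi⟩, hx⟩

/-- Random distinct nodes hit a set of `s` nodes with probability at most `s m / n`. -/
theorem failure_randomNodes_miss (hn : 0 < n) (m : ℕ) (S : Finset (Fin n)) :
    (randomNodes n m).failure f (fun l => ¬∃ x ∈ l, x ∈ S) 0 ≤
      S.card * (min m n : ℕ) / n := by
  classical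
  have hn' : (0 : ℝ) < n := by exact_mod_cast hn
  have hs : S.card ≤ n := (Finset.card_le_univ S).trans (Fintype.card_fin n).le
  have hd : (0 : ℝ) < n.descFactorial (min m n) := by
    exact_mod_cast Nat.descFactorial_pos.2 (min_le_right m n)
  rw [failure_randomNodes m _ (fun v => ¬∀ i, v i ∉ S) (fun v => by simp [List.mem_ofFn]),
    div_le_div_iff₀ hd hn']
  have h1 := Finset.card_filter_add_card_filter_not
      (s := (Finset.univ : Finset (Fin (min m n) ↪ Fin n))) (fun v => ∀ i, v i ∉ S)
  rw [card_avoiding, Finset.card_univ, Fintype.card_embedding_eq, Fintype.card_fin,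
    Fintype.card_fin] at h1
  have h3 : ((n - S.card).descFactorial (min m n) : ℝ) +
      ((Finset.univ.filter fun v : Fin (min m n) ↪ Fin n => ¬∀ i, v i ∉ S).card : ℕ) =
      n.descFactorial (min m n) := by exact_mod_cast h1
  have h4 := le_descFactorial_sub hs (min_le_right m n)
  nlinarith

theorem zip_map_self {α β : Type} (l : List α) (g : α → β) :
    l.zip (l.map g) = l.map fun x => (x, g x) := by
  induction l with
  | nil => rfl
  | cons x l ih => simp [ih]

/-- The neighbours of `v` in `G'` that are also neighbours of `v` in the input. -/
noncomputable def sharedNeighbours (f : Fin n × Fin n → Bool) (G' : SimpleGraph (Fin n)) (v : Fin n) :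
    Finset (Fin n) :=
  open Classical in Finset.univ.filter fun w => f (v, w) = true ∧ G'.Adj v w

theorem mem_sharedNeighbours {G' : SimpleGraph (Fin n)} {v w : Fin n} :
    w ∈ sharedNeighbours f G' v ↔ f (v, w) = true ∧ G'.Adj v w := by
  simp [sharedNeighbours]

/-- The queries of a sampling round, for the sample `l`. -/
noncomputable def sampleTail (G' : SimpleGraph (Fin n)) (v : Fin n) (l : List (Fin n)) :
    GProg n Bool :=
  (askAll (l.map fun w => (v, w))).bind fun bs =>
    ret (open Classical in (l.zip bs).any fun q => q.2 && decide (G'.Adj v q.1))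

theorem sampleRound_eq (δ : ℝ) (G' : SimpleGraph (Fin n)) (v : Fin n) :
    sampleRound δ G' v = (randomNodes n ⌈(n : ℝ) ^ δ⌉₊).bind (sampleTail G' v) := rfl

theorem sampleTail_always (G' : SimpleGraph (Fin n)) (v : Fin n) (l : List (Fin n)) :
    (sampleTail G' v l).Always f fun b => b = true ↔ ∃ x ∈ l, x ∈ sharedNeighbours f G' v := by
  refine (askAll_always _).bind fun bs h => ?_
  subst h
  change _ = true ↔ _
  rw [List.map_map, zip_map_self, List.any_map, List.any_eq_true]
  simp [mem_sharedNeighbours]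

theorem queries_sampleTail (G' : SimpleGraph (Fin n)) (v : Fin n) (l : List (Fin n)) :
    (sampleTail G' v l).queries ≤ l.length :=
  queries_bind_le (B₂ := 0) ((queries_askAll _).trans (List.length_map _).le) fun _ => le_rfl

/-- The number of pairs that are queried in one round of sampling. -/
noncomputable def sampleSize (n : ℕ) (δ : ℝ) : ℕ := min ⌈(n : ℝ) ^ δ⌉₊ n

theorem queries_sampleRound (δ : ℝ) (G' : SimpleGraph (Fin n)) (v : Fin n) :
    (sampleRound δ G' v).queries ≤ sampleSize n δ := by
  refine Finset.sup_le fun l _ => ?_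
  refine (queries_sampleTail G' v _).trans (List.length_ofFn).le

theorem failure_sampleRound_le {δ η : ℝ} {G' : SimpleGraph (Fin n)} {v : Fin n} {t : Bool}
    (h : (randomNodes n ⌈(n : ℝ) ^ δ⌉₊).failure f
      (fun l => t = true ↔ ∃ x ∈ l, x ∈ sharedNeighbours f G' v) 0 ≤ η) :
    (sampleRound δ G' v).failure f (fun b => b = t) (sampleSize n δ) ≤ η := by
  rw [sampleRound_eq]
  have h' := (failure_le_of_always (randomNodes_always _)
    (fun (l : List (Fin n)) h1 h2 => And.intro h1 h2) 0).trans h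
  have := failure_bind_le_add (f := f) (B₁ := 0) (B₂ := sampleSize n δ) (η₂ := 0)
    (Q := fun b => b = t) le_rfl h'
    (g := sampleTail G' v) fun l hl =>
      (failure_eq_zero ((sampleTail_always G' v l).mono fun b hb => ?_)
      ((queries_sampleTail G' v l).trans hl.2.le)).le
  · simpa using this
  · rw [Bool.eq_iff_iff, hb, hl.1]

theorem sampleCount_succ (δ : ℝ) (G' : SimpleGraph (Fin n)) (v : Fin n) (K : ℕ) :
    sampleCount δ G' v (K + 1) = (sampleRound δ G' v).bind fun b =>
      (sampleCount δ G' v K).bind fun C => ret (if b then C + 1 else C) := rfl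

theorem queries_sampleCount (δ : ℝ) (G' : SimpleGraph (Fin n)) (v : Fin n) (K : ℕ) :
    (sampleCount δ G' v K).queries ≤ K * sampleSize n δ := by
  induction K with
  | zero => exact Nat.zero_le _
  | succ K ih =>
    rw [sampleCount_succ, add_mul, one_mul, add_comm]
    exact queries_bind_le (queries_sampleRound δ G' v) fun b =>
      queries_bind_le (B₂ := 0) ih fun _ => le_rfl

/-- The contribution `±1` of a round with outcome `b` to twice the number of successes minus the number
of rounds. -/
def vote (b : Bool) : ℤ := if b then 1 else -1

/-- A Chernoff bound, with the moment generating function at `7`: if every round has the outcome `t`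
except with probability `q`, then the outcomes `t` outnumber the others by `x`, except with
probability `7 ^ x * (7 q + 1 / 7) ^ K`. -/
theorem failure_sampleCount_le {δ q : ℝ} {G' : SimpleGraph (Fin n)} {v : Fin n} {t : Bool}
    (h : (sampleRound δ G' v).failure f (fun b => b = t) (sampleSize n δ) ≤ q) (K : ℕ) (x : ℤ) :
    (sampleCount δ G' v K).failure f (fun C : ℕ => x ≤ vote t * (2 * C - K)) (K * sampleSize n δ) ≤
      (7 : ℝ) ^ x * (7 * q + 1 / 7) ^ K := by
  have hq : 0 ≤ q := (failure_nonneg _ _ _).trans h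
  induction K generalizing x with
  | zero =>
    change (ret 0 : GProg n ℕ).failure f _ _ ≤ _
    rw [failure_ret, pow_zero, mul_one]
    split_ifs with hx
    · positivity
    · refine one_le_zpow₀ (by norm_num) ?_
      simp at hx
      omega
  | succ K ih =>
    set μ : ℝ := (7 * q + 1 / 7) ^ K with hμ
    have hμ0 : 0 ≤ μ := by positivity
    have hbranch : ∀ b : Bool, ((sampleCount δ G' v K).bind fun C =>
        (ret (if b then C + 1 else C) : GProg n ℕ)).failure f
          (fun C : ℕ => x ≤ vote t * (2 * C - (K + 1 : ℕ))) (K * sampleSize n δ) ≤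
        (7 : ℝ) ^ (x - vote t * vote b) * μ := by
      intro b
      have := failure_bind_le_add (f := f) (B₂ := 0) (η₂ := 0)
        (Q := fun C : ℕ => x ≤ vote t * (2 * C - (K + 1 : ℕ))) le_rfl (ih (x - vote t * vote b))
        (g := fun C => (ret (if b then C + 1 else C) : GProg n ℕ)) fun C hC => ?_
      · simpa using this
      · rw [failure_ret, if_pos]
        revert hC
        cases b <;> cases t <;> simp [vote] <;> omega
    have hsame : vote t * vote t = 1 := by cases t <;> rfl
    have hdiff : ∀ b, b ≠ t → vote t * vote b = -1 := by
      intro b hb; cases t <;> cases b <;> simp_all [vote]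
    rw [sampleCount_succ, add_mul, one_mul, add_comm (K * _)]
    have h7 : (0 : ℝ) < 7 ^ x := by positivity
    have e1 : (7 : ℝ) ^ (x - 1) = 7 ^ x / 7 := by rw [zpow_sub_one₀ (by norm_num)]; ring
    have e2 : (7 : ℝ) ^ (x - -1) = 7 ^ x * 7 := by
      rw [sub_neg_eq_add, zpow_add_one₀ (by norm_num)]
    have := failure_bind_le (f := f) (p := sampleRound δ G' v)
      (Q := fun C : ℕ => x ≤ vote t * (2 * C - (K + 1 : ℕ))) (Q₁ := fun b => b = t)
      (B₁ := sampleSize n δ) (B₂ := K * sampleSize n δ) (η := 7 ^ x / 7 * μ)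
      (ζ := 7 ^ x * 7 * μ - 7 ^ x / 7 * μ)
      (g := fun b => (sampleCount δ G' v K).bind fun C =>
        (ret (if b then C + 1 else C) : GProg n ℕ))
      (Or.inl (queries_sampleRound δ G' v)) ?_ ?_
    · refine this.trans ?_
      have hζ : 0 ≤ 7 ^ x * 7 * μ - 7 ^ x / 7 * μ := by
        have : 0 ≤ 7 ^ x * μ := by positivity
        linarith
      have h1 := mul_le_mul_of_nonneg_right h hζ
      rw [pow_succ, ← hμ]
      have h2 : 0 ≤ q * (7 ^ x / 7 * μ) := by positivity
      linarith
    · rintro b rfl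
      have := hbranch b
      rwa [hsame, e1] at this
    · intro b hb
      have := hbranch b
      rw [hdiff b hb, e2] at this
      linarith

theorem acceptHigh_eq (c δ : ℝ) (G' : SimpleGraph (Fin n)) (v : Fin n) :
    acceptHigh c δ G' v = (sampleCount δ G' v (reps c n)).bind fun C =>
      ret (decide (reps c n ≤ 2 * C)) := rfl

theorem queries_acceptHigh (c δ : ℝ) (G' : SimpleGraph (Fin n)) (v : Fin n) :
    (acceptHigh c δ G' v).queries ≤ reps c n * sampleSize n δ :=
  queries_bind_le (B₂ := 0) (queries_sampleCount δ G' v _) fun _ => le_rfl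

/-- If each round has the outcome `t` except with probability `1 / 50`, so has the majority vote except
with exponentially small probability. -/
theorem failure_acceptHigh_le_of_round (c : ℝ) {δ : ℝ} {G' : SimpleGraph (Fin n)} {v : Fin n}
    {t : Bool}
    (h : (sampleRound δ G' v).failure f (fun b => b = t) (sampleSize n δ) ≤ 1 / 50) :
    (acceptHigh c δ G' v).failure f (fun b => b = t) (reps c n * sampleSize n δ) ≤
      7 * Real.exp (-reps c n) := by
  have h1 := failure_sampleCount_le h (reps c n) 1
  have h2 : (7 : ℝ) * (1 / 50) + 1 / 7 ≤ Real.exp (-1) := by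
    rw [Real.exp_neg]
    have := Real.exp_one_lt_d9
    rw [le_inv_comm₀ (by norm_num) (Real.exp_pos 1)]
    refine this.le.trans (by norm_num)
  have h3 : (7 : ℝ) ^ (1 : ℤ) * (7 * (1 / 50) + 1 / 7) ^ reps c n ≤
      7 * Real.exp (-reps c n) := by
    rw [zpow_one]
    gcongr
    calc _ ≤ Real.exp (-1) ^ reps c n := by gcongr
      _ = _ := by rw [← Real.exp_nat_mul]; congr 1; ring
  rw [acceptHigh_eq]
  have := failure_bind_le_add (f := f) (B₂ := 0) (η₂ := 0) (Q := fun b => b = t) le_rfl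
    (h1.trans h3) (g := fun C => (ret (decide (reps c n ≤ 2 * C)) : GProg n Bool)) fun C hC => ?_
  · simpa using this
  · rw [failure_ret, if_pos]
    revert hC
    cases t <;> simp [vote] <;> omega

/-- The sampling distinguishes high from low degree: it accepts the high degree hypothesis only if
the degree is at least `n ^ (1 - δ) / 100`, and the low degree hypothesis only if it is at most
`4 n ^ (1 - δ)`. -/
theorem failure_acceptHigh_le (hn : 0 < n) (c : ℝ) {δ : ℝ} (hδ : 0 ≤ δ) (G' : SimpleGraph (Fin n))
    (v : Fin n) :
    (acceptHigh c δ G' v).failure f (fun b =>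
        (b = true → (n : ℝ) ^ (1 - δ) / 100 ≤ (sharedNeighbours f G' v).card) ∧
        (b = false → ((sharedNeighbours f G' v).card : ℝ) ≤ 4 * (n : ℝ) ^ (1 - δ)))
      (reps c n * sampleSize n δ) ≤ 7 * Real.exp (-reps c n) := by
  set D := sharedNeighbours f G' v with hD
  have hn' : (0 : ℝ) < n := by exact_mod_cast hn
  have hn1 : (1 : ℝ) ≤ n := by exact_mod_cast hn
  have hpow : (n : ℝ) ^ δ * (n : ℝ) ^ (1 - δ) = n := by
    rw [← Real.rpow_add hn']; simp
  have hp0 : (0 : ℝ) < (n : ℝ) ^ (1 - δ) := Real.rpow_pos_of_pos hn' _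
  have hδ1 : (1 : ℝ) ≤ (n : ℝ) ^ δ := Real.one_le_rpow hn1 hδ
  rcases lt_or_ge (D.card : ℝ) ((n : ℝ) ^ (1 - δ) / 100) with hlow | hlow
  · -- low degree: a round succeeds with probability at most `1 / 50`
    refine (failure_mono (Q₁ := fun b => b = false) ?_ _).trans
      (failure_acceptHigh_le_of_round c (failure_sampleRound_le ?_))
    · rintro b rfl
      exact ⟨fun h => absurd h (by decide), fun _ => by linarith⟩
    · refine (failure_mono (Q₁ := fun l => ¬∃ x ∈ l, x ∈ D) ?_ 0).trans
        ((failure_randomNodes_miss hn _ D).trans ?_)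
      · intro l hl; simpa using hl
      · rw [div_le_iff₀ hn']
        have h1 : ((min ⌈(n : ℝ) ^ δ⌉₊ n : ℕ) : ℝ) ≤ 2 * (n : ℝ) ^ δ := by
          have h2 : ((min ⌈(n : ℝ) ^ δ⌉₊ n : ℕ) : ℝ) ≤ ⌈(n : ℝ) ^ δ⌉₊ := by
            exact_mod_cast min_le_left _ _
          have := Nat.ceil_lt_add_one (by linarith : (0 : ℝ) ≤ (n : ℝ) ^ δ)
          linarith
        calc (D.card : ℝ) * (min ⌈(n : ℝ) ^ δ⌉₊ n : ℕ)
            ≤ ((n : ℝ) ^ (1 - δ) / 100) * (2 * (n : ℝ) ^ δ) := by gcongr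
          _ = 1 / 50 * ((n : ℝ) ^ δ * (n : ℝ) ^ (1 - δ)) := by ring
          _ = _ := by rw [hpow]
  · rcases le_or_gt (D.card : ℝ) (4 * (n : ℝ) ^ (1 - δ)) with hhigh | hhigh
    · have h0 : (0 : ℝ) ≤ 7 * Real.exp (-reps c n) := by positivity
      exact (failure_eq_zero ((always_true _).mono fun b _ => ⟨fun _ => hlow, fun _ => hhigh⟩)
        (queries_acceptHigh c δ G' v)).le.trans h0
    · -- high degree: a round fails with probability at most `exp (-4)`
      refine (failure_mono (Q₁ := fun b => b = true) ?_ _).trans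
        (failure_acceptHigh_le_of_round c (failure_sampleRound_le ?_))
      · rintro b rfl
        exact ⟨fun _ => hlow, fun h => absurd h (by decide)⟩
      · refine (failure_mono (Q₁ := fun l => ∃ x ∈ l, x ∈ D) (fun l hl => by simpa using hl)
          0).trans ?_
        rcases le_or_gt ⌈(n : ℝ) ^ δ⌉₊ n with hm | hm
        · refine (failure_randomNodes_hit hn _ D).trans ?_
          rw [min_eq_left hm]
          have h1 : 4 ≤ (D.card : ℝ) * ⌈(n : ℝ) ^ δ⌉₊ / n := by
            rw [le_div_iff₀ hn']
            calc 4 * (n : ℝ) = (4 * (n : ℝ) ^ (1 - δ)) * (n : ℝ) ^ δ := by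
                  rw [mul_assoc, mul_comm ((n : ℝ) ^ (1 - δ)), hpow]
              _ ≤ _ := by
                  gcongr
                  exact Nat.le_ceil _
          calc Real.exp (-(D.card * ⌈(n : ℝ) ^ δ⌉₊ / n)) ≤ Real.exp (-4) := by gcongr
            _ ≤ 1 / 50 := by
              rw [Real.exp_neg, one_div]
              gcongr
              have h2 := Real.exp_one_gt_d9
              have h3 : Real.exp 4 = Real.exp 1 ^ 4 := by rw [← Real.exp_nat_mul]; norm_num
              rw [h3]
              calc (50 : ℝ) ≤ 2.7182818283 ^ 4 := by norm_num
                _ ≤ _ := by gcongr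
        · refine (failure_randomNodes_hit_of_le hm.le ?_).trans (by norm_num)
          rw [← Finset.card_pos]
          have : (0 : ℝ) < D.card := by linarith
          exact_mod_cast this

end Triangle

/-! ### Invariants of the classification of the edges -/

namespace Triangle

open scoped Classical

variable {n : ℕ}

/-- The ordered pairs of adjacent nodes, so that each edge counts twice. -/
noncomputable def adjPairs (H : SimpleGraph (Fin n)) : Finset (Fin n × Fin n) :=
  Finset.univ.filter fun p => H.Adj p.1 p.2

theorem mem_adjPairs {H : SimpleGraph (Fin n)} {p : Fin n × Fin n} :
    p ∈ adjPairs H ↔ H.Adj p.1 p.2 := by simp [adjPairs]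

theorem adjPairs_mono {H H' : SimpleGraph (Fin n)} (h : H ≤ H') : adjPairs H ⊆ adjPairs H' :=
  fun _ hp => mem_adjPairs.2 (h (mem_adjPairs.1 hp))

theorem card_adjPairs_le (H : SimpleGraph (Fin n)) : (adjPairs H).card ≤ n ^ 2 :=
  (Finset.card_le_univ _).trans (by simp [sq])

theorem card_adjPairs_sdiff {H K : SimpleGraph (Fin n)} (h : K ≤ H) :
    (adjPairs (H \ K)).card + (adjPairs K).card = (adjPairs H).card := by
  have : adjPairs (H \ K) = adjPairs H \ adjPairs K := by
    ext p; simp [mem_adjPairs, SimpleGraph.sdiff_adj]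
  rw [this]
  exact Finset.card_sdiff_add_card_eq_card (adjPairs_mono h)

/-- The nodes of non-zero degree. -/
noncomputable def nonIsolated (H : SimpleGraph (Fin n)) : Finset (Fin n) :=
  Finset.univ.filter fun v => ∃ w, H.Adj v w

theorem mem_nonIsolated {H : SimpleGraph (Fin n)} {v : Fin n} :
    v ∈ nonIsolated H ↔ ∃ w, H.Adj v w := by simp [nonIsolated]

theorem nonIsolated_mono {H H' : SimpleGraph (Fin n)} (h : H ≤ H') :
    nonIsolated H ⊆ nonIsolated H' :=
  fun _ hv => mem_nonIsolated.2 ((mem_nonIsolated.1 hv).imp fun _ hw => h hw)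

/-- The common neighbours of `a` and `b`, as a finset. -/
noncomputable def commonNbrs (H : SimpleGraph (Fin n)) (a b : Fin n) : Finset (Fin n) :=
  Finset.univ.filter fun x => H.Adj a x ∧ H.Adj b x

theorem mem_commonNbrs {H : SimpleGraph (Fin n)} {a b x : Fin n} :
    x ∈ commonNbrs H a b ↔ H.Adj a x ∧ H.Adj b x := by simp [commonNbrs]

theorem numPaths_eq_card (H : SimpleGraph (Fin n)) (a b : Fin n) :
    numPaths H a b = (commonNbrs H a b).card := by
  rw [numPaths, ← Set.ncard_coe_finset]
  congr 1
  ext x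
  simp [mem_commonNbrs]

/-- The (ordered) triangles of `T ⊔ G'` with an edge in `T`.  As an edge that is moved to `T` has few
common neighbours in `G'`, their number stays small. -/
noncomputable def mixedTriangles (s : ClassState n) : Finset (Fin n × Fin n × Fin n) :=
  Finset.univ.filter fun t => IsTriangle (s.T ⊔ s.G') t ∧
    (s.T.Adj t.1 t.2.1 ∨ s.T.Adj t.1 t.2.2 ∨ s.T.Adj t.2.1 t.2.2)

theorem mem_mixedTriangles {s : ClassState n} {t : Fin n × Fin n × Fin n} :
    t ∈ mixedTriangles s ↔ IsTriangle (s.T ⊔ s.G') t ∧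
      (s.T.Adj t.1 t.2.1 ∨ s.T.Adj t.1 t.2.2 ∨ s.T.Adj t.2.1 t.2.2) := by
  simp [mixedTriangles]

/-- The invariant of the classification for the input `G`, with `G₀` the value of `G'` at the start:
all edges of `G` are known to be in `T ⊔ E ⊔ G'`, and each edge that has left `G'` accounts for at
most `6 τ` mixed triangles. -/
structure Inv (G G₀ : SimpleGraph (Fin n)) (τ : ℝ) (s : ClassState n) : Prop where
  cover : G ≤ s.T ⊔ s.E ⊔ s.G'
  le : s.G' ≤ G₀
  mixed : ((mixedTriangles s).card : ℝ) + 6 * τ * (adjPairs s.G').card ≤ 6 * τ * n ^ 2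

/-- An edge of `G'` that is to be moved to `T`. -/
def HasLowEdge (τ : ℝ) (s : ClassState n) : Prop :=
  ∃ e : Fin n × Fin n, s.G'.Adj e.1 e.2 ∧ (numPaths s.G' e.1 e.2 : ℝ) < τ

theorem moveToT_of_not {τ : ℝ} {s : ClassState n} (h : ¬HasLowEdge τ s) : moveToT τ s = s :=
  dif_neg h

theorem exists_moveToT {τ : ℝ} {s : ClassState n} (h : HasLowEdge τ s) :
    ∃ e : Fin n × Fin n, s.G'.Adj e.1 e.2 ∧ (numPaths s.G' e.1 e.2 : ℝ) < τ ∧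
      moveToT τ s = { s with
        T := s.T ⊔ SimpleGraph.edge e.1 e.2, G' := s.G' \ SimpleGraph.edge e.1 e.2 } :=
  ⟨Exists.choose h, (Exists.choose_spec h).1, (Exists.choose_spec h).2, dif_pos h⟩

theorem moveToT_E (τ : ℝ) (s : ClassState n) : (moveToT τ s).E = s.E := by
  by_cases h : HasLowEdge τ s
  · obtain ⟨e, -, -, h⟩ := exists_moveToT h
    rw [h]
  · rw [moveToT_of_not h]

theorem moveToT_le (τ : ℝ) (s : ClassState n) : (moveToT τ s).G' ≤ s.G' := by
  by_cases h : HasLowEdge τ s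
  · obtain ⟨e, -, -, h⟩ := exists_moveToT h
    rw [h]
    exact sdiff_le
  · rw [moveToT_of_not h]

theorem edge_le_of_adj {H : SimpleGraph (Fin n)} {v w : Fin n} (h : H.Adj v w) :
    SimpleGraph.edge v w ≤ H := by
  intro a b hab
  rw [SimpleGraph.edge_adj] at hab
  rcases hab.1 with ⟨rfl, rfl⟩ | ⟨rfl, rfl⟩
  exacts [h, h.symm]

theorem card_adjPairs_moveToT {τ : ℝ} {s : ClassState n} (h : HasLowEdge τ s) :
    (adjPairs (moveToT τ s).G').card + 1 ≤ (adjPairs s.G').card := by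
  obtain ⟨e, he, -, h⟩ := exists_moveToT h
  rw [h, ← card_adjPairs_sdiff (edge_le_of_adj he)]
  gcongr
  refine Finset.card_pos.2 ⟨e, mem_adjPairs.2 ?_⟩
  rw [SimpleGraph.edge_adj]
  exact ⟨Or.inl ⟨rfl, rfl⟩, he.ne⟩

theorem card_mixedTriangles_moveToT {τ : ℝ} {s : ClassState n} (h : HasLowEdge τ s) :
    ((mixedTriangles (moveToT τ s)).card : ℝ) ≤ (mixedTriangles s).card + 6 * τ := by
  obtain ⟨⟨v, w⟩, he, hτ, h⟩ := exists_moveToT h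
  simp only at he hτ h
  rw [h]
  set C := commonNbrs s.G' v w with hC
  have hsub : mixedTriangles (⟨s.T ⊔ SimpleGraph.edge v w, s.E,
      s.G' \ SimpleGraph.edge v w⟩ : ClassState n) ⊆
      mixedTriangles s ∪ (C.image (fun x => (v, w, x)) ∪ (C.image (fun x => (w, v, x)) ∪
        (C.image (fun x => (v, x, w)) ∪ (C.image (fun x => (w, x, v)) ∪
          (C.image (fun x => (x, v, w)) ∪ C.image (fun x => (x, w, v))))))) := by
    rintro ⟨a, b, c⟩ ht
    rw [mem_mixedTriangles] at ht
    obtain ⟨⟨h1, h2, h3⟩, h4⟩ := ht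
    have hle : (s.T ⊔ SimpleGraph.edge v w) ⊔ s.G' \ SimpleGraph.edge v w ≤ s.T ⊔ s.G' :=
      sup_le (sup_le le_sup_left ((edge_le_of_adj he).trans le_sup_right))
        (sdiff_le.trans le_sup_right)
    have h1' : s.T.Adj a b ∨ s.G'.Adj a b := hle h1
    have h2' : s.T.Adj a c ∨ s.G'.Adj a c := hle h2
    have h3' : s.T.Adj b c ∨ s.G'.Adj b c := hle h3
    by_cases hmix : (a, b, c) ∈ mixedTriangles s
    · exact Finset.mem_union_left _ hmix
    have hT : ¬(s.T.Adj a b ∨ s.T.Adj a c ∨ s.T.Adj b c) := fun hT =>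
      hmix (mem_mixedTriangles.2 ⟨⟨h1', h2', h3'⟩, hT⟩)
    push Not at hT
    have g1 := h1'.resolve_left hT.1
    have g2 := h2'.resolve_left hT.2.1
    have g3 := h3'.resolve_left hT.2.2
    refine Finset.mem_union_right _ ?_
    have hmem : ∀ x, x ∈ C ↔ s.G'.Adj v x ∧ s.G'.Adj w x := fun x => mem_commonNbrs
    simp only [Finset.mem_union, Finset.mem_image, Prod.mk.injEq, hmem]
    simp only [SimpleGraph.sup_adj, SimpleGraph.edge_adj] at h4
    rcases h4 with h4 | h4 | h4
    · rcases (h4.resolve_left hT.1).1 with ⟨rfl, rfl⟩ | ⟨rfl, rfl⟩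
      · exact Or.inl ⟨c, ⟨g2, g3⟩, rfl, rfl, rfl⟩
      · exact Or.inr (Or.inl ⟨c, ⟨g3, g2⟩, rfl, rfl, rfl⟩)
    · rcases (h4.resolve_left hT.2.1).1 with ⟨rfl, rfl⟩ | ⟨rfl, rfl⟩
      · exact Or.inr (Or.inr (Or.inl ⟨b, ⟨g1, g3.symm⟩, rfl, rfl, rfl⟩))
      · exact Or.inr (Or.inr (Or.inr (Or.inl ⟨b, ⟨g3.symm, g1⟩, rfl, rfl, rfl⟩)))
    · rcases (h4.resolve_left hT.2.2).1 with ⟨rfl, rfl⟩ | ⟨rfl, rfl⟩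
      · exact Or.inr (Or.inr (Or.inr (Or.inr (Or.inl
          ⟨a, ⟨g1.symm, g2.symm⟩, rfl, rfl, rfl⟩))))
      · exact Or.inr (Or.inr (Or.inr (Or.inr (Or.inr
          ⟨a, ⟨g2.symm, g1.symm⟩, rfl, rfl, rfl⟩))))
  have hcard : (mixedTriangles (⟨s.T ⊔ SimpleGraph.edge v w, s.E,
      s.G' \ SimpleGraph.edge v w⟩ : ClassState n)).card ≤
      (mixedTriangles s).card + (C.card + (C.card + (C.card + (C.card + (C.card + C.card))))) := by
    refine (Finset.card_le_card hsub).trans ((Finset.card_union_le _ _).trans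
      (add_le_add le_rfl ?_))
    iterate 5 refine (Finset.card_union_le _ _).trans (add_le_add Finset.card_image_le ?_)
    exact Finset.card_image_le
  have hCτ : (C.card : ℝ) ≤ τ := by
    rw [hC, ← numPaths_eq_card]
    exact hτ.le
  have : ((mixedTriangles (⟨s.T ⊔ SimpleGraph.edge v w, s.E,
      s.G' \ SimpleGraph.edge v w⟩ : ClassState n)).card : ℝ) ≤
      (mixedTriangles s).card + (C.card + (C.card + (C.card + (C.card + (C.card + C.card))))) := by
    exact_mod_cast hcard
  linarith

theorem Inv.moveToT {G G₀ : SimpleGraph (Fin n)} {τ : ℝ} (hτ : 0 ≤ τ) {s : ClassState n}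
    (hs : Inv G G₀ τ s) : Inv G G₀ τ (moveToT τ s) := by
  by_cases h : HasLowEdge τ s
  · have h1 := card_mixedTriangles_moveToT h
    have h2 : ((adjPairs (Triangle.moveToT τ s).G').card : ℝ) + 1 ≤ (adjPairs s.G').card := by
      exact_mod_cast card_adjPairs_moveToT h
    refine ⟨?_, (moveToT_le τ s).trans hs.le, ?_⟩
    · obtain ⟨e, he, -, h⟩ := exists_moveToT h
      rw [h]
      refine hs.cover.trans fun a b hab => ?_
      simp only [SimpleGraph.sup_adj, SimpleGraph.sdiff_adj] at hab ⊢
      tauto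
    · have h3 := mul_le_mul_of_nonneg_left h2 (by positivity : 0 ≤ 6 * τ)
      have := hs.mixed
      linarith
  · rwa [moveToT_of_not h]

theorem moveAllToT_spec {G G₀ : SimpleGraph (Fin n)} {τ : ℝ} (hτ : 0 ≤ τ) {s : ClassState n}
    (hs : Inv G G₀ τ s) :
    Inv G G₀ τ (moveAllToT τ s) ∧ (moveAllToT τ s).G' ≤ s.G' ∧ (moveAllToT τ s).E = s.E ∧
      ∀ a b, (moveAllToT τ s).G'.Adj a b → τ ≤ numPaths (moveAllToT τ s).G' a b := by
  have key : ∀ k : ℕ, Inv G G₀ τ ((moveToT τ)^[k] s) ∧ ((moveToT τ)^[k] s).G' ≤ s.G' ∧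
      ((moveToT τ)^[k] s).E = s.E ∧ (HasLowEdge τ ((moveToT τ)^[k] s) →
        (adjPairs ((moveToT τ)^[k] s).G').card + k ≤ (adjPairs s.G').card) := by
    intro k
    induction k with
    | zero => exact ⟨hs, le_rfl, rfl, fun _ => le_rfl⟩
    | succ k ih =>
      obtain ⟨h1, h2, h3, h4⟩ := ih
      rw [Function.iterate_succ_apply']
      refine ⟨h1.moveToT hτ, (moveToT_le _ _).trans h2, (moveToT_E _ _).trans h3, fun h => ?_⟩
      have h5 : HasLowEdge τ ((moveToT τ)^[k] s) := by
        by_contra h6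
        rw [moveToT_of_not h6] at h
        exact h6 h
      have := card_adjPairs_moveToT h5
      have := h4 h5
      omega
  obtain ⟨h1, h2, h3, h4⟩ := key (n ^ 2)
  refine ⟨h1, h2, h3, fun a b hab => ?_⟩
  by_contra hcon
  push Not at hcon
  have h5 := h4 ⟨(a, b), hab, hcon⟩
  have h6 : 0 < (adjPairs ((moveToT τ)^[n ^ 2] s).G').card :=
    Finset.card_pos.2 ⟨(a, b), mem_adjPairs.2 hab⟩
  have := card_adjPairs_le s.G'
  omega

theorem Inv.moveToE {G G₀ : SimpleGraph (Fin n)} {τ : ℝ} (hτ : 0 ≤ τ) {s : ClassState n}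
    (hs : Inv G G₀ τ s) (A A' : Set (Fin n)) : Inv G G₀ τ (moveToE A A' s) := by
  refine ⟨?_, sdiff_le.trans hs.le, ?_⟩
  · refine hs.cover.trans fun a b hab => ?_
    simp only [Triangle.moveToE, SimpleGraph.sup_adj, SimpleGraph.sdiff_adj] at hab ⊢
    tauto
  · have h1 : (mixedTriangles (Triangle.moveToE A A' s)).card ≤ (mixedTriangles s).card := by
      refine Finset.card_le_card fun t ht => ?_
      rw [mem_mixedTriangles] at ht ⊢
      have hle : s.T ⊔ s.G' \ s.G'.between A A' ≤ s.T ⊔ s.G' := sup_le_sup_left sdiff_le _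
      exact ⟨⟨hle ht.1.1, hle ht.1.2.1, hle ht.1.2.2⟩, ht.2⟩
    have h2 : (adjPairs (Triangle.moveToE A A' s).G').card ≤ (adjPairs s.G').card :=
      Finset.card_le_card (adjPairs_mono sdiff_le)
    have h3 : ((mixedTriangles (Triangle.moveToE A A' s)).card : ℝ) ≤ (mixedTriangles s).card := by
      exact_mod_cast h1
    have h4 : ((adjPairs (Triangle.moveToE A A' s).G').card : ℝ) ≤ (adjPairs s.G').card := by
      exact_mod_cast h2
    have := hs.mixed
    have := mul_le_mul_of_nonneg_left h4 (by positivity : 0 ≤ 6 * τ)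
    linarith

theorem card_adjPairs_moveToE (s : ClassState n) (A A' : Set (Fin n)) :
    (adjPairs (moveToE A A' s).G').card + (adjPairs (s.G'.between A A')).card =
      (adjPairs s.G').card :=
  card_adjPairs_sdiff fun _ _ h => h.1

theorem card_adjPairs_inf_moveToE (G : SimpleGraph (Fin n)) (s : ClassState n)
    (A A' : Set (Fin n)) :
    (adjPairs (G ⊓ (moveToE A A' s).E)).card ≤
      (adjPairs (G ⊓ s.E)).card + (adjPairs (G ⊓ s.G'.between A A')).card := by
  refine (Finset.card_le_card ?_).trans (Finset.card_union_le _ _)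
  intro p hp
  simp only [Finset.mem_union, mem_adjPairs, moveToE, SimpleGraph.inf_adj,
    SimpleGraph.sup_adj] at hp ⊢
  tauto

/-- After the low degree step, `v` is isolated in `G'`. -/
theorem card_nonIsolated_moveToE {s : ClassState n} {v : Fin n} (hv : ∃ w, s.G'.Adj v w) :
    (nonIsolated (moveToE {v} Set.univ s).G').card + 1 ≤ (nonIsolated s.G').card := by
  refine Finset.card_lt_card (Finset.ssubset_iff_subset_ne.2
    ⟨nonIsolated_mono sdiff_le, fun h => ?_⟩)
  have h1 : v ∈ nonIsolated (moveToE {v} Set.univ s).G' := h ▸ mem_nonIsolated.2 hv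
  obtain ⟨w, hw⟩ := mem_nonIsolated.1 h1
  exact hw.2 ⟨hw.1, Or.inl ⟨rfl, trivial⟩⟩

/-- The low degree step moves few edges of `G` to `E`. -/
theorem card_adjPairs_between_singleton (G : SimpleGraph (Fin n)) (G' : SimpleGraph (Fin n))
    (v : Fin n) (D : Finset (Fin n)) (hD : ∀ w, G.Adj v w → G'.Adj v w → w ∈ D) :
    (adjPairs (G ⊓ G'.between {v} Set.univ)).card ≤ 2 * D.card := by
  have hsub : adjPairs (G ⊓ G'.between {v} Set.univ) ⊆
      D.image (fun w => (v, w)) ∪ D.image (fun w => (w, v)) := by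
    rintro ⟨a, b⟩ h
    rw [mem_adjPairs] at h
    obtain ⟨h1, h2, h3⟩ := h
    simp only [Set.mem_singleton_iff, Set.mem_univ, and_true, true_and] at h3
    rw [Finset.mem_union, Finset.mem_image, Finset.mem_image]
    rcases h3 with rfl | rfl
    · exact Or.inl ⟨b, hD b h1 h2, rfl⟩
    · exact Or.inr ⟨a, hD a h1.symm h2.symm, rfl⟩
  refine (Finset.card_le_card hsub).trans ((Finset.card_union_le _ _).trans ?_)
  rw [two_mul]
  exact add_le_add Finset.card_image_le Finset.card_image_le

/-- The high degree step removes many edges from `G'`: each of the nodes `a ∈ D` has `τ` common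
neighbours with `v`, all of which are in `ν_{G'}(v)`. -/
theorem le_card_adjPairs_between {G' : SimpleGraph (Fin n)} {τ : ℝ} {v : Fin n}
    (hτ : ∀ a b, G'.Adj a b → τ ≤ numPaths G' a b) (D : Finset (Fin n)) (A : Set (Fin n))
    (hD : ∀ a ∈ D, G'.Adj v a) (hA : ∀ a ∈ D, a ∈ A) :
    (D.card : ℝ) * τ ≤ (adjPairs (G'.between A (G'.neighborSet v))).card := by
  have hsub : (D.sigma fun a => commonNbrs G' v a).card ≤
      (adjPairs (G'.between A (G'.neighborSet v))).card := by
    refine Finset.card_le_card_of_injOn (fun q => (q.1, q.2)) ?_ ?_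
    · rintro ⟨a, x⟩ h
      simp only [Finset.coe_sigma, Set.mem_sigma_iff, Finset.mem_coe, mem_commonNbrs] at h
      exact mem_adjPairs.2 ⟨h.2.2, Or.inl ⟨hA a h.1, h.2.1⟩⟩
    · rintro ⟨a, x⟩ _ ⟨a', x'⟩ _ h
      simp only [Prod.mk.injEq] at h
      obtain ⟨rfl, rfl⟩ := h
      rfl
  rw [Finset.card_sigma] at hsub
  have h1 : (D.card : ℝ) * τ ≤ ∑ a ∈ D, ((commonNbrs G' v a).card : ℝ) := by
    rw [← nsmul_eq_mul]
    refine Finset.card_nsmul_le_sum _ _ _ fun a ha => ?_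
    rw [← numPaths_eq_card]
    exact hτ v a (hD a ha)
  refine h1.trans ?_
  exact_mod_cast hsub

/-- The high degree step moves few edges of `G` to `E`: the ends of such an edge are a node
`x ∈ ν_{G'}(v)` and a common neighbour of `v` and `x` in `G`. -/
theorem card_adjPairs_inf_between_le {G G' : SimpleGraph (Fin n)} {κ : ℝ} (hκ : 0 ≤ κ) {v : Fin n}
    (hG : ∀ x, G'.Adj v x → (numPaths G v x : ℝ) ≤ κ) {A : Set (Fin n)}
    (hA : ∀ a ∈ A, G.Adj v a) :
    ((adjPairs (G ⊓ G'.between A (G'.neighborSet v))).card : ℝ) ≤ 2 * (n * κ) := by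
  set N : Finset (Fin n) := Finset.univ.filter fun x => G'.Adj v x with hN
  set P := N.sigma fun x => commonNbrs G v x with hP
  have hsub : adjPairs (G ⊓ G'.between A (G'.neighborSet v)) ⊆
      P.image (fun q => (q.1, q.2)) ∪ P.image (fun q => (q.2, q.1)) := by
    rintro ⟨a, b⟩ h
    rw [mem_adjPairs] at h
    obtain ⟨h1, -, h3⟩ := h
    simp only at h1 h3
    have hmem : ∀ x y, x ∈ G'.neighborSet v → y ∈ A → G.Adj x y →
        (⟨x, y⟩ : (_ : Fin n) × Fin n) ∈ P := fun x y hx hy hxy => by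
      rw [hP, Finset.mem_sigma, mem_commonNbrs, hN, Finset.mem_filter]
      exact ⟨⟨Finset.mem_univ _, hx⟩, hA y hy, hxy⟩
    rw [Finset.mem_union, Finset.mem_image, Finset.mem_image]
    rcases h3 with ⟨ha, hb⟩ | ⟨ha, hb⟩
    · exact Or.inr ⟨⟨b, a⟩, hmem b a hb ha h1.symm, rfl⟩
    · exact Or.inl ⟨⟨a, b⟩, hmem a b ha hb h1, rfl⟩
  have hcard : (adjPairs (G ⊓ G'.between A (G'.neighborSet v))).card ≤ P.card + P.card :=
    (Finset.card_le_card hsub).trans ((Finset.card_union_le _ _).trans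
      (add_le_add Finset.card_image_le Finset.card_image_le))
  have hPc : (P.card : ℝ) ≤ n * κ := by
    rw [hP, Finset.card_sigma]
    push_cast
    calc ∑ x ∈ N, ((commonNbrs G v x).card : ℝ) ≤ N.card • κ := by
          refine Finset.sum_le_card_nsmul _ _ _ fun x hx => ?_
          rw [← numPaths_eq_card]
          exact hG x (by simpa [hN] using hx)
      _ = N.card * κ := nsmul_eq_mul _ _
      _ ≤ n * κ := by
          gcongr
          exact (Finset.card_le_univ N).trans (Fintype.card_fin n).le
  have : ((adjPairs (G ⊓ G'.between A (G'.neighborSet v))).card : ℝ) ≤ P.card + P.card := by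
    exact_mod_cast hcard
  linarith

end Triangle

/-! ### Analysis of the steps of the algorithm -/

namespace QQuery.Prog

variable {X : Type} [Fintype X] {f : X → Bool} {α β : Type}

theorem firstSome_cons (t : β → Prog X (Option α)) (b : β) (l : List β) :
    firstSome t (b :: l) = (t b).bind fun o => match o with
      | some a => ret (some a)
      | none => firstSome t l := rfl

theorem Always.firstSome {Q : Option α → Prop} {t : β → Prog X (Option α)} {l : List β}
    (h : ∀ b ∈ l, (t b).Always f Q) (hn : Q none) : (firstSome t l).Always f Q := by
  induction l with
  | nil => exact hn
  | cons b l ih =>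
    rw [firstSome_cons]
    refine (h b (by simp)).bind fun o ho => ?_
    cases o with
    | none => exact ih fun b hb => h b (by simp [hb])
    | some a => exact ho

theorem OnlyGrover.firstSome {t : β → Prog X (Option α)} (h : ∀ b, (t b).OnlyGrover)
    (l : List β) : (firstSome t l).OnlyGrover := by
  induction l with
  | nil => trivial
  | cons b l ih =>
    rw [firstSome_cons]
    refine (h b).bind fun o => ?_
    cases o with
    | none => exact ih
    | some a => trivial

/-- If the searches up to some index respect the bounds `B b`, then so does a search that goes through
the list until this index; a success at this index suffices. -/
theorem failure_firstSome_append {t : β → Prog X (Option α)} {B : β → ℕ} {b : β} {η : ℝ}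
    (hη : 0 ≤ η) (l₁ l₂ : List β) (hq : ∀ b ∈ l₁, (t b).queries ≤ B b)
    (hb : (t b).failure f (fun o => o.isSome = true) (B b) ≤ η) :
    (firstSome t (l₁ ++ b :: l₂)).failure f (fun o => o.isSome = true)
      ((l₁.map B).sum + B b) ≤ η := by
  induction l₁ with
  | nil =>
    rw [List.nil_append, firstSome_cons, List.map_nil, List.sum_nil, zero_add]
    have := failure_bind_le_add (f := f) (B₂ := 0) (η₂ := 0)
      (Q := fun o : Option α => o.isSome = true) le_rfl hb
      (g := fun o => match o with
        | some a => ret (some a)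
        | none => firstSome t l₂) fun o ho => ?_
    · simpa using this
    · cases o with
      | none => simp at ho
      | some a => rw [failure_ret]; simp
  | cons b' l₁ ih =>
    rw [List.cons_append, firstSome_cons, List.map_cons, List.sum_cons, add_assoc]
    refine failure_bind_le_of_always hη (hq b' (by simp)) (always_true _) fun o _ => ?_
    cases o with
    | none => exact ih fun b hb => hq b (by simp [hb])
    | some a =>
      rw [failure_ret]
      simpa using hη

/-- A sequence of searches, each of which fails with probability at most `η`, if there is something
to be found. -/
theorem failure_firstSome_le {t : β → Prog X (Option α)} {B : ℕ} {η : ℝ} (hη : 0 ≤ η)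
    (P : β → Prop) (l : List β)
    (h : ∀ b ∈ l, (t b).failure f (fun o => o = none → P b) B ≤ η) :
    (firstSome t l).failure f (fun o => o = none → ∀ b ∈ l, P b) (l.length * B) ≤
      l.length * η := by
  induction l with
  | nil => exact (failure_eq_zero (fun _ b hb => by simp at hb) (Nat.zero_le _)).le.trans (by simp)
  | cons b l ih =>
    rw [firstSome_cons, List.length_cons, add_mul, one_mul, add_comm (l.length * B)]
    refine (failure_bind_le_add (η₂ := l.length * η) (by positivity) (h b (by simp))
      fun o ho => ?_).trans (by push_cast; linarith)
    cases o with
    | some a =>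
      rw [failure_ret, if_pos (fun h => by cases h)]
      positivity
    | none =>
      refine (failure_mono ?_ _).trans (ih fun b hb => h b (by simp [hb]))
      intro o ho' hn b' hb'
      rcases List.mem_cons.1 hb' with rfl | hb'
      · exact ho rfl
      · exact ho' hn b' hb'

end QQuery.Prog

namespace Triangle

open QQuery Prog

section Neighbourhoods

variable {n : ℕ} {f : Fin n × Fin n → Bool}

theorem onlyGrover_sampleRound (δ : ℝ) (G' : SimpleGraph (Fin n)) (v : Fin n) :
    (sampleRound δ G' v).OnlyGrover :=
  (onlyGrover_randomNodes n _).bind fun _ => (onlyGrover_askAll _).bind fun _ => trivial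

theorem onlyGrover_acceptHigh (c δ : ℝ) (G' : SimpleGraph (Fin n)) (v : Fin n) :
    (acceptHigh c δ G' v).OnlyGrover := by
  rw [acceptHigh_eq]
  refine OnlyGrover.bind ?_ fun _ => trivial
  induction reps c n with
  | zero => trivial
  | succ K ih =>
    exact (onlyGrover_sampleRound δ G' v).bind fun b =>
      OnlyGrover.bind (g := fun C => ret (if b then C + 1 else C)) ih fun _ => trivial

/-- The neighbours of `v` in the input. -/
noncomputable def inputNbrs (f : Fin n × Fin n → Bool) (v : Fin n) : Finset (Fin n) :=
  Finset.univ.filter fun w => w ≠ v ∧ f (v, w) = true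

theorem neighbourhood_eq (v : Fin n) :
    neighbourhood v = (askAll (((List.finRange n).filter (· ≠ v)).map fun w => (v, w))).bind
      fun bs => ret (((((List.finRange n).filter (· ≠ v)).zip bs).filterMap
        fun q => if q.2 then some q.1 else none).toFinset) := rfl

theorem neighbourhood_always (v : Fin n) :
    (neighbourhood v).Always f (· = inputNbrs f v) := by
  rw [neighbourhood_eq]
  refine (askAll_always _).bind fun bs h => ?_
  subst h
  change _ = inputNbrs f v
  rw [List.map_map, zip_map_self]
  ext w
  simp [inputNbrs, List.mem_filterMap]

theorem queries_neighbourhood (v : Fin n) : (neighbourhood v).queries ≤ n := by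
  rw [neighbourhood_eq]
  refine queries_bind_le (B₂ := 0) ((queries_askAll _).trans ?_) fun _ => le_rfl
  rw [List.length_map]
  exact (List.length_filter_le _ _).trans (List.length_finRange).le

theorem onlyGrover_neighbourhood (v : Fin n) : (neighbourhood v).OnlyGrover :=
  (onlyGrover_askAll _).bind fun _ => trivial

theorem neighbourhoods_cons (v : Fin n) (l : List (Fin n)) :
    neighbourhoods (v :: l) = (neighbourhood v).bind fun A =>
      (neighbourhoods l).bind fun L => ret ((v, A) :: L) := rfl

theorem neighbourhoods_always (l : List (Fin n)) :
    (neighbourhoods l).Always f (· = l.map fun v => (v, inputNbrs f v)) := by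
  induction l with
  | nil => rfl
  | cons v l ih =>
    rw [neighbourhoods_cons]
    refine (neighbourhood_always v).bind fun A hA => ih.bind fun L hL => ?_
    change _ :: _ = _
    rw [hA, hL]; rfl

theorem queries_neighbourhoods (l : List (Fin n)) :
    (neighbourhoods l).queries ≤ l.length * n := by
  induction l with
  | nil => exact Nat.zero_le _
  | cons v l ih =>
    rw [neighbourhoods_cons, List.length_cons, add_mul, one_mul, add_comm]
    exact queries_bind_le (queries_neighbourhood v) fun A =>
      queries_bind_le (B₂ := 0) ih fun _ => le_rfl

theorem onlyGrover_neighbourhoods (l : List (Fin n)) : (neighbourhoods l).OnlyGrover := by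
  induction l with
  | nil => trivial
  | cons v l ih => exact (onlyGrover_neighbourhood v).bind fun A => ih.bind fun _ => trivial

end Neighbourhoods

section Searches

variable {n : ℕ} [NeZero n] {G : SimpleGraph (Fin n)}

omit [NeZero n] in
theorem adjMatrix_eq_true {p : Fin n × Fin n} : adjMatrix G p = true ↔ G.Adj p.1 p.2 := by
  simp [adjMatrix]

omit [NeZero n] in
theorem mem_inputNbrs {v w : Fin n} : w ∈ inputNbrs (adjMatrix G) v ↔ G.Adj v w := by
  simp only [inputNbrs, Finset.mem_filter, Finset.mem_univ, true_and, adjMatrix_eq_true]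
  exact ⟨fun h => h.2, fun h => ⟨h.ne', h⟩⟩

/-- An output, if any, is a triangle. -/
def Sound (G : SimpleGraph (Fin n)) (o : Option (Fin n × Fin n × Fin n)) : Prop :=
  ∀ t, o = some t → IsTriangle G t

/-- The output is a triangle. -/
def Finds (G : SimpleGraph (Fin n)) (o : Option (Fin n × Fin n × Fin n)) : Prop :=
  ∃ t, o = some t ∧ IsTriangle G t

theorem searchNeighbourhood_eq (c : ℝ) (v : Fin n) (A : Finset (Fin n)) :
    searchNeighbourhood c v A =
      (safeGrover 0 (reps c n) ((A ×ˢ A).filter fun e => e.1 < e.2)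
        (fun (_ : Fin 1) (e : Fin n × Fin n) => e)).bind fun o =>
          ret (o.map fun e => (v, e.1, e.2)) := rfl

theorem searchNeighbourhood_always (c : ℝ) (v : Fin n) :
    (searchNeighbourhood c v (inputNbrs (adjMatrix G) v)).Always (adjMatrix G) (Sound G) := by
  rw [searchNeighbourhood_eq]
  refine (safeGrover_always _ _ _ _).bind fun o ho t ht => ?_
  obtain ⟨e, rfl, rfl⟩ := Option.map_eq_some_iff.1 ht
  obtain ⟨h1, h2⟩ := ho e rfl
  rw [Finset.mem_filter, Finset.mem_product] at h1
  exact ⟨mem_inputNbrs.1 h1.1.1, mem_inputNbrs.1 h1.1.2, adjMatrix_eq_true.1 (h2 0)⟩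

/-- The number of queries of a search in a neighbourhood. -/
noncomputable def nbrSearchCost (c : ℝ) (n : ℕ) : ℕ := reps c n * (2 * n + 2)

omit [NeZero n] in
theorem safeGrover_cost_le (c : ℝ) (A : Finset (Fin n)) :
    reps c n * ((2 * ⌈Real.sqrt ((A ×ˢ A).filter fun e => e.1 < e.2).card⌉₊ + 2) * 1) ≤
      nbrSearchCost c n := by
  have h1 : ((A ×ˢ A).filter fun e => e.1 < e.2).card ≤ n ^ 2 :=
    (Finset.card_le_univ _).trans (by simp [sq])
  have h2 : ⌈Real.sqrt ((A ×ˢ A).filter fun e => e.1 < e.2).card⌉₊ ≤ n := by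
    rw [Nat.ceil_le, Real.sqrt_le_left (Nat.cast_nonneg n)]
    exact_mod_cast h1
  rw [mul_one, nbrSearchCost]
  gcongr

theorem queries_searchNeighbourhood (c : ℝ) (v : Fin n) (A : Finset (Fin n)) :
    (searchNeighbourhood c v A).queries ≤ nbrSearchCost c n :=
  (queries_bind_le (B₂ := 0) (queries_safeGrover _ _ _ _) fun _ => le_rfl).trans
    (safeGrover_cost_le c A)

theorem onlyGrover_searchNeighbourhood (c : ℝ) (v : Fin n) (A : Finset (Fin n)) :
    (searchNeighbourhood c v A).OnlyGrover :=
  (onlyGrover_safeGrover _ _ _ _).bind fun _ => trivial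

theorem failure_searchNeighbourhood_le (c : ℝ) (v : Fin n) :
    (searchNeighbourhood c v (inputNbrs (adjMatrix G) v)).failure (adjMatrix G)
      (fun o => o = none → ∀ a b, G.Adj v a → G.Adj v b → ¬G.Adj a b) (nbrSearchCost c n) ≤
      (3 / 4) ^ reps c n := by
  by_cases h : ∃ a b, G.Adj v a ∧ G.Adj v b ∧ G.Adj a b
  · obtain ⟨a, b, ha, hb, hab⟩ := h
    set A := inputNbrs (adjMatrix G) v with hA
    have hM : ∃ e ∈ (A ×ˢ A).filter fun e => e.1 < e.2, ∀ _ : Fin 1, adjMatrix G e = true := by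
      rcases lt_or_gt_of_ne hab.ne with h | h
      · refine ⟨(a, b), ?_, fun _ => adjMatrix_eq_true.2 hab⟩
        simp [hA, mem_inputNbrs, ha, hb, h]
      · refine ⟨(b, a), ?_, fun _ => adjMatrix_eq_true.2 hab.symm⟩
        simp [hA, mem_inputNbrs, ha, hb, h]
    have h1 := failure_safeGrover_le (f := adjMatrix G) 0 (reps c n)
      (fun (_ : Fin 1) (e : Fin n × Fin n) => e) hM
    have h2 := failure_bind_le_add (f := adjMatrix G) (B₂ := 0) (η₂ := 0)
      (Q := fun o => o = none → ∀ a b, G.Adj v a → G.Adj v b → ¬G.Adj a b) le_rfl h1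
      (g := fun o => ret (o.map fun e => (v, e.1, e.2))) fun o ho => ?_
    · rw [← searchNeighbourhood_eq, add_zero, add_zero] at h2
      exact (failure_anti _ _ (safeGrover_cost_le c A)).trans h2
    · rw [failure_ret, if_pos]
      intro hn
      rw [Option.map_eq_none_iff] at hn
      rw [hn] at ho
      simp at ho
  · have h0 : (0 : ℝ) ≤ (3 / 4) ^ reps c n := by positivity
    refine (failure_eq_zero ((always_true _).mono fun o _ _ a b ha hb hab => ?_)
      (queries_searchNeighbourhood c v _)).le.trans h0
    exact h ⟨a, b, ha, hb, hab⟩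

theorem searchTriangles_always (c : ℝ) (T : SimpleGraph (Fin n)) :
    (searchTriangles c T).Always (adjMatrix G) (Sound G) := by
  refine (safeGrover_always _ _ _ _).mono fun o ho t ht => ?_
  have h := (ho t ht).2
  exact ⟨adjMatrix_eq_true.1 (h 0), adjMatrix_eq_true.1 (h 1), adjMatrix_eq_true.1 (h 2)⟩

theorem onlyGrover_searchTriangles (c : ℝ) (T : SimpleGraph (Fin n)) :
    (searchTriangles c T).OnlyGrover := onlyGrover_safeGrover _ _ _ _

/-- The number of queries of a search among `N` triangles. -/
noncomputable def triSearchCost (c : ℝ) (n : ℕ) (N : ℝ) : ℕ :=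
  reps c n * ((2 * ⌈Real.sqrt N⌉₊ + 2) * 3)

open Classical in
/-- The triangles of `T`, each of them once. -/
noncomputable def sortedTriangles (T : SimpleGraph (Fin n)) : Finset (Fin n × Fin n × Fin n) :=
  Finset.univ.filter fun t => t.1 < t.2.1 ∧ t.2.1 < t.2.2 ∧ IsTriangle T t

omit [NeZero n] in
theorem mem_sortedTriangles {T : SimpleGraph (Fin n)} {t : Fin n × Fin n × Fin n} :
    t ∈ sortedTriangles T ↔ t.1 < t.2.1 ∧ t.2.1 < t.2.2 ∧ IsTriangle T t := by
  simp [sortedTriangles]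

theorem queries_searchTriangles (c : ℝ) {T : SimpleGraph (Fin n)} {N : ℝ}
    (hN : ((sortedTriangles T).card : ℝ) ≤ N) :
    (searchTriangles c T).queries ≤ triSearchCost c n N := by
  refine (queries_safeGrover _ _ _ _).trans ?_
  unfold triSearchCost
  gcongr
  exact hN

omit [NeZero n] in
/-- A triangle can be sorted. -/
theorem IsTriangle.exists_sorted {G : SimpleGraph (Fin n)} {t : Fin n × Fin n × Fin n}
    (h : IsTriangle G t) (P : Fin n → Fin n → Prop) (hP : ∀ a b, P a b → P b a)
    (h1 : P t.1 t.2.1) (h2 : P t.1 t.2.2) (h3 : P t.2.1 t.2.2) :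
    ∃ t' : Fin n × Fin n × Fin n, t'.1 < t'.2.1 ∧ t'.2.1 < t'.2.2 ∧ IsTriangle G t' ∧
      P t'.1 t'.2.1 ∧ P t'.1 t'.2.2 ∧ P t'.2.1 t'.2.2 := by
  obtain ⟨a, b, c⟩ := t
  obtain ⟨hab, hac, hbc⟩ := h
  simp only at *
  rcases lt_or_gt_of_ne hab.ne with g1 | g1 <;> rcases lt_or_gt_of_ne hac.ne with g2 | g2 <;>
    rcases lt_or_gt_of_ne hbc.ne with g3 | g3
  · exact ⟨(a, b, c), g1, g3, ⟨hab, hac, hbc⟩, h1, h2, h3⟩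
  · exact ⟨(a, c, b), g2, g3, ⟨hac, hab, hbc.symm⟩, h2, h1, hP _ _ h3⟩
  · exact absurd (g1.trans g3) (not_lt.2 g2.le)
  · exact ⟨(c, a, b), g2, g1, ⟨hac.symm, hbc.symm, hab⟩, hP _ _ h2, hP _ _ h3, h1⟩
  · exact ⟨(b, a, c), g1, g2, ⟨hab.symm, hbc, hac⟩, hP _ _ h1, h3, h2⟩
  · exact absurd (g3.trans g1) (not_lt.2 g2.le)
  · exact ⟨(b, c, a), g3, g2, ⟨hbc, hab.symm, hac.symm⟩, h3, hP _ _ h1, hP _ _ h2⟩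
  · exact ⟨(c, b, a), g3, g1, ⟨hbc.symm, hac.symm, hab.symm⟩, hP _ _ h3, hP _ _ h2, hP _ _ h1⟩

/-- The search among the triangles of `T` succeeds if one of them is a triangle of `G`. -/
theorem failure_searchTriangles_le (c : ℝ) {T : SimpleGraph (Fin n)} {N : ℝ}
    (hN : ((sortedTriangles T).card : ℝ) ≤ N) {t : Fin n × Fin n × Fin n} (ht : IsTriangle G t)
    (htT : IsTriangle T t) :
    (searchTriangles c T).failure (adjMatrix G) (Finds G) (triSearchCost c n N) ≤
      (3 / 4) ^ reps c n := by
  obtain ⟨t', h1, h2, h3, h4⟩ := ht.exists_sorted T.Adj (fun _ _ h => h.symm) htT.1 htT.2.1 htT.2.2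
  have hM : ∃ t ∈ sortedTriangles T, ∀ i : Fin 3, adjMatrix G
      (![(t.1, t.2.1), (t.1, t.2.2), (t.2.1, t.2.2)] i) = true := by
    refine ⟨t', mem_sortedTriangles.2 ⟨h1, h2, h4⟩, fun i => adjMatrix_eq_true.2 ?_⟩
    fin_cases i
    exacts [h3.1, h3.2.1, h3.2.2]
  have hle : reps c n * ((2 * ⌈Real.sqrt (sortedTriangles T).card⌉₊ + 2) * 3) ≤
      triSearchCost c n N := by
    unfold triSearchCost
    gcongr
  refine (failure_le_of_always (Q₁ := fun o => o.isSome = true) (searchTriangles_always c T)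
    (fun o ho hs => ?_) _).trans ((failure_anti _ _ hle).trans
      (failure_safeGrover_le (f := adjMatrix G) 0 (reps c n) _ hM))
  obtain ⟨t, rfl⟩ := Option.isSome_iff_exists.1 ho
  exact ⟨t, rfl, hs t rfl⟩

open Classical in
/-- The edges of `E`, each of them once. -/
noncomputable def sortedEdges (E : SimpleGraph (Fin n)) : Finset (Fin n × Fin n) :=
  Finset.univ.filter fun e => e.1 < e.2 ∧ E.Adj e.1 e.2

omit [NeZero n] in
theorem mem_sortedEdges {E : SimpleGraph (Fin n)} {e : Fin n × Fin n} :
    e ∈ sortedEdges E ↔ e.1 < e.2 ∧ E.Adj e.1 e.2 := by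
  simp [sortedEdges]

theorem searchEdgeTriangles_eq (c : ℝ) (E : SimpleGraph (Fin n)) :
    searchEdgeTriangles c E = if (sortedEdges E).Nonempty then
      firstSome (fun i : ℕ => attempts (edgeAttempt c (sortedEdges E) i) (reps c n))
        (List.range (Nat.log 2 (sortedEdges E).card + 1)) else ret none := rfl

theorem searchEdgeTriangles_always (c : ℝ) (E : SimpleGraph (Fin n)) :
    (searchEdgeTriangles c E).Always (adjMatrix G) (Sound G) := by
  rw [searchEdgeTriangles_eq]
  split_ifs
  · refine Always.firstSome (fun i _ => Always.attempts ?_ (fun t ht => by cases ht) _)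
      (fun t ht => by cases ht)
    refine (edgeAttempt_always c _ i).mono fun o ho t ht => ?_
    have h := ho t ht
    simp only [triPairs, List.mem_cons, List.not_mem_nil, or_false, forall_eq_or_imp,
      forall_eq, adjMatrix_eq_true] at h
    exact h
  · exact fun t ht => by cases ht

theorem onlyGrover_searchEdgeTriangles (c : ℝ) (E : SimpleGraph (Fin n)) :
    (searchEdgeTriangles c E).OnlyGrover := by
  rw [searchEdgeTriangles_eq]
  split_ifs with h
  · exact OnlyGrover.firstSome (fun i => (onlyGrover_edgeAttempt c h i).attempts _) _
  · trivial

end Searches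

end Triangle

/-! ### The last two searches -/

namespace Triangle

open QQuery Prog

section FinalSearch

variable {n : ℕ} [NeZero n] {G : SimpleGraph (Fin n)}

/-- The order of magnitude of the number of queries of one attempt of the edge search with a guess of
at most `M`. -/
noncomputable def edgeAttemptBound (c : ℝ) (n : ℕ) (M : ℝ) : ℕ :=
  ⌈65 * c * (n + Real.sqrt (n * M))⌉₊

theorem edgeAttemptCost_le {c : ℝ} (hc : 1 ≤ c) {N i : ℕ} {M : ℝ} (hN : N ≤ n ^ 2)
    (hi : (2 : ℝ) ^ i ≤ M) : edgeAttemptCost c n N i ≤ edgeAttemptBound c n M := by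
  have hn1 : (1 : ℝ) ≤ n := by exact_mod_cast NeZero.pos n
  set x := Real.sqrt (2 ^ i) with hx
  have hx1 : 1 ≤ x := Real.one_le_sqrt.2 (one_le_pow₀ one_le_two)
  have hx0 : 0 < x := by linarith
  set y := Real.sqrt n with hy
  have hy1 : 1 ≤ y := Real.one_le_sqrt.2 hn1
  have hyx : y * x ≤ Real.sqrt (n * M) := by
    rw [hy, hx, ← Real.sqrt_mul (Nat.cast_nonneg n)]
    gcongr
  have h1 : (⌈c * x⌉₊ : ℝ) ≤ 2 * (c * x) := by
    have := Nat.ceil_lt_add_one (by positivity : 0 ≤ c * x)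
    nlinarith
  have h2 : (⌈Real.sqrt (N / 2 ^ i)⌉₊ : ℝ) ≤ n / x + 1 := by
    have h := Nat.ceil_lt_add_one (Real.sqrt_nonneg ((N : ℝ) / 2 ^ i))
    have h' : Real.sqrt ((N : ℝ) / 2 ^ i) ≤ n / x := by
      rw [Real.sqrt_div (Nat.cast_nonneg N)]
      gcongr
      rw [Real.sqrt_le_left (Nat.cast_nonneg n)]
      exact_mod_cast hN
    linarith
  have h3 : (⌈y⌉₊ : ℝ) ≤ 2 * y := by
    have := Nat.ceil_lt_add_one (by positivity : 0 ≤ y)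
    linarith
  have hcx : 1 ≤ c * x := one_le_mul_of_one_le_of_one_le hc hx1
  suffices h : (edgeAttemptCost c n N i : ℝ) ≤ 65 * c * (n + Real.sqrt (n * M)) by
    exact_mod_cast h.trans (Nat.le_ceil _)
  unfold edgeAttemptCost
  push_cast
  calc (2 * (⌈c * x⌉₊ : ℝ) + 1) *
        (2 * (⌈Real.sqrt (N / 2 ^ i)⌉₊ : ℝ) + 1 + (2 * (⌈y⌉₊ : ℝ) + 1) * 2) + 3
      ≤ (5 * (c * x)) * (2 * (n / x) + 13 * y) + 3 := by
        have hA : 2 * (⌈c * x⌉₊ : ℝ) + 1 ≤ 5 * (c * x) := by linarith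
        have hB : 2 * (⌈Real.sqrt (N / 2 ^ i)⌉₊ : ℝ) + 1 + (2 * (⌈y⌉₊ : ℝ) + 1) * 2 ≤
            2 * (n / x) + 13 * y := by linarith
        have := mul_le_mul hA hB (by positivity) (by positivity)
        linarith
    _ = 10 * c * n + 65 * c * (y * x) + 3 := by field_simp; ring
    _ ≤ 65 * c * (n + y * x) := by nlinarith
    _ ≤ _ := by gcongr

/-- A bound for the number of queries of the edge search with the guesses up to `M`. -/
noncomputable def edgeSearchCost (c : ℝ) (n : ℕ) (M : ℝ) : ℕ :=
  (Nat.log 2 (n ^ 2) + 1) * (reps c n * edgeAttemptBound c n M)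

omit [NeZero n] in
theorem card_sortedEdges_le (E : SimpleGraph (Fin n)) : (sortedEdges E).card ≤ n ^ 2 :=
  (Finset.card_le_univ _).trans (by simp [sq])

/-- The edge search succeeds by the time it reaches the right guess for the number of edges of `G` in
`E`, and does not use more queries than for this guess. -/
theorem failure_searchEdgeTriangles_le {c : ℝ} (hc : 8 ≤ c) {E : SimpleGraph (Fin n)} {M : ℝ}
    (hM : ((adjPairs (G ⊓ E)).card : ℝ) ≤ M) {e : Fin n × Fin n} (he : e ∈ sortedEdges E)
    (hG : G.Adj e.1 e.2) {v : Fin n} (h1 : G.Adj e.1 v) (h2 : G.Adj e.2 v) :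
    (searchEdgeTriangles c E).failure (adjMatrix G) (Finds G) (edgeSearchCost c n M) ≤
      (127 / 128) ^ reps c n := by
  set S := sortedEdges E with hS
  set m := (S.filter fun e => adjMatrix G e = true).card with hm
  have hm0 : m ≠ 0 := by
    rw [hm]
    exact (Finset.card_pos.2 ⟨e, Finset.mem_filter.2 ⟨he, adjMatrix_eq_true.2 hG⟩⟩).ne'
  have hmM : (m : ℝ) ≤ M := by
    refine le_trans ?_ hM
    norm_cast
    refine Finset.card_le_card fun p hp => ?_
    rw [Finset.mem_filter, adjMatrix_eq_true, hS, mem_sortedEdges] at hp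
    exact mem_adjPairs.2 ⟨hp.2, hp.1.2⟩
  set i := Nat.log 2 m with hi
  have hi1 : 2 ^ i ≤ m := Nat.pow_log_le_self 2 hm0
  have hi2 : m < 2 ^ (i + 1) := Nat.lt_pow_succ_log_self one_lt_two m
  have hmS : m ≤ S.card := Finset.card_filter_le _ _
  have hSn : S.card ≤ n ^ 2 := card_sortedEdges_le E
  have hiS : i ≤ Nat.log 2 S.card := Nat.log_mono_right hmS
  have hcost : ∀ k ≤ i, edgeAttemptCost c n S.card k ≤ edgeAttemptBound c n M := fun k hk => by
    refine edgeAttemptCost_le (by linarith) hSn (le_trans ?_ hmM)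
    exact_mod_cast (Nat.pow_le_pow_right two_pos hk).trans hi1
  have hlist : List.range (Nat.log 2 S.card + 1) = List.range i ++ i ::
      (List.map Nat.succ (List.range (Nat.log 2 S.card - i))).map (i + ·) := by
    have : Nat.log 2 S.card + 1 = i + (Nat.log 2 S.card - i + 1) := by omega
    rw [this, List.range_add, List.range_succ_eq_map]
    rfl
  have hatt : (attempts (edgeAttempt c S i) (reps c n)).failure (adjMatrix G)
      (fun o => o.isSome = true) (reps c n * edgeAttemptBound c n M) ≤ (127 / 128) ^ reps c n :=
    (failure_anti _ _ (Nat.mul_le_mul_left _ (hcost i le_rfl))).trans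
      (failure_attempts_le (by norm_num) (queries_edgeAttempt c S i)
        (failure_edgeAttempt_le hc hi1 hi2 ⟨e, he, adjMatrix_eq_true.2 hG, v,
          adjMatrix_eq_true.2 h1, adjMatrix_eq_true.2 h2⟩) _)
  have hall := failure_firstSome_append (f := adjMatrix G)
    (t := fun i : ℕ => attempts (edgeAttempt c S i) (reps c n))
    (B := fun _ => reps c n * edgeAttemptBound c n M) (by positivity) (List.range i)
    ((List.map Nat.succ (List.range (Nat.log 2 S.card - i))).map (i + ·))
    (fun k hk => queries_attempts ((queries_edgeAttempt c S k).trans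
      (hcost k (List.mem_range.1 hk).le)) _) hatt
  rw [← hlist] at hall
  have hB : ((List.range i).map fun _ => reps c n * edgeAttemptBound c n M).sum +
      reps c n * edgeAttemptBound c n M ≤ edgeSearchCost c n M := by
    rw [List.map_const', List.sum_replicate, List.length_range, smul_eq_mul, edgeSearchCost,
      add_mul, one_mul]
    have : i ≤ Nat.log 2 (n ^ 2) := hiS.trans (Nat.log_mono_right hSn)
    gcongr
  refine (failure_le_of_always (Q₁ := fun o => o.isSome = true) (searchEdgeTriangles_always c E)
    (fun o ho hs => ?_) _).trans ((failure_anti _ _ hB).trans ?_)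
  · obtain ⟨t, rfl⟩ := Option.isSome_iff_exists.1 ho
    exact ⟨t, rfl, hs t rfl⟩
  · rw [searchEdgeTriangles_eq, if_pos ⟨e, he⟩]
    exact hall

/-- Search among the triangles of `T`, and then for a triangle with an edge in `E`. -/
noncomputable def finalSearch (c : ℝ) (T E : SimpleGraph (Fin n)) :
    GProg n (Option (Fin n × Fin n × Fin n)) := do
  match ← searchTriangles c T with
  | some t => return some t
  | none => searchEdgeTriangles c E

theorem finalSearch_eq (c : ℝ) (T E : SimpleGraph (Fin n)) :
    finalSearch c T E = (searchTriangles c T).bind fun o => match o with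
      | some t => ret (some t)
      | none => searchEdgeTriangles c E := rfl

theorem finalSearch_always (c : ℝ) (T E : SimpleGraph (Fin n)) :
    (finalSearch c T E).Always (adjMatrix G) (Sound G) := by
  rw [finalSearch_eq]
  refine (searchTriangles_always c T).bind fun o ho => ?_
  cases o with
  | some t => exact ho
  | none => exact searchEdgeTriangles_always c E

theorem onlyGrover_finalSearch (c : ℝ) (T E : SimpleGraph (Fin n)) :
    (finalSearch c T E).OnlyGrover := by
  rw [finalSearch_eq]
  refine (onlyGrover_searchTriangles c T).bind fun o => ?_
  cases o with
  | some t => trivial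
  | none => exact onlyGrover_searchEdgeTriangles c E

omit [NeZero n] in
theorem finds_some {t : Fin n × Fin n × Fin n} (h : Sound G (some t)) : Finds G (some t) :=
  ⟨t, rfl, h t rfl⟩

theorem failure_finalSearch_le {c : ℝ} (hc : 8 ≤ c) {T E : SimpleGraph (Fin n)} {N M : ℝ}
    (hcover : G ≤ T ⊔ E) (hN : ((sortedTriangles T).card : ℝ) ≤ N)
    (hM : ((adjPairs (G ⊓ E)).card : ℝ) ≤ M) (hG : ∃ t, IsTriangle G t) :
    (finalSearch c T E).failure (adjMatrix G) (Finds G)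
      (triSearchCost c n N + edgeSearchCost c n M) ≤ (127 / 128) ^ reps c n := by
  obtain ⟨t, ht⟩ := hG
  rw [finalSearch_eq]
  by_cases htT : IsTriangle T t
  · have h := failure_bind_le_add (B₂ := edgeSearchCost c n M) (η₂ := 0) (Q := Finds G) le_rfl
      (failure_searchTriangles_le c hN ht htT)
      (g := fun o => match o with
      | some t => ret (some t)
      | none => searchEdgeTriangles c E) fun o ho => ?_
    · refine h.trans ?_
      rw [add_zero]
      exact pow_le_pow_left₀ (by norm_num) (by norm_num) _
    · obtain ⟨t, rfl, ht⟩ := ho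
      rw [failure_ret, if_pos ⟨t, rfl, ht⟩]
  · refine failure_bind_le_of_always (by positivity) (queries_searchTriangles c hN)
      (searchTriangles_always (G := G) c T) fun o ho => ?_
    cases o with
    | some t =>
      rw [failure_ret, if_pos (finds_some ho)]
      positivity
    | none =>
      -- one of the edges of the triangle is in `E`
      have hE : ∃ a b v, G.Adj a b ∧ E.Adj a b ∧ G.Adj a v ∧ G.Adj b v := by
        obtain ⟨h1, h2, h3⟩ := ht
        by_contra hcon
        push Not at hcon
        refine htT ⟨(hcover h1).resolve_right fun h => ?_, (hcover h2).resolve_right fun h => ?_,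
          (hcover h3).resolve_right fun h => ?_⟩
        · exact hcon _ _ _ h1 h h2 h3
        · exact hcon _ _ _ h2 h h1 h3.symm
        · exact hcon _ _ _ h3 h h1.symm h2.symm
      obtain ⟨a, b, v, hab, hE, ha, hb⟩ := hE
      rcases lt_or_gt_of_ne hab.ne with h | h
      · exact failure_searchEdgeTriangles_le hc hM (e := (a, b)) (mem_sortedEdges.2 ⟨h, hE⟩) hab
          ha hb
      · exact failure_searchEdgeTriangles_le hc hM (e := (b, a)) (mem_sortedEdges.2 ⟨h, hE.symm⟩)
          hab.symm hb ha

end FinalSearch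

/-! ### The classification -/

section Classify

variable {n : ℕ} [NeZero n] {G : SimpleGraph (Fin n)}

open Classical in
theorem classify_succ (c δ ε' : ℝ) (k : SimpleGraph (Fin n) → SimpleGraph (Fin n) →
      GProg n (Option (Fin n × Fin n × Fin n))) (fuel : ℕ) (s₀ : ClassState n) :
    classify c δ ε' k (fuel + 1) s₀ =
      if h : ∃ v, ∃ w, (moveAllToT ((n : ℝ) ^ (1 - ε')) s₀).G'.Adj v w then
        (acceptHigh c δ (moveAllToT ((n : ℝ) ^ (1 - ε')) s₀).G' h.choose).bind fun b =>
          if b = true then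
            (neighbourhood h.choose).bind fun A =>
              (searchNeighbourhood c h.choose A).bind fun o => match o with
                | some t => ret (some t)
                | none => classify c δ ε' k fuel (moveToE
                    ({x | x ∈ A} ∩ (moveAllToT ((n : ℝ) ^ (1 - ε')) s₀).G'.neighborSet h.choose)
                    ((moveAllToT ((n : ℝ) ^ (1 - ε')) s₀).G'.neighborSet h.choose)
                    (moveAllToT ((n : ℝ) ^ (1 - ε')) s₀))
          else classify c δ ε' k fuel
            (moveToE {h.choose} Set.univ (moveAllToT ((n : ℝ) ^ (1 - ε')) s₀))
      else k (moveAllToT ((n : ℝ) ^ (1 - ε')) s₀).T (moveAllToT ((n : ℝ) ^ (1 - ε')) s₀).E := rfl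

theorem classify_always (c δ ε' : ℝ) {k : SimpleGraph (Fin n) → SimpleGraph (Fin n) →
      GProg n (Option (Fin n × Fin n × Fin n))}
    (hk : ∀ T E, (k T E).Always (adjMatrix G) (Sound G)) (fuel : ℕ) (s : ClassState n) :
    (classify c δ ε' k fuel s).Always (adjMatrix G) (Sound G) := by
  induction fuel generalizing s with
  | zero => exact fun t ht => by cases ht
  | succ fuel ih =>
    rw [classify_succ]
    split_ifs with h
    · refine (always_true _).bind fun b _ => ?_
      split_ifs
      · refine (neighbourhood_always _).bind fun A hA => ?_
        subst hA
        refine (searchNeighbourhood_always c _).bind fun o ho => ?_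
        cases o with
        | some t => exact ho
        | none => exact ih _
      · exact ih _
    · exact hk _ _

theorem onlyGrover_classify (c δ ε' : ℝ) {k : SimpleGraph (Fin n) → SimpleGraph (Fin n) →
      GProg n (Option (Fin n × Fin n × Fin n))} (hk : ∀ T E, (k T E).OnlyGrover) (fuel : ℕ)
    (s : ClassState n) : (classify c δ ε' k fuel s).OnlyGrover := by
  induction fuel generalizing s with
  | zero => trivial
  | succ fuel ih =>
    rw [classify_succ]
    split_ifs with h
    · refine (onlyGrover_acceptHigh _ _ _ _).bind fun b => ?_
      split_ifs
      · refine (onlyGrover_neighbourhood _).bind fun A => ?_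
        refine (onlyGrover_searchNeighbourhood c _ _).bind fun o => ?_
        cases o with
        | some t => trivial
        | none => exact ih _
      · exact ih _
    · exact hk _ _

/-- The number of queries of the sampling in one round of the classification. -/
noncomputable def lowCost (c δ : ℝ) (n : ℕ) : ℕ := reps c n * sampleSize n δ

/-- The number of queries of a round of the classification with the high degree hypothesis. -/
noncomputable def highCost (c δ : ℝ) (n : ℕ) : ℕ := lowCost c δ n + (n + nbrSearchCost c n)

/-- A lower bound for the number of pairs that a round with the high degree hypothesis removes from
`G'`. -/
noncomputable def highGain (δ ε' : ℝ) (n : ℕ) : ℝ :=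
  max 1 ((n : ℝ) ^ (1 - δ) / 100 * (n : ℝ) ^ (1 - ε'))

/-- The classification.  There are at most `a` rounds with the low degree hypothesis, as each of them
isolates a node in `G'`, and at most `h` rounds with the high degree hypothesis, as each of them
removes at least `highGain` pairs from `G'`; accordingly `a` bounds the number of nodes that are not
isolated, and `h * highGain` the number of pairs.  The hypothesis `hM` leaves room in `M` for the
pairs of `G` that the remaining rounds move to `E`. -/
theorem failure_classify_le {c δ ε' κ : ℝ} (hδ : 0 ≤ δ) (hκ : 0 ≤ κ) {G₀ : SimpleGraph (Fin n)}
    (hG₀ : ∀ a b, G₀.Adj a b → (numPaths G a b : ℝ) ≤ κ)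
    {k : SimpleGraph (Fin n) → SimpleGraph (Fin n) → GProg n (Option (Fin n × Fin n × Fin n))}
    {M ηk : ℝ} {Bk : ℕ} (hηk : 0 ≤ ηk)
    (hk : ∀ T E, G ≤ T ⊔ E →
      ((sortedTriangles T).card : ℝ) ≤ 6 * (n : ℝ) ^ (1 - ε') * n ^ 2 →
      ((adjPairs (G ⊓ E)).card : ℝ) ≤ M → (k T E).failure (adjMatrix G) (Finds G) Bk ≤ ηk)
    (fuel a h : ℕ) (s : ClassState n) (hs : Inv G G₀ ((n : ℝ) ^ (1 - ε')) s)
    (ha : (nonIsolated s.G').card ≤ a)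
    (hh : ((adjPairs s.G').card : ℝ) ≤ h * highGain δ ε' n)
    (hM : ((adjPairs (G ⊓ s.E)).card : ℝ) + a * (8 * (n : ℝ) ^ (1 - δ)) + h * (2 * (n * κ)) ≤ M)
    (hfuel : a + h + 1 ≤ fuel) :
    (classify c δ ε' k fuel s).failure (adjMatrix G) (Finds G)
      (a * lowCost c δ n + h * highCost c δ n + Bk) ≤
      (a + h) * (7 * Real.exp (-reps c n)) + ηk := by
  have hn : 0 < n := NeZero.pos n
  have hn' : (0 : ℝ) < n := by exact_mod_cast hn
  have hp : (0 : ℝ) < (n : ℝ) ^ (1 - δ) := Real.rpow_pos_of_pos hn' _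
  set τ := (n : ℝ) ^ (1 - ε') with hτ
  have hτ0 : 0 < τ := Real.rpow_pos_of_pos hn' _
  set η := 7 * Real.exp (-reps c n) with hη
  have hη0 : 0 ≤ η := by positivity
  induction fuel generalizing a h s with
  | zero => omega
  | succ fuel ih =>
    obtain ⟨hs', hle, hE, hlow⟩ := moveAllToT_spec hτ0.le hs
    rw [classify_succ, ← hτ]
    set s' := moveAllToT τ s with hs'def
    have ha' : (nonIsolated s'.G').card ≤ a :=
      (Finset.card_le_card (nonIsolated_mono hle)).trans ha
    have hh' : ((adjPairs s'.G').card : ℝ) ≤ h * highGain δ ε' n := by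
      refine le_trans ?_ hh
      exact_mod_cast Finset.card_le_card (adjPairs_mono hle)
    have hgain : 1 ≤ highGain δ ε' n := le_max_left _ _
    split_ifs with hex
    · set v := hex.choose with hv
      have hvadj : ∃ w, s'.G'.Adj v w := hex.choose_spec
      -- as `G'` has an edge, neither of the two kinds of rounds is used up
      obtain ⟨a, rfl⟩ : ∃ a', a = a' + 1 := by
        have : 0 < (nonIsolated s'.G').card := Finset.card_pos.2 ⟨v, mem_nonIsolated.2 hvadj⟩
        exact ⟨a - 1, by omega⟩
      obtain ⟨h, rfl⟩ : ∃ h', h = h' + 1 := by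
        obtain ⟨w, hw⟩ := hvadj
        have h1 : 0 < (adjPairs s'.G').card := Finset.card_pos.2 ⟨(v, w), mem_adjPairs.2 hw⟩
        refine ⟨h - 1, ?_⟩
        have h2 : h ≠ 0 := by
          rintro rfl
          rw [Nat.cast_zero, zero_mul] at hh'
          have : (0 : ℝ) < (adjPairs s'.G').card := by exact_mod_cast h1
          linarith
        omega
      set D := sharedNeighbours (adjMatrix G) s'.G' v with hD
      have hDmem : ∀ w, w ∈ D ↔ G.Adj v w ∧ s'.G'.Adj v w := fun w => by
        rw [hD, mem_sharedNeighbours, adjMatrix_eq_true]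
      have hacc := failure_acceptHigh_le (f := adjMatrix G) hn c hδ s'.G' v
      rw [← hD, ← hη] at hacc
      have hbudget : (a + 1) * lowCost c δ n + (h + 1) * highCost c δ n + Bk =
          lowCost c δ n + (a * lowCost c δ n + (h + 1) * highCost c δ n + Bk) := by ring
      have hprob : ((a + 1 : ℕ) + (h + 1 : ℕ)) * η + ηk =
          η + ((a + (h + 1 : ℕ)) * η + ηk) := by push_cast; ring
      rw [hbudget, hprob]
      refine failure_bind_le_add (by positivity) hacc fun b hb => ?_
      push_cast at hM hh'
      split_ifs with hbt
      · -- high degree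
        have hdeg := hb.1 hbt
        have hD1 : (1 : ℝ) ≤ D.card := by
          have h1 : (0 : ℝ) < D.card := lt_of_lt_of_le (by positivity) hdeg
          have h2 : 0 < D.card := by exact_mod_cast h1
          exact_mod_cast h2
        have hbudget2 : a * lowCost c δ n + (h + 1) * highCost c δ n + Bk =
            n + (nbrSearchCost c n + ((a + 1) * lowCost c δ n + h * highCost c δ n + Bk)) := by
          unfold highCost; ring
        rw [hbudget2]
        refine failure_bind_le_of_always (by positivity) (queries_neighbourhood v)
          (neighbourhood_always v) fun A hA => ?_
        subst hA
        refine failure_bind_le_of_always (by positivity) (queries_searchNeighbourhood c v _)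
          (searchNeighbourhood_always (G := G) c v) fun o ho => ?_
        cases o with
        | some t =>
          rw [failure_ret, if_pos (finds_some ho)]
          positivity
        | none =>
          set A : Set (Fin n) := {x | x ∈ inputNbrs (adjMatrix G) v} ∩ s'.G'.neighborSet v with hA
          have hAmem : ∀ w, w ∈ A ↔ G.Adj v w ∧ s'.G'.Adj v w := fun w => by
            rw [hA, Set.mem_inter_iff]
            exact and_congr mem_inputNbrs Iff.rfl
          have hprob2 : (a + (h + 1 : ℕ)) * η + ηk = ((a + 1 : ℕ) + h) * η + ηk := by
            push_cast; ring
          rw [hprob2]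
          have hrem := card_adjPairs_moveToE s' A (s'.G'.neighborSet v)
          have hrem' : ((adjPairs (moveToE A (s'.G'.neighborSet v) s').G').card : ℝ) +
              (adjPairs (s'.G'.between A (s'.G'.neighborSet v))).card =
              (adjPairs s'.G').card := by exact_mod_cast hrem
          have hbig : (D.card : ℝ) * τ ≤ (adjPairs (s'.G'.between A (s'.G'.neighborSet v))).card :=
            le_card_adjPairs_between hlow D A (fun x hx => ((hDmem x).1 hx).2)
              fun x hx => (hAmem x).2 ((hDmem x).1 hx)
          have hgain2 : highGain δ ε' n ≤
              (adjPairs (s'.G'.between A (s'.G'.neighborSet v))).card := by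
            refine max_le ?_ (le_trans ?_ hbig)
            · have h1 : (0 : ℝ) < (adjPairs (s'.G'.between A (s'.G'.neighborSet v))).card :=
                lt_of_lt_of_le (by positivity) hbig
              have h2 : 0 < (adjPairs (s'.G'.between A (s'.G'.neighborSet v))).card := by
                exact_mod_cast h1
              exact_mod_cast h2
            · rw [← hτ]
              gcongr
          have hnew := card_adjPairs_inf_moveToE G s' A (s'.G'.neighborSet v)
          have hnew' : ((adjPairs (G ⊓ (moveToE A (s'.G'.neighborSet v) s').E)).card : ℝ) ≤
              (adjPairs (G ⊓ s'.E)).card +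
              (adjPairs (G ⊓ s'.G'.between A (s'.G'.neighborSet v))).card := by
            exact_mod_cast hnew
          have hfew : ((adjPairs (G ⊓ s'.G'.between A (s'.G'.neighborSet v))).card : ℝ) ≤
              2 * (n * κ) :=
            card_adjPairs_inf_between_le hκ (fun x hx => hG₀ v x (hs'.le hx))
              fun x hx => ((hAmem x).1 hx).1
          refine ih (a + 1) h _ ((Finset.card_le_card (nonIsolated_mono sdiff_le)).trans ha')
            ?_ ?_ (by omega) (hs'.moveToE hτ0.le _ _)
          · linarith
          · rw [hE] at hnew'
            push_cast
            linarith
      · -- low degree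
        have hdeg := hb.2 (by simpa using hbt)
        have hnew := card_adjPairs_inf_moveToE G s' {v} Set.univ
        have hnew' : ((adjPairs (G ⊓ (moveToE {v} Set.univ s').E)).card : ℝ) ≤
            (adjPairs (G ⊓ s'.E)).card +
            (adjPairs (G ⊓ s'.G'.between {v} Set.univ)).card := by exact_mod_cast hnew
        have hfew : ((adjPairs (G ⊓ s'.G'.between {v} Set.univ)).card : ℝ) ≤ 2 * D.card := by
          exact_mod_cast card_adjPairs_between_singleton G s'.G' v D
            fun w h1 h2 => (hDmem w).2 ⟨h1, h2⟩
        have hiso := card_nonIsolated_moveToE hvadj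
        refine ih a (h + 1) _ (by omega) ?_ ?_ (by omega) (hs'.moveToE hτ0.le _ _)
        · push_cast
          refine le_trans ?_ hh'
          exact_mod_cast Finset.card_le_card (adjPairs_mono sdiff_le)
        · rw [hE] at hnew'
          push_cast
          linarith
    · -- every edge has been classified
      push Not at hex
      have h0 : s'.G' = ⊥ := by
        ext x y
        simpa using hex x y
      have hfin := hk s'.T s'.E ?_ ?_ ?_
      · refine ((failure_anti _ _ (Nat.le_add_left _ _)).trans hfin).trans ?_
        have : 0 ≤ ((a : ℝ) + h) * η := by positivity
        linarith
      · have := hs'.cover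
        rwa [h0, sup_bot_eq] at this
      · have h1 : (sortedTriangles s'.T).card ≤ (mixedTriangles s').card := by
          refine Finset.card_le_card fun t ht => ?_
          rw [mem_sortedTriangles] at ht
          obtain ⟨-, -, g1, g2, g3⟩ := ht
          exact mem_mixedTriangles.2 ⟨⟨Or.inl g1, Or.inl g2, Or.inl g3⟩, Or.inl g1⟩
        have h2 : ((sortedTriangles s'.T).card : ℝ) ≤ (mixedTriangles s').card := by
          exact_mod_cast h1
        have h3 := hs'.mixed
        have h4 : 0 ≤ 6 * τ * (adjPairs s'.G').card := by positivity
        linarith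
      · rw [hE]
        have h1 : 0 ≤ (a : ℝ) * (8 * (n : ℝ) ^ (1 - δ)) := by positivity
        have h2 : 0 ≤ (h : ℝ) * (2 * (n * κ)) := by positivity
        linarith

end Classify

end Triangle

/-! ### The whole algorithm -/

namespace QQuery.Prog

variable {X : Type} [Fintype X] {α ι : Type} {f : X → Bool}

/-- The union bound over finitely many requirements on the result. -/
theorem failure_forall_le [Fintype ι] [Nonempty ι] (Q : ι → α → Prop) (p : Prog X α) (B : ℕ) :
    p.failure f (fun a => ∀ i, Q i a) B ≤ ∑ i, p.failure f (Q i) B := by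
  classical
  have hone : (1 : ℝ) ≤ ∑ _i : ι, 1 := by
    simp only [Finset.sum_const, Finset.card_univ, nsmul_eq_mul, mul_one]
    exact_mod_cast Fintype.card_pos
  induction p generalizing B with
  | ret a =>
    simp only [failure_ret]
    split_ifs with h
    · exact Finset.sum_nonneg fun i _ => by split_ifs <;> norm_num
    · push Not at h
      obtain ⟨i, hi⟩ := h
      refine le_trans ?_ (Finset.single_le_sum (f := fun i => if Q i a then (0 : ℝ) else 1)
        (fun i _ => by split_ifs <;> norm_num) (Finset.mem_univ i))
      exact (if_neg hi).ge
  | query x k ih =>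
    simp only [failure_query]
    split_ifs
    · exact ih _ _
    · exact hone
  | choose S hS k ih =>
    simp only [failure_choose]
    rw [← Finset.sum_div, Finset.sum_comm]
    gcongr
    exact ih _ _
  | quantum C b₀ k ih =>
    simp only [failure_quantum]
    split_ifs
    · rw [Finset.sum_comm]
      simp only [← Finset.mul_sum]
      gcongr
      exact ih _ _
    · exact hone

end QQuery.Prog

namespace Triangle

open QQuery Prog

/-- The number of random nodes whose neighbourhoods are searched first. -/
noncomputable def coverSize (ε : ℝ) (n : ℕ) : ℕ := ⌈4 * (n : ℝ) ^ ε * Real.log n⌉₊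

theorem inv_pow_four_eq_exp {x : ℝ} (hx : 0 < x) : (x ^ 4)⁻¹ = Real.exp (-(4 * Real.log x)) := by
  have : 4 * Real.log x = (4 : ℕ) * Real.log x := by norm_num
  rw [Real.exp_neg, this, Real.exp_nat_mul, Real.exp_log hx]

/-- With high probability, the random nodes contain a common neighbour of any two nodes that have more
than `n ^ (1 - ε)` of them. -/
theorem failure_randomNodes_cover {n : ℕ} (hn : 0 < n) {f : Fin n × Fin n → Bool}
    (G : SimpleGraph (Fin n)) (ε : ℝ) :
    (randomNodes n (coverSize ε n)).failure f (fun l => ∀ p : Fin n × Fin n,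
      (n : ℝ) ^ (1 - ε) < numPaths G p.1 p.2 → ∃ x ∈ l, x ∈ commonNbrs G p.1 p.2) 0 ≤
      (n : ℝ) ^ 2 * ((n : ℝ) ^ 4)⁻¹ := by
  have hn' : (0 : ℝ) < n := by exact_mod_cast hn
  have hp : (0 : ℝ) < (n : ℝ) ^ (1 - ε) := Real.rpow_pos_of_pos hn' _
  have : Nonempty (Fin n × Fin n) := ⟨(⟨0, hn⟩, ⟨0, hn⟩)⟩
  refine (failure_forall_le _ _ _).trans ?_
  have hone : ∀ p : Fin n × Fin n, (randomNodes n (coverSize ε n)).failure f (fun l =>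
      (n : ℝ) ^ (1 - ε) < numPaths G p.1 p.2 → ∃ x ∈ l, x ∈ commonNbrs G p.1 p.2) 0 ≤
      ((n : ℝ) ^ 4)⁻¹ := fun p => by
    have h0 : (0 : ℝ) ≤ ((n : ℝ) ^ 4)⁻¹ := by positivity
    by_cases h : (n : ℝ) ^ (1 - ε) < numPaths G p.1 p.2
    · refine (failure_mono (fun l hl _ => hl) 0).trans ?_
      rw [numPaths_eq_card] at h
      rcases le_total n (coverSize ε n) with hm | hm
      · have hS : (commonNbrs G p.1 p.2).Nonempty := by
          rw [← Finset.card_pos]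
          exact_mod_cast hp.trans h
        exact (failure_randomNodes_hit_of_le hm hS).trans h0
      · refine (failure_randomNodes_hit hn _ _).trans ?_
        rw [inv_pow_four_eq_exp hn', min_eq_left hm]
        gcongr
        rw [le_div_iff₀ hn']
        have hlog : 0 ≤ Real.log n := Real.log_natCast_nonneg n
        calc 4 * Real.log n * n
            = (n : ℝ) ^ (1 - ε) * (4 * (n : ℝ) ^ ε * Real.log n) := by
              have : (n : ℝ) = (n : ℝ) ^ (1 - ε) * (n : ℝ) ^ ε := by
                rw [← Real.rpow_add hn', sub_add_cancel, Real.rpow_one]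
              linear_combination (4 * Real.log n) * this
          _ ≤ _ := mul_le_mul h.le (Nat.le_ceil _) (by positivity) (by positivity)
    · exact (failure_eq_zero ((always_true _).mono fun l _ h' => absurd h' h)
        (queries_randomNodes n _).le).le.trans h0
  refine (Finset.sum_le_sum fun p _ => hone p).trans ?_
  rw [Finset.sum_const, Finset.card_univ, Fintype.card_prod, Fintype.card_fin, nsmul_eq_mul]
  push_cast
  rw [sq]

/-- A bound for the number of rounds of the classification with the high degree hypothesis. -/
noncomputable def highRounds (δ ε' : ℝ) (n : ℕ) : ℕ := ⌈(n : ℝ) ^ 2 / highGain δ ε' n⌉₊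

/-- A bound for the number of pairs of adjacent nodes of `G` that are in `E` in the end: each round
with the low degree hypothesis contributes `O(n ^ (1 - δ))` of them, and each one with the high degree
hypothesis `O(n * n ^ (1 - ε))`. -/
noncomputable def foundPairs (ε δ ε' : ℝ) (n : ℕ) : ℝ :=
  n * (8 * (n : ℝ) ^ (1 - δ)) + highRounds δ ε' n * (2 * (n * (n : ℝ) ^ (1 - ε)))

/-- The threshold for the number of queries: the sum of the bounds for the individual steps, and the
number of rounds of the classification (the algorithm derives its bound on the number of rounds from
the threshold). -/
noncomputable def threshold (ε δ ε' c : ℝ) (n : ℕ) : ℕ :=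
  (min (coverSize ε n) n * n + (min (coverSize ε n) n * nbrSearchCost c n +
    (n * lowCost c δ n + highRounds δ ε' n * highCost c δ n +
      (triSearchCost c n (6 * (n : ℝ) ^ (1 - ε') * n ^ 2) +
        edgeSearchCost c n (foundPairs ε δ ε' n))))) + (n + highRounds δ ε' n)

section Steps

variable {n : ℕ} [NeZero n] {G : SimpleGraph (Fin n)}

theorem steps_eq (ε δ ε' c : ℝ) (fuel : ℕ) : steps (n := n) ε δ ε' c fuel =
    (randomNodes n (coverSize ε n)).bind fun vs => (neighbourhoods vs).bind fun L =>
      (firstSome (fun q : Fin n × Finset (Fin n) => searchNeighbourhood c q.1 q.2) L).bind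
        fun o => match o with
          | some t => ret (some t)
          | none => classify c δ ε' (finalSearch c) fuel ⟨⊥, ⊥, remaining L⟩ := rfl

theorem steps_always (ε δ ε' c : ℝ) (fuel : ℕ) :
    (steps ε δ ε' c fuel).Always (adjMatrix G) (Sound G) := by
  rw [steps_eq]
  refine (always_true _).bind fun vs _ => (neighbourhoods_always vs).bind fun L hL => ?_
  subst hL
  refine (Always.firstSome (Q := Sound G) (fun q hq => ?_) fun t ht => by cases ht).bind
    fun o ho => ?_
  · obtain ⟨v, -, rfl⟩ := List.mem_map.1 hq
    exact searchNeighbourhood_always c v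
  · cases o with
    | some t => exact ho
    | none => exact classify_always c δ ε' (finalSearch_always c) fuel _

theorem onlyGrover_steps (ε δ ε' c : ℝ) (fuel : ℕ) : (steps (n := n) ε δ ε' c fuel).OnlyGrover := by
  rw [steps_eq]
  refine (onlyGrover_randomNodes n (coverSize ε n)).bind fun vs => ?_
  refine (onlyGrover_neighbourhoods vs).bind fun L => ?_
  refine (OnlyGrover.firstSome
    (t := fun q : Fin n × Finset (Fin n) => searchNeighbourhood c q.1 q.2)
    (fun q => onlyGrover_searchNeighbourhood c q.1 q.2) L).bind fun o => ?_
  cases o with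
  | some t => trivial
  | none => exact onlyGrover_classify c δ ε' (onlyGrover_finalSearch c) fuel _

omit [NeZero n] in
theorem inv_remaining {L : List (Fin n × Finset (Fin n))} {τ : ℝ} (hτ : 0 ≤ τ)
    (hL : ∀ q ∈ L, ∀ a b, a ∈ q.2 → b ∈ q.2 → ¬G.Adj a b) :
    Inv G (remaining L) τ ⟨⊥, ⊥, remaining L⟩ where
  cover a b h := Or.inr ⟨h.ne, fun q hq h' => hL q hq a b h'.1 h'.2 h⟩
  le := le_rfl
  mixed := by
    have h0 : mixedTriangles ⟨⊥, ⊥, remaining L⟩ = ∅ :=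
      Finset.eq_empty_of_forall_notMem fun t ht => by
        simpa using (mem_mixedTriangles.1 ht).2
    have h1 : ((adjPairs (remaining L)).card : ℝ) ≤ (n : ℝ) ^ 2 := by
      exact_mod_cast card_adjPairs_le (remaining L)
    rw [h0, Finset.card_empty, Nat.cast_zero, zero_add]
    gcongr

/-- The constant `512 = 4 * 128` makes the errors of the searches, of which there are at most about
`n ^ 2`, negligible. -/
theorem pow_reps_le {c : ℝ} (hc : 512 ≤ c) :
    ((127 / 128 : ℝ) ^ reps c n) ≤ ((n : ℝ) ^ 4)⁻¹ := by
  have hn' : (0 : ℝ) < n := by exact_mod_cast NeZero.pos n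
  have hlog : 0 ≤ Real.log n := Real.log_natCast_nonneg n
  have hR : 512 * Real.log n ≤ reps c n :=
    le_trans (by gcongr) (Nat.le_ceil (c * Real.log n))
  have h1 : (127 / 128 : ℝ) ≤ Real.exp (-(1 / 128)) := by
    have := Real.add_one_le_exp (-(1 / 128) : ℝ)
    linarith
  calc ((127 / 128 : ℝ) ^ reps c n) ≤ Real.exp (-(1 / 128)) ^ reps c n := by gcongr
    _ = Real.exp (-(reps c n / 128)) := by
      rw [← Real.exp_nat_mul]
      congr 1
      ring
    _ ≤ Real.exp (-(4 * Real.log n)) := by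
      gcongr
      linarith
    _ = _ := (inv_pow_four_eq_exp hn').symm

omit [NeZero n] in
theorem highRounds_le (δ ε' : ℝ) : highRounds δ ε' n ≤ n ^ 2 := by
  rw [highRounds, Nat.ceil_le]
  push_cast
  exact div_le_self (by positivity) (le_max_left _ _)

/-- The algorithm finds a triangle within the threshold: the sum of the errors of the cover, of the
searches in the neighbourhoods, of the sampling and of the final searches is `O(n ^ 2 * n ^ (-4))`. -/
theorem failure_steps_le {ε δ ε' c : ℝ} (hc : 512 ≤ c) (hδ : 0 ≤ δ) (hG : ∃ t, IsTriangle G t)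
    {fuel : ℕ} (hfuel : n + highRounds δ ε' n + 1 ≤ fuel) :
    (steps ε δ ε' c fuel).failure (adjMatrix G) (Finds G) (threshold ε δ ε' c n) ≤ 17 / n := by
  have hn : 0 < n := NeZero.pos n
  have hn' : (0 : ℝ) < n := by exact_mod_cast hn
  have hn1 : (1 : ℝ) ≤ n := by exact_mod_cast hn
  have hκ : (0 : ℝ) ≤ (n : ℝ) ^ (1 - ε) := by positivity
  set μ := ((n : ℝ) ^ 4)⁻¹ with hμ
  have hμ0 : 0 ≤ μ := by positivity
  set m := min (coverSize ε n) n with hm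
  set h₀ := highRounds δ ε' n with hh₀
  have hpow : ((127 / 128 : ℝ) ^ reps c n) ≤ μ := pow_reps_le hc
  have hpow2 : ((3 / 4 : ℝ) ^ reps c n) ≤ μ :=
    (pow_le_pow_left₀ (by norm_num) (by norm_num) _).trans hpow
  have hpow3 : Real.exp (-reps c n) ≤ μ := by
    refine le_trans ?_ hpow
    have h1 : Real.exp (-1) ≤ 127 / 128 := by
      have := Real.exp_neg_one_lt_d9
      linarith
    calc Real.exp (-reps c n) = Real.exp (-1) ^ reps c n := by
          rw [← Real.exp_nat_mul]; congr 1; ring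
      _ ≤ _ := by gcongr
  have hcls : ∀ L : List (Fin n × Finset (Fin n)),
      (∀ q ∈ L, ∀ a b, a ∈ q.2 → b ∈ q.2 → ¬G.Adj a b) →
      (∀ a b, (remaining L).Adj a b → (numPaths G a b : ℝ) ≤ (n : ℝ) ^ (1 - ε)) →
      (classify c δ ε' (finalSearch c) fuel ⟨⊥, ⊥, remaining L⟩).failure (adjMatrix G) (Finds G)
        (n * lowCost c δ n + h₀ * highCost c δ n +
          (triSearchCost c n (6 * (n : ℝ) ^ (1 - ε') * n ^ 2) +
            edgeSearchCost c n (foundPairs ε δ ε' n))) ≤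
      (n + h₀) * (7 * Real.exp (-reps c n)) + (127 / 128) ^ reps c n := fun L hL hL' => by
    refine failure_classify_le hδ hκ hL' (M := foundPairs ε δ ε' n) (by positivity)
      (fun T E h1 h2 h3 => failure_finalSearch_le (by linarith) h1 h2 h3 hG) fuel n h₀ _
      (inv_remaining (by positivity) hL) ?_ ?_ ?_ hfuel
    · exact (Finset.card_le_univ _).trans (Fintype.card_fin n).le
    · have h1 : ((adjPairs (remaining L)).card : ℝ) ≤ (n : ℝ) ^ 2 := by
        exact_mod_cast card_adjPairs_le (remaining L)
      have h2 : (0 : ℝ) < highGain δ ε' n := lt_of_lt_of_le one_pos (le_max_left _ _)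
      exact h1.trans ((div_le_iff₀ h2).1 (Nat.le_ceil _))
    · have h0 : adjPairs (G ⊓ (⊥ : SimpleGraph (Fin n))) = ∅ :=
        Finset.eq_empty_of_forall_notMem fun p hp => by
          simpa using mem_adjPairs.1 hp
      rw [h0, Finset.card_empty, Nat.cast_zero, zero_add, foundPairs]
  set ηc := ((n : ℝ) + h₀) * (7 * Real.exp (-reps c n)) + (127 / 128) ^ reps c n with hηc
  have hηc0 : 0 ≤ ηc := by positivity
  have hcover := (failure_le_of_always (randomNodes_always (f := adjMatrix G) (coverSize ε n))
    (fun l h1 h2 => And.intro h1 h2) 0).trans (failure_randomNodes_cover hn G ε)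
  have hmain : (steps ε δ ε' c fuel).failure (adjMatrix G) (Finds G) (threshold ε δ ε' c n) ≤
      (n : ℝ) ^ 2 * μ + (m * (3 / 4) ^ reps c n + ηc) := by
    rw [steps_eq]
    -- the last summand of the threshold only serves to bound the number of rounds
    refine (failure_anti _ _ (Nat.le_add_right _ _)).trans ?_
    rw [← zero_add (_ * _ + _)]
    refine failure_bind_le_add (by positivity) hcover fun vs hvs => ?_
    refine failure_bind_le_of_always (by positivity)
      ((queries_neighbourhoods vs).trans (by rw [hvs.2])) (neighbourhoods_always vs) fun L hL => ?_
    have hlen : L.length = m := by rw [hL, List.length_map, hvs.2]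
    have hfirst := failure_firstSome_le (f := adjMatrix G) (η := (3 / 4) ^ reps c n)
      (t := fun q : Fin n × Finset (Fin n) => searchNeighbourhood c q.1 q.2)
      (B := nbrSearchCost c n) (by positivity)
      (fun q => ∀ a b, a ∈ q.2 → b ∈ q.2 → ¬G.Adj a b) L fun q hq => by
        rw [hL] at hq
        obtain ⟨v, -, rfl⟩ := List.mem_map.1 hq
        refine (failure_mono (fun o h ho a b ha hb => ?_) _).trans
          (failure_searchNeighbourhood_le c v)
        exact h ho a b (mem_inputNbrs.1 ha) (mem_inputNbrs.1 hb)
    have hfirst' := failure_le_of_always (Always.firstSome (Q := Sound G) (l := L)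
      (t := fun q : Fin n × Finset (Fin n) => searchNeighbourhood c q.1 q.2) (fun q hq => by
        rw [hL] at hq
        obtain ⟨v, -, rfl⟩ := List.mem_map.1 hq
        exact searchNeighbourhood_always (G := G) c v) fun t ht => by cases ht)
      (fun o h1 h2 => And.intro h1 h2) (L.length * nbrSearchCost c n) |>.trans hfirst
    rw [hlen] at hfirst'
    refine failure_bind_le_add hηc0 hfirst' fun o ho => ?_
    cases o with
    | some t =>
      rw [failure_ret, if_pos (finds_some ho.2)]
      exact hηc0
    | none =>
      refine hcls L (ho.1 rfl) fun a b hab => ?_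
      by_contra hcon
      obtain ⟨x, hx, hxab⟩ := hvs.1 (a, b) (not_le.1 hcon)
      rw [mem_commonNbrs] at hxab
      refine hab.2 (x, inputNbrs (adjMatrix G) x) ?_
        ⟨mem_inputNbrs.2 hxab.1.symm, mem_inputNbrs.2 hxab.2.symm⟩
      rw [hL]
      exact List.mem_map.2 ⟨x, hx, rfl⟩
  refine hmain.trans ?_
  have hmn : (m : ℝ) ≤ n := by exact_mod_cast min_le_right _ _
  have hh₀n : (h₀ : ℝ) ≤ (n : ℝ) ^ 2 := by exact_mod_cast highRounds_le (n := n) δ ε'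
  calc (n : ℝ) ^ 2 * μ + (m * (3 / 4) ^ reps c n + ηc)
      ≤ (n : ℝ) ^ 2 * μ + (n * μ + ((n + (n : ℝ) ^ 2) * (7 * μ) + μ)) := by
        rw [hηc]
        gcongr
    _ ≤ (n : ℝ) ^ 2 * μ + ((n : ℝ) ^ 2 * μ + (((n : ℝ) ^ 2 + (n : ℝ) ^ 2) * (7 * μ) +
          (n : ℝ) ^ 2 * μ)) := by
        have h1 : (n : ℝ) ≤ (n : ℝ) ^ 2 := by nlinarith
        have h2 : μ ≤ (n : ℝ) ^ 2 * μ := le_mul_of_one_le_left hμ0 (by nlinarith)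
        gcongr
    _ = 17 / n * (1 / n) := by
        rw [hμ]
        field_simp
        ring
    _ ≤ 17 / n := mul_le_of_le_one_right (by positivity) (by rw [div_le_one hn']; exact hn1)

end Steps

/-- Correctness, for the threshold that is the sum of the bounds for the individual steps. -/
theorem findsTriangles_combinatorialAlgorithm {ε δ ε' c : ℝ} (hc : 512 ≤ c) (hδ : 0 ≤ δ) :
    FindsTriangles fun n => combinatorialAlgorithm ε δ ε' c n (threshold ε δ ε' c n) := by
  refine ⟨fun n G hG => ?_, 17, fun n G hG => ?_⟩
  · cases n with
    | zero => rfl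
    | succ n =>
      refine Always.run_withThreshold ((steps_always (G := G) ε δ ε' c _).mono fun o ho => ?_) _
      exact Option.eq_none_iff_forall_ne_some.2 fun t ht => hG t (ho t ht)
  · cases n with
    | zero => exact hG.elim fun t _ => t.1.elim0
    | succ n =>
      refine le_trans ?_ (one_sub_failure_le _ _ _)
      have := failure_steps_le (ε := ε) (ε' := ε') hc hδ hG
        (fuel := threshold ε δ ε' c (n + 1) + 1) (by unfold threshold; omega)
      exact sub_le_sub_left this 1

theorem onlyGrover_combinatorialAlgorithm (ε δ ε' c : ℝ) (n B : ℕ) :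
    (combinatorialAlgorithm ε δ ε' c n B).OnlyGrover := by
  cases n with
  | zero => trivial
  | succ n => exact (onlyGrover_steps ε δ ε' c (B + 1)).withThreshold B

theorem queries_combinatorialAlgorithm_le (ε δ ε' c : ℝ) (n B : ℕ) :
    (combinatorialAlgorithm ε δ ε' c n B).queries ≤ B := by
  cases n with
  | zero => exact Nat.zero_le _
  | succ n => exact queries_withThreshold_le _ B

end Triangle

/-! ### The order of magnitude of the threshold -/

namespace Triangle

open QQuery Prog

section Threshold

variable {n : ℕ}

theorem one_le_log_natCast (hn : 3 ≤ n) : 1 ≤ Real.log n := by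
  rw [Real.le_log_iff_exp_le (by positivity)]
  have h1 := Real.exp_one_lt_d9
  have h2 : (3 : ℝ) ≤ n := by exact_mod_cast hn
  linarith

theorem natCeil_le_add_mul {x a b : ℝ} (hx : 0 ≤ x) (hxa : x ≤ a * b) (hb : 1 ≤ b) :
    (⌈x⌉₊ : ℝ) ≤ (a + 1) * b := by
  have := (Nat.ceil_lt_add_one hx).le
  linarith

theorem cast_reps_le {c : ℝ} (hc : 1 ≤ c) (hn : 3 ≤ n) :
    (reps c n : ℝ) ≤ 2 * c * Real.log n := by
  have hℓ := one_le_log_natCast hn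
  have h1 : 1 ≤ c * Real.log n := one_le_mul_of_one_le_of_one_le hc hℓ
  have h2 := natCeil_le_add_mul (a := 1) (by positivity) (one_mul _).ge h1
  unfold reps
  linarith

theorem cast_coverSize_le {ε : ℝ} (hε : 0 ≤ ε) (hn : 3 ≤ n) :
    (coverSize ε n : ℝ) ≤ 5 * ((n : ℝ) ^ ε * Real.log n) := by
  have hℓ := one_le_log_natCast hn
  have hn1 : (1 : ℝ) ≤ n := by exact_mod_cast (by omega : 1 ≤ n)
  have h1 : 1 ≤ (n : ℝ) ^ ε * Real.log n :=
    one_le_mul_of_one_le_of_one_le (Real.one_le_rpow hn1 hε) hℓ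
  have h2 := natCeil_le_add_mul (a := 4) (x := 4 * (n : ℝ) ^ ε * Real.log n) (by positivity)
    (mul_assoc _ _ _).le h1
  unfold coverSize
  linarith

theorem cast_nbrSearchCost_le {c : ℝ} (hc : 1 ≤ c) (hn : 3 ≤ n) :
    (nbrSearchCost c n : ℝ) ≤ 8 * c * (n * Real.log n) := by
  have hn1 : (1 : ℝ) ≤ n := by exact_mod_cast (by omega : 1 ≤ n)
  unfold nbrSearchCost
  push_cast
  calc (reps c n : ℝ) * (2 * n + 2) ≤ 2 * c * Real.log n * (4 * n) :=
        mul_le_mul (cast_reps_le hc hn) (by linarith) (by positivity)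
          (by have := one_le_log_natCast hn; positivity)
    _ = _ := by ring

theorem cast_lowCost_le {c δ : ℝ} (hc : 1 ≤ c) (hδ : 0 ≤ δ) (hn : 3 ≤ n) :
    (lowCost c δ n : ℝ) ≤ 4 * c * ((n : ℝ) ^ δ * Real.log n) := by
  have hℓ := one_le_log_natCast hn
  have hn1 : (1 : ℝ) ≤ n := by exact_mod_cast (by omega : 1 ≤ n)
  have h1 : (1 : ℝ) ≤ (n : ℝ) ^ δ := Real.one_le_rpow hn1 hδ
  have h2 : (sampleSize n δ : ℝ) ≤ 2 * (n : ℝ) ^ δ := by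
    have h3 := natCeil_le_add_mul (a := 1) (by positivity) (one_mul _).ge h1
    refine le_trans (Nat.cast_le.2 (min_le_left _ _)) (h3.trans ?_)
    linarith
  unfold lowCost
  push_cast
  calc (reps c n : ℝ) * sampleSize n δ ≤ 2 * c * Real.log n * (2 * (n : ℝ) ^ δ) :=
        mul_le_mul (cast_reps_le hc hn) h2 (by positivity) (by positivity)
    _ = _ := by ring

theorem cast_highCost_le {c δ : ℝ} (hc : 1 ≤ c) (hn : 3 ≤ n) :
    (highCost c δ n : ℝ) ≤ 11 * c * (n * Real.log n) := by
  have hℓ := one_le_log_natCast hn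
  have h1 : (lowCost c δ n : ℝ) ≤ 2 * c * Real.log n * n := by
    unfold lowCost
    push_cast
    exact mul_le_mul (cast_reps_le hc hn) (Nat.cast_le.2 (min_le_right _ _)) (by positivity)
      (by positivity)
  have h2 := cast_nbrSearchCost_le hc hn
  have h3 : (n : ℝ) * 1 ≤ n * (c * Real.log n) := by
    gcongr
    exact one_le_mul_of_one_le_of_one_le hc hℓ
  unfold highCost
  push_cast
  linarith

theorem cast_highRounds_le {δ ε' : ℝ} (hδ : 0 ≤ δ) (hε' : 0 ≤ ε') (hn : 3 ≤ n) :
    (highRounds δ ε' n : ℝ) ≤ 101 * (n : ℝ) ^ (δ + ε') := by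
  have hn1 : (1 : ℝ) ≤ n := by exact_mod_cast (by omega : 1 ≤ n)
  have hn0 : (0 : ℝ) < n := by linarith
  have h1 : (1 : ℝ) ≤ (n : ℝ) ^ (δ + ε') := Real.one_le_rpow hn1 (by linarith)
  have h2 : (n : ℝ) ^ 2 / highGain δ ε' n ≤ 100 * (n : ℝ) ^ (δ + ε') := by
    have hpos : (0 : ℝ) < highGain δ ε' n := lt_of_lt_of_le one_pos (le_max_left _ _)
    rw [div_le_iff₀ hpos]
    calc (n : ℝ) ^ 2 = 100 * (n : ℝ) ^ (δ + ε') *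
          ((n : ℝ) ^ (1 - δ) / 100 * (n : ℝ) ^ (1 - ε')) := by
          have : (n : ℝ) ^ 2 = (n : ℝ) ^ (δ + ε') * (n : ℝ) ^ (1 - δ) * (n : ℝ) ^ (1 - ε') := by
            rw [← Real.rpow_add hn0, ← Real.rpow_add hn0, ← Real.rpow_natCast]
            congr 1
            push_cast
            ring
          linear_combination this
      _ ≤ _ := by
          gcongr
          exact le_max_right _ _
  have h3 := natCeil_le_add_mul (x := (n : ℝ) ^ 2 / highGain δ ε' n)
    (div_nonneg (by positivity) (zero_le_one.trans (le_max_left _ _))) h2 h1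
  unfold highRounds
  linarith

theorem cast_triSearchCost_le {c ε' : ℝ} (hc : 1 ≤ c) (hn : 3 ≤ n) :
    (triSearchCost c n (6 * (n : ℝ) ^ (1 - ε') * n ^ 2) : ℝ) ≤
      36 * c * ((n + Real.sqrt ((n : ℝ) ^ (3 - ε'))) * Real.log n) := by
  have hℓ := one_le_log_natCast hn
  have hn3 : (3 : ℝ) ≤ n := by exact_mod_cast hn
  have hn0 : (0 : ℝ) < n := by linarith
  have h1 : (n : ℝ) ^ (1 - ε') * n ^ 2 = (n : ℝ) ^ (3 - ε') := by
    rw [← Real.rpow_natCast, ← Real.rpow_add hn0]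
    congr 1
    push_cast
    ring
  have h2 : Real.sqrt (6 * (n : ℝ) ^ (1 - ε') * n ^ 2) ≤ 3 * Real.sqrt ((n : ℝ) ^ (3 - ε')) := by
    rw [mul_assoc, h1]
    refine Real.sqrt_le_iff.2 ⟨by positivity, ?_⟩
    rw [mul_pow, Real.sq_sqrt (by positivity)]
    have : (0 : ℝ) ≤ (n : ℝ) ^ (3 - ε') := by positivity
    linarith
  have h3 := Nat.ceil_lt_add_one (Real.sqrt_nonneg (6 * (n : ℝ) ^ (1 - ε') * n ^ 2))
  unfold triSearchCost
  push_cast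
  calc (reps c n : ℝ) * ((2 * (⌈Real.sqrt (6 * (n : ℝ) ^ (1 - ε') * n ^ 2)⌉₊ : ℝ) + 2) * 3)
      ≤ 2 * c * Real.log n * (18 * (n + Real.sqrt ((n : ℝ) ^ (3 - ε')))) :=
        mul_le_mul (cast_reps_le hc hn) (by linarith) (by positivity) (by positivity)
    _ = _ := by ring

theorem mul_foundPairs_le {ε δ ε' : ℝ} (hδ : 0 ≤ δ) (hε' : 0 ≤ ε') (hn : 3 ≤ n) :
    n * foundPairs ε δ ε' n ≤ 210 * (n : ℝ) ^ (3 - min δ (ε - δ - ε')) := by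
  have hn1 : (1 : ℝ) ≤ n := by exact_mod_cast (by omega : 1 ≤ n)
  have hn0 : (0 : ℝ) < n := by linarith
  have h1 : (n : ℝ) ^ 2 * (n : ℝ) ^ (1 - δ) ≤ (n : ℝ) ^ (3 - min δ (ε - δ - ε')) := by
    rw [← Real.rpow_natCast, ← Real.rpow_add hn0]
    refine Real.rpow_le_rpow_of_exponent_le hn1 ?_
    push_cast
    linarith [min_le_left δ (ε - δ - ε')]
  have h2 : (n : ℝ) ^ (δ + ε') * ((n : ℝ) ^ 2 * (n : ℝ) ^ (1 - ε)) ≤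
      (n : ℝ) ^ (3 - min δ (ε - δ - ε')) := by
    rw [← Real.rpow_natCast, ← Real.rpow_add hn0, ← Real.rpow_add hn0]
    refine Real.rpow_le_rpow_of_exponent_le hn1 ?_
    push_cast
    linarith [min_le_right δ (ε - δ - ε')]
  have h3 : (highRounds δ ε' n : ℝ) * ((n : ℝ) ^ 2 * (n : ℝ) ^ (1 - ε)) ≤
      101 * (n : ℝ) ^ (δ + ε') * ((n : ℝ) ^ 2 * (n : ℝ) ^ (1 - ε)) := by
    gcongr
    exact cast_highRounds_le hδ hε' hn
  unfold foundPairs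
  linarith

theorem cast_edgeSearchCost_le {c M : ℝ} (hc : 1 ≤ c) (hn : 3 ≤ n) :
    (edgeSearchCost c n M : ℝ) ≤
      528 * c ^ 2 * ((n + Real.sqrt (n * M)) * Real.log n ^ 2) := by
  have hℓ := one_le_log_natCast hn
  have hn1 : (1 : ℝ) ≤ n := by exact_mod_cast (by omega : 1 ≤ n)
  have h1 : ((Nat.log 2 (n ^ 2) : ℕ) : ℝ) + 1 ≤ 4 * Real.log n := by
    have h2 : ((Nat.log 2 (n ^ 2) : ℕ) : ℝ) * Real.log 2 ≤ 2 * Real.log n := by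
      have h3 : ((2 : ℕ) ^ Nat.log 2 (n ^ 2) : ℝ) ≤ (n : ℝ) ^ 2 := by
        exact_mod_cast Nat.pow_log_le_self 2 (by positivity : n ^ 2 ≠ 0)
      have h4 := Real.log_le_log (by positivity) h3
      rwa [Real.log_pow, Real.log_pow] at h4
    have h5 := Real.log_two_gt_d9
    nlinarith [Nat.cast_nonneg (α := ℝ) (Nat.log 2 (n ^ 2))]
  have h2 : (edgeAttemptBound c n M : ℝ) ≤ 66 * (c * (n + Real.sqrt (n * M))) := by
    have hs := Real.sqrt_nonneg (n * M)
    have h3 : 1 ≤ c * (n + Real.sqrt (n * M)) :=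
      one_le_mul_of_one_le_of_one_le hc (by linarith)
    have h4 := natCeil_le_add_mul (a := 65) (x := 65 * c * (n + Real.sqrt (n * M)))
      (by positivity) (mul_assoc _ _ _).le h3
    unfold edgeAttemptBound
    linarith
  unfold edgeSearchCost
  push_cast
  calc (((Nat.log 2 (n ^ 2) : ℕ) : ℝ) + 1) * (reps c n * edgeAttemptBound c n M)
      ≤ (4 * Real.log n) * ((2 * c * Real.log n) * (66 * (c * (n + Real.sqrt (n * M))))) := by
        gcongr
        exact cast_reps_le hc hn
    _ = _ := by ring

end Threshold

/-- The order of magnitude of the number of queries; the four terms belong to the first step, the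
sampling and the rounds with the high degree hypothesis, the search among the triangles of `T`, and
the search for a triangle with an edge in `E`. -/
noncomputable def queryOrder (ε δ ε' : ℝ) (n : ℕ) : ℝ :=
  (n : ℝ) ^ (1 + ε) + (n : ℝ) ^ (1 + δ + ε') + Real.sqrt ((n : ℝ) ^ (3 - ε'))
    + Real.sqrt ((n : ℝ) ^ (3 - min δ (ε - δ - ε')))

theorem cast_threshold_le {ε δ ε' c : ℝ} (hc : 1 ≤ c) (hε : 0 ≤ ε) (hδ : 0 ≤ δ) (hε' : 0 ≤ ε')
    {n : ℕ} (hn : 3 ≤ n) :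
    (threshold ε δ ε' c n : ℝ) ≤ 10000 * c ^ 2 * (queryOrder ε δ ε' n * Real.log n ^ 2) := by
  have hℓ := one_le_log_natCast hn
  have hn1 : (1 : ℝ) ≤ n := by exact_mod_cast (by omega : 1 ≤ n)
  have hn0 : (0 : ℝ) < n := by linarith
  set ℓ := Real.log n with hℓdef
  set g₁ := (n : ℝ) ^ (1 + ε) with hg₁
  set g₂ := (n : ℝ) ^ (1 + δ + ε') with hg₂
  set g₃ := Real.sqrt ((n : ℝ) ^ (3 - ε')) with hg₃
  set g₄ := Real.sqrt ((n : ℝ) ^ (3 - min δ (ε - δ - ε'))) with hg₄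
  have hg₃0 : 0 ≤ g₃ := Real.sqrt_nonneg _
  have hg₄0 : 0 ≤ g₄ := Real.sqrt_nonneg _
  have hng₁ : (n : ℝ) ≤ g₁ := by
    simpa using Real.rpow_le_rpow_of_exponent_le hn1 (by linarith : (1 : ℝ) ≤ 1 + ε)
  have hg₁' : (n : ℝ) ^ ε * n = g₁ := by
    rw [hg₁, add_comm 1, Real.rpow_add hn0, Real.rpow_one]
  have hg₂' : (n : ℝ) ^ (δ + ε') * n = g₂ := by
    rw [hg₂, add_assoc, add_comm 1, Real.rpow_add hn0 _ 1, Real.rpow_one]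
  have hδg₂ : n * (n : ℝ) ^ δ ≤ g₂ := by
    rw [← hg₂', mul_comm]
    gcongr
    linarith
  have hng₂ : (n : ℝ) ^ (δ + ε') ≤ g₂ := by
    rw [← hg₂']
    exact le_mul_of_one_le_right (by positivity) hn1
  have hg₁0 : 0 ≤ g₁ := by positivity
  have hg₂0 : 0 ≤ g₂ := by positivity
  have hm : ((min (coverSize ε n) n : ℕ) : ℝ) ≤ 5 * ((n : ℝ) ^ ε * ℓ) :=
    le_trans (Nat.cast_le.2 (min_le_left _ _)) (cast_coverSize_le hε hn)
  have hh := cast_highRounds_le hδ hε' hn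
  -- all terms are compared with `c ^ 2 * g * ℓ ^ 2`
  have hc2 : c ≤ c ^ 2 := by nlinarith
  have hℓ2 : ℓ ≤ ℓ ^ 2 := by nlinarith
  have hcℓ : c * ℓ ≤ c ^ 2 * ℓ ^ 2 := by gcongr
  have hℓc : ℓ ≤ c ^ 2 * ℓ ^ 2 := by nlinarith
  have h1c : 1 ≤ c ^ 2 * ℓ ^ 2 := by nlinarith
  have t1 : ((min (coverSize ε n) n : ℕ) : ℝ) * n ≤ 5 * (g₁ * (c ^ 2 * ℓ ^ 2)) :=
    calc _ ≤ 5 * ((n : ℝ) ^ ε * ℓ) * n := by gcongr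
      _ = 5 * (g₁ * ℓ) := by rw [← hg₁']; ring
      _ ≤ _ := by gcongr
  have t2 : ((min (coverSize ε n) n : ℕ) : ℝ) * nbrSearchCost c n ≤
      40 * (g₁ * (c ^ 2 * ℓ ^ 2)) :=
    calc _ ≤ 5 * ((n : ℝ) ^ ε * ℓ) * (8 * c * (n * ℓ)) :=
          mul_le_mul hm (cast_nbrSearchCost_le hc hn) (by positivity) (by positivity)
      _ = 40 * (g₁ * (c * ℓ ^ 2)) := by rw [← hg₁']; ring
      _ ≤ _ := by gcongr
  have t3 : (n : ℝ) * lowCost c δ n ≤ 4 * (g₂ * (c ^ 2 * ℓ ^ 2)) :=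
    calc _ ≤ n * (4 * c * ((n : ℝ) ^ δ * ℓ)) := by
          gcongr
          exact cast_lowCost_le hc hδ hn
      _ = 4 * (n * (n : ℝ) ^ δ * (c * ℓ)) := by ring
      _ ≤ _ := by gcongr
  have t4 : (highRounds δ ε' n : ℝ) * highCost c δ n ≤ 1111 * (g₂ * (c ^ 2 * ℓ ^ 2)) :=
    calc _ ≤ 101 * (n : ℝ) ^ (δ + ε') * (11 * c * (n * ℓ)) :=
          mul_le_mul hh (cast_highCost_le hc hn) (by positivity) (by positivity)
      _ = 1111 * (g₂ * (c * ℓ)) := by rw [← hg₂']; ring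
      _ ≤ _ := by gcongr
  have t5 : (triSearchCost c n (6 * (n : ℝ) ^ (1 - ε') * n ^ 2) : ℝ) ≤
      36 * ((g₁ + g₃) * (c ^ 2 * ℓ ^ 2)) :=
    calc _ ≤ 36 * c * ((n + g₃) * ℓ) := cast_triSearchCost_le hc hn
      _ = 36 * ((n + g₃) * (c * ℓ)) := by ring
      _ ≤ _ := by gcongr
  have t6 : (edgeSearchCost c n (foundPairs ε δ ε' n) : ℝ) ≤
      528 * ((g₁ + 15 * g₄) * (c ^ 2 * ℓ ^ 2)) := by
    have hs : Real.sqrt (n * foundPairs ε δ ε' n) ≤ 15 * g₄ := by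
      refine Real.sqrt_le_iff.2 ⟨by positivity, (mul_foundPairs_le hδ hε' hn).trans ?_⟩
      rw [mul_pow, Real.sq_sqrt (by positivity)]
      gcongr
      norm_num
    calc _ ≤ 528 * c ^ 2 * ((n + Real.sqrt (n * foundPairs ε δ ε' n)) * ℓ ^ 2) :=
          cast_edgeSearchCost_le hc hn
      _ = 528 * ((n + Real.sqrt (n * foundPairs ε δ ε' n)) * (c ^ 2 * ℓ ^ 2)) := by ring
      _ ≤ _ := by gcongr
  have t7 : (n : ℝ) ≤ g₁ * (c ^ 2 * ℓ ^ 2) := hng₁.trans (le_mul_of_one_le_right hg₁0 h1c)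
  have t8 : (highRounds δ ε' n : ℝ) ≤ 101 * (g₂ * (c ^ 2 * ℓ ^ 2)) :=
    hh.trans (by gcongr; exact hng₂.trans (le_mul_of_one_le_right hg₂0 h1c))
  have p1 : 0 ≤ g₁ * (c ^ 2 * ℓ ^ 2) := by positivity
  have p2 : 0 ≤ g₂ * (c ^ 2 * ℓ ^ 2) := by positivity
  have p3 : 0 ≤ g₃ * (c ^ 2 * ℓ ^ 2) := by positivity
  have p4 : 0 ≤ g₄ * (c ^ 2 * ℓ ^ 2) := by positivity
  unfold threshold queryOrder
  push_cast at t1 t2 ⊢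
  linarith

/-- The algorithm has query complexity `Õ(g)` for every `g` that dominates `queryOrder`. -/
theorem findsTrianglesWithin_of_le {ε δ ε' c : ℝ} (hc : 512 ≤ c) (hε : 0 ≤ ε) (hδ : 0 ≤ δ)
    (hε' : 0 ≤ ε') {g : ℕ → ℝ} {K : ℝ} (hK : 0 ≤ K)
    (hg : ∀ n : ℕ, 1 ≤ n → queryOrder ε δ ε' n ≤ K * g n) :
    FindsTrianglesWithin
      (fun n => combinatorialAlgorithm ε δ ε' c n (threshold ε δ ε' c n)) g := by
  refine ⟨findsTriangles_combinatorialAlgorithm hc hδ, ⟨2, ?_⟩,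
    fun n => onlyGrover_combinatorialAlgorithm _ _ _ _ _ _⟩
  refine Asymptotics.IsBigO.of_bound (10000 * c ^ 2 * K) ?_
  filter_upwards [Filter.eventually_ge_atTop 3] with n hn
  rw [Real.norm_of_nonneg (Nat.cast_nonneg _)]
  calc ((combinatorialAlgorithm ε δ ε' c n (threshold ε δ ε' c n)).queries : ℝ)
      ≤ threshold ε δ ε' c n := Nat.cast_le.2 (queries_combinatorialAlgorithm_le _ _ _ _ _ _)
    _ ≤ 10000 * c ^ 2 * (queryOrder ε δ ε' n * Real.log n ^ 2) :=
        cast_threshold_le (by linarith) hε hδ hε' hn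
    _ ≤ 10000 * c ^ 2 * (K * g n * Real.log n ^ 2) := by
        gcongr
        exact hg n (by omega)
    _ = 10000 * c ^ 2 * K * (g n * Real.log n ^ 2) := by ring
    _ ≤ _ := by
        gcongr
        exact Real.le_norm_self _

/-- The parameters that balance the first and the last two terms. -/
theorem queryOrder_optimal_le {n : ℕ} (hn : 1 ≤ n) :
    queryOrder (3 / 7) (1 / 7) (1 / 7) n ≤ 4 * (n : ℝ) ^ (10 / 7 : ℝ) := by
  have hn1 : (1 : ℝ) ≤ n := by exact_mod_cast hn
  have hsqrt : Real.sqrt ((n : ℝ) ^ (3 - 1 / 7 : ℝ)) = (n : ℝ) ^ (10 / 7 : ℝ) := by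
    rw [Real.sqrt_eq_rpow, ← Real.rpow_mul (Nat.cast_nonneg n)]
    norm_num
  have hmin : min (1 / 7 : ℝ) (3 / 7 - 1 / 7 - 1 / 7) = 1 / 7 := by norm_num
  have h1 : (n : ℝ) ^ (1 + 3 / 7 : ℝ) = (n : ℝ) ^ (10 / 7 : ℝ) := by norm_num
  have h2 : (n : ℝ) ^ (1 + 1 / 7 + 1 / 7 : ℝ) ≤ (n : ℝ) ^ (10 / 7 : ℝ) :=
    Real.rpow_le_rpow_of_exponent_le hn1 (by norm_num)
  unfold queryOrder
  rw [hmin, hsqrt, h1]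
  linarith

end Triangle

theorem theorem1 :
    ∃ c₀ : ℝ, ∀ c : ℝ, c₀ ≤ c →
      (∀ ε δ ε' : ℝ, 0 < ε → ε < 1 → 0 ≤ δ → 0 ≤ ε' →
        ∃ B : ℕ → ℕ,
          Triangle.FindsTrianglesWithin
            (fun n => Triangle.combinatorialAlgorithm ε δ ε' c n (B n))
            (fun n => (n : ℝ) ^ (1 + ε) + (n : ℝ) ^ (1 + δ + ε') + Real.sqrt ((n : ℝ) ^ (3 - ε'))
              + Real.sqrt ((n : ℝ) ^ (3 - min δ (ε - δ - ε'))))) ∧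
      ∃ B : ℕ → ℕ,
        Triangle.FindsTrianglesWithin
          (fun n => Triangle.combinatorialAlgorithm (3 / 7) (1 / 7) (1 / 7) c n (B n))
          (fun n => (n : ℝ) ^ (10 / 7 : ℝ)) := by
  refine ⟨512, fun c hc => ⟨fun ε δ ε' hε _ hδ hε' => ⟨_,
    Triangle.findsTrianglesWithin_of_le hc hε.le hδ hε' zero_le_one fun n _ => ?_⟩, ⟨_,
    Triangle.findsTrianglesWithin_of_le hc (by norm_num) (by norm_num) (by norm_num)
      (by norm_num : (0 : ℝ) ≤ 4) fun n hn => Triangle.queryOrder_optimal_le hn⟩⟩⟩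
  rw [one_mul]
  rfl
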